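/- **Setting.** A *real quiver of rank 3* is a skew-symmetric matrix $B\in\mathbb R^{3\times3}$ (an arrow $i\to j$ of weight $b_{ij}$ whenever $b_{ij}>0$). *Mutation* at $k$ replaces $B$ by $\mu_k(B)=B'$ with $b'_{ij}=-b_{ij}$ if $k\in\{i,j\}$ and $b'_{ij}=b_{ij}+\tfrac12(b_{ik}|b_{kj}|+|b_{ik}|b_{kj})$ otherwise. $B$ is *mutation-finite* if only finitely many matrices arise from it by sequences of mutations, and *acyclic* if the quiver has no oriented cycle. The *Markov quiver* is the oriented triangle with all weights $2$. Let $V$ be a real vector space of dimension $3$ with a symmetric bilinear form $(\cdot,\cdot)$. A *seed* $(\mathbf v,B)$ consists of a skew-symmetric $B$ and a basis $\mathbf v=(v_1,v_2,v_3)$ of $V$ with $(v_i,v_i)=2$, $|(v_i,v_j)|=|b_{ij}|$ for $i\ne j$, such that, if $(v_i,v_j)\neq0$ for all $i\ne j$, the number of pairs $i<j$ with $(v_i,v_j)>0$ is even if $B$ is acyclic and odd otherwise. Seeds are identified up to simultaneous permutation of the vectors and of the rows and columns of $B$. Given a set $V^+\subseteq V$ of *positive* vectors, the mutation of $(\mathbf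 v,B)$ at $k$ is $(\mathbf v',\mu_k(B))$ with $v_k'=-v_k$ and, for $i\neq k$, $v_i'=v_i-(v_i,v_k)v_k$ if either $v_k\in V^+$ and $b_{ik}<0$, or $v_k\notin V^+$ and $b_{ik}>0$, and $v_i'=v_i$ otherwise. The *exchange graph* $\Gamma$ of an initial seed has as vertices the seeds obtained from it by sequences of mutations; two distinct vertices are joined by an edge if they are related by one mutation. For a vertex $x_0$ of $\Gamma$ let $\mathrm{gr}(m)$ be the number of vertices at distance at most $m$ from $x_0$. $\Gamma$ has *polynomial growth* if all $\mathrm{gr}(m)$ are finite and $\mathrm{gr}(m)=O(m^r)$ for some $r$; its *growth rate* is the smallest natural number $r$ with $\mathrm{gr}(m)=O(m^r)$. **Affine case.** Let $V$ be the space of affine functions $f(x)=\langle a,x\rangle+c$ on $\mathbb E^2$ with $(f,f')=\langle a,a'\rangle$. Let $(\mathbf v_0,B_0)$ be a seed in $V$ with $B_0$ acyclic and mutation-finite whose domain $\Delta_0=\{x: f_i(x)<0,\ i=1,2,3\}$ is a (nonempty, bounded) triangle. Choose a source $i$ and a sink $k$ of $B_0$ with $b_{ik}>0$, let $H_i,H_k$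 be the feet of the altitudes of $\Delta_0$ on the corresponding sides, and let the *belt line* be the line through $H_i$ and $H_k$. The reference point is the point infinitely far away on this line in the direction from $H_i$ to $H_k$: a function $f$ is positive if $f(H_i+t(H_k-H_i))<0$ for all sufficiently large $t$. Let $L\subset\mathbb R$ be the $\mathbb Z$-module spanned by the lengths of all vectors $w\in\mathbb E^2$ such that $\Gamma$ contains two seeds which differ by the translation by $w$ (same quiver, triple of functions translated by $w$). **Corollary 5.6.** (1) In the affine case, for every base vertex: $\Gamma$ has polynomial growth, $L$ is finitely generated, and the growth rate of $\Gamma$ equals the rank of $L$. If moreover the angles of $\Delta_0$ are rational multiples $r_1\pi,r_2\pi,r_3\pi$ of $\pi$ such that the least common denominator of $r_1,r_2,r_3$ is $2n+1$ with $n\ge1$ (for example $\frac{\pi}{2n+1},\frac{n\pi}{2n+1},\frac{n\pi}{2n+1}$), then the growth rate of $\Gamma$ and the rank of $L$ are both equal to $\varphi(2n+1)/2$. (2) More generally, let $(\mathbf v,B)$ be any seed in any three-dimensional $V$ such that $B$ is mutation-finite and not the Markov quiver (in either orientation), and let $V^+\subseteq V$ be any set of positive vectors. Then the exchange graph of $(\mathbf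 v,B)$ has polynomial growth. -/

import Mathlib

open Filter Asymptotics

noncomputable section

/-! Real quivers with three vertices, encoded by skew-symmetric real `3 × 3` matrices `B`:
there is an arrow `i → j` of weight `B i j` whenever `0 < B i j`. -/

/-- Matrix mutation `μ_k`. -/
def mutateMatrix (k : Fin 3) (B : Matrix (Fin 3) (Fin 3) ℝ) : Matrix (Fin 3) (Fin 3) ℝ :=
  Matrix.of fun i j =>
    if i = k ∨ j = k then -B i j
    else B i j + (B i k * |B k j| + |B i k| * B k j) / 2

/-- The matrices that arise from `B` by finite sequences of mutations. -/
def mutationClass (B : Matrix (Fin 3) (Fin 3) ℝ) : Set (Matrix (Fin 3) (Fin 3) ℝ) :=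
  {B' | ∃ ks : List (Fin 3), B' = ks.foldl (fun M k => mutateMatrix k M) B}

def IsMutationFinite (B : Matrix (Fin 3) (Fin 3) ℝ) : Prop :=
  (mutationClass B).Finite

/-- The quiver of `B` has no oriented cycle. -/
def IsAcyclic (B : Matrix (Fin 3) (Fin 3) ℝ) : Prop :=
  ∀ i, ¬ Relation.TransGen (fun a b => 0 < B a b) i i

/-- The Markov quiver: an oriented triangle with all weights equal to `2`. The oppositely oriented
(isomorphic) quiver is `-markovMatrix`. -/
def markovMatrix : Matrix (Fin 3) (Fin 3) ℝ :=
  !![0, 2, -2; -2, 0, 2; 2, -2, 0]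

/-! Seeds. -/

/-- A triple of vectors together with an exchange matrix. The conditions which make it a
seed are stated in `IsSeed`. -/
@[ext] structure Seed (V : Type*) where
  vec : Fin 3 → V
  mat : Matrix (Fin 3) (Fin 3) ℝ

section Seeds

variable {V : Type*} [AddCommGroup V] [Module ℝ V]

/-- `v` is a geometric realisation of `B` in the three-dimensional quadratic space `(V, Q)`. -/
structure IsGeometricRealisation (Q : LinearMap.BilinForm ℝ V) (v : Fin 3 → V)
    (B : Matrix (Fin 3) (Fin 3) ℝ) : Prop where
  linearIndependent : LinearIndependent ℝ v
  span_eq_top : Submodule.span ℝ (Set.range v) = ⊤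
  self_eq_two : ∀ i, Q (v i) (v i) = 2
  abs_eq : ∀ i j, i ≠ j → |Q (v i) (v j)| = |B i j|
  even_of_acyclic : (∀ i j, i ≠ j → Q (v i) (v j) ≠ 0) → IsAcyclic B →
    Even {p : Fin 3 × Fin 3 | p.1 < p.2 ∧ 0 < Q (v p.1) (v p.2)}.ncard
  odd_of_cyclic : (∀ i j, i ≠ j → Q (v i) (v j) ≠ 0) → ¬ IsAcyclic B →
    Odd {p : Fin 3 × Fin 3 | p.1 < p.2 ∧ 0 < Q (v p.1) (v p.2)}.ncard

/-- A seed: a skew-symmetric matrix together with a geometric realisation. -/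
structure IsSeed (Q : LinearMap.BilinForm ℝ V) (s : Seed V) : Prop where
  skew : s.mat.transpose = -s.mat
  realisation : IsGeometricRealisation Q s.vec s.mat

open Classical in
/-- Seed mutation at `k` by partial reflections, where `pos` is the set of positive vectors:
if `v_k` is positive, the vectors `v_i` with an arrow `k → i` are reflected in `v_k`; otherwise
those with an arrow `i → k` are reflected (recall `Q v_k v_k = 2`). -/
def mutateSeed (Q : LinearMap.BilinForm ℝ V) (pos : Set V) (k : Fin 3) (s : Seed V) : Seed V where
  vec i :=
    if i = k then -s.vec k
    else if (s.vec k ∈ pos ∧ s.mat i k < 0) ∨ (s.vec k ∉ pos ∧ 0 < s.mat i k) then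
      s.vec i - Q (s.vec i) (s.vec k) • s.vec k
    else s.vec i
  mat := mutateMatrix k s.mat

end Seeds

/-- Seeds are regarded up to simultaneous renumbering of vectors and of rows and columns. -/
def seedSetoid (V : Type*) : Setoid (Seed V) where
  r s t := ∃ σ : Equiv.Perm (Fin 3), t.vec = s.vec ∘ σ ∧ t.mat = s.mat.submatrix σ σ
  iseqv :=
    { refl := fun s => ⟨1, rfl, by ext; rfl⟩
      symm := by
        rintro s t ⟨σ, h₁, h₂⟩
        refine ⟨σ⁻¹, ?_, ?_⟩
        · rw [h₁]; ext i; simp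
        · rw [h₂]; ext i j; simp
      trans := by
        rintro s t u ⟨σ, h₁, h₂⟩ ⟨τ, h₃, h₄⟩
        refine ⟨σ * τ, ?_, ?_⟩
        · rw [h₃, h₁]; rfl
        · rw [h₄, h₂]; ext i j; rfl }

/-- Unlabelled seeds. -/
abbrev USeed (V : Type*) := Quotient (seedSetoid V)

def Seed.unlabelled {V : Type*} (s : Seed V) : USeed V := Quotient.mk (seedSetoid V) s

section ExchangeGraph

variable {V : Type*} [AddCommGroup V] [Module ℝ V]

/-- The unlabelled seeds obtained from the initial seed `s` by finite sequences of mutations. -/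
def exchangeVertices (Q : LinearMap.BilinForm ℝ V) (pos : Set V) (s : Seed V) : Set (USeed V) :=
  {x | ∃ ks : List (Fin 3), x = (ks.foldl (fun t k => mutateSeed Q pos k t) s).unlabelled}

/-- The exchange graph of `s`: two distinct vertices are adjacent if they are related by a single
mutation. -/
def exchangeGraph (Q : LinearMap.BilinForm ℝ V) (pos : Set V) (s : Seed V) :
    SimpleGraph (exchangeVertices Q pos s) where
  Adj x y := x ≠ y ∧ ∃ (t : Seed V) (k : Fin 3),
    (x.1 = t.unlabelled ∧ y.1 = (mutateSeed Q pos k t).unlabelled) ∨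
    (y.1 = t.unlabelled ∧ x.1 = (mutateSeed Q pos k t).unlabelled)
  symm := ⟨by
    rintro x y ⟨h, t, k, h'⟩
    exact ⟨h.symm, t, k, h'.symm⟩⟩
  loopless := ⟨fun _ h => h.1 rfl⟩

end ExchangeGraph

/-! Growth of a connected graph from a base vertex. -/

section Growth

variable {X : Type*}

/-- The number of vertices at distance at most `m` from `x`. -/
def growth (G : SimpleGraph X) (x : X) (m : ℕ) : ℕ := {y | G.dist x y ≤ m}.ncard

def HasGrowthAtMost (G : SimpleGraph X) (x : X) (r : ℕ) : Prop :=
  (fun m : ℕ => (growth G x m : ℝ)) =O[atTop] fun m : ℕ => (m : ℝ) ^ r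

/-- Polynomial growth (the balls being finite, so that `growth` really counts them). -/
def HasPolynomialGrowth (G : SimpleGraph X) (x : X) : Prop :=
  (∀ m : ℕ, {y | G.dist x y ≤ m}.Finite) ∧ ∃ r, HasGrowthAtMost G x r

/-- `r` is the (polynomial) growth rate: the smallest natural number with `growth = O(m ^ r)`. -/
def IsGrowthRate (G : SimpleGraph X) (x : X) (r : ℕ) : Prop :=
  (∀ m : ℕ, {y | G.dist x y ≤ m}.Finite) ∧ IsLeast {r | HasGrowthAtMost G x r} r

end Growth

/-! The Euclidean plane. -/

abbrev Plane := EuclideanSpace ℝ (Fin 2)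

/-- Affine functions on the plane; `(a, c)` stands for `x ↦ ⟪a, x⟫ + c`. -/
abbrev AffineFun := Plane × ℝ

def AffineFun.eval (f : AffineFun) (x : Plane) : ℝ := inner ℝ f.1 x + f.2

/-- The degenerate quadratic structure on affine functions: inner product of the gradients. -/
def planeForm : LinearMap.BilinForm ℝ AffineFun :=
  (innerₗ Plane).compl₁₂ (LinearMap.fst ℝ Plane ℝ) (LinearMap.fst ℝ Plane ℝ)

/-- The domain of a seed: the intersection of the three open half-planes `f_i < 0`. -/
def domain (s : Seed AffineFun) : Set Plane := {x | ∀ i, AffineFun.eval (s.vec i) x < 0}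

/-- A seed in the plane whose domain is a (nonempty, bounded) triangle. Its sides lie
on the lines `f_i = 0`, and the gradients are outward normal vectors. -/
def IsTriangleSeed (s : Seed AffineFun) : Prop :=
  IsSeed planeForm s ∧ (domain s).Nonempty ∧ Bornology.IsBounded (domain s)

/-- `H` is the foot of the altitude onto the side `f_i = 0`. Here `X` is the opposite corner. -/
def IsAltitudeFoot (s : Seed AffineFun) (i : Fin 3) (H : Plane) : Prop :=
  ∃ X : Plane, (∀ j, j ≠ i → AffineFun.eval (s.vec j) X = 0) ∧
    AffineFun.eval (s.vec i) H = 0 ∧ ∃ c : ℝ, H = X + c • (s.vec i).1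

/-- `pos` is the set of positive vectors determined by the acyclic triangle seed `s`. The belt line
goes through the feet `Hi`, `Hk` of the altitudes on the sides which are the source `i` and
the sink `k` of the quiver. The reference point lies infinitely far away on it, in the direction
from source to sink, and `f` is positive if that point belongs to the half-plane `f < 0`. -/
def IsBeltPositivity (s : Seed AffineFun) (pos : Set AffineFun) : Prop :=
  ∃ (i k : Fin 3) (Hi Hk : Plane),
    (∀ j, 0 ≤ s.mat i j) ∧ (∀ j, 0 ≤ s.mat j k) ∧ 0 < s.mat i k ∧
    IsAltitudeFoot s i Hi ∧ IsAltitudeFoot s k Hk ∧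
    pos = {f | ∀ᶠ t : ℝ in atTop, AffineFun.eval f (Hi + t • (Hk - Hi)) < 0}

/-- The angles of the triangle are `r i * π`, the `i`-th one being opposite to the `i`-th side
(the gradients are outward normals of length `√2`). -/
def HasAngles (s : Seed AffineFun) (r : Fin 3 → ℚ) : Prop :=
  (∀ i, 0 < r i ∧ r i < 1) ∧
  ∀ i j k, i ≠ j → j ≠ k → i ≠ k →
    planeForm (s.vec j) (s.vec k) = -(2 * Real.cos (r i * Real.pi))

/-- All angles are rational multiples of `π`, and `d` is the least common denominator. -/
def HasDenominator (s : Seed AffineFun) (d : ℕ) : Prop :=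
  ∃ r : Fin 3 → ℚ, HasAngles s r ∧ d = Nat.lcm (r 0).den (Nat.lcm (r 1).den (r 2).den)

/-- Translation of a seed by `w`: every `f` is replaced by `x ↦ f (x - w)`. -/
def translateSeed (w : Plane) (s : Seed AffineFun) : Seed AffineFun where
  vec i := ((s.vec i).1, (s.vec i).2 - inner ℝ (s.vec i).1 w)
  mat := s.mat

/-- The lattice `L`: the `ℤ`-module spanned by the lengths of all vectors `w` such that the
exchange graph of `s` contains two seeds which differ by the translation by `w`. -/
def translationLattice (pos : Set AffineFun) (s : Seed AffineFun) : Submodule ℤ ℝ :=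
  Submodule.span ℤ {l | ∃ (w : Plane) (t : Seed AffineFun),
    t.unlabelled ∈ exchangeVertices planeForm pos s ∧
    (translateSeed w t).unlabelled ∈ exchangeVertices planeForm pos s ∧ l = ‖w‖}

end

/-! Polynomial growth. Mutation is studied with freely chosen signs, which makes the set `V^+`
irrelevant. The three products of the vectors of a seed move by Vieta involutions `t_k ↦ t_i t_j -
t_k`, each of which is realised by mutations of the quiver; so a mutation-finite quiver gives a
triple with a finite Vieta orbit. If at least two of the three numbers are nonzero, finiteness has
two consequences (`exists_rootOfUnity_of_finite`, `isBoundedTriple_of_finite`): they have the form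
`ζ + ζ⁻¹` with `ζ` a root of unity, and their Gram matrix is positive semidefinite. Both properties
hold for all Galois conjugates as well, since conjugate triples again have finite orbits. A vector
of square length 2 with integral coordinates therefore has products with the basis that are
algebraic integers in a fixed number field with all conjugates at most 2 in absolute value, and
there are only finitely many of these (`finite_pairings`). So modulo the radical of the form there
are finitely many types of seeds.

Apart from the Markov quiver the radical is at most a line, and seeds of one type differ by a map `1
+ h` with `h` vanishing on the radical and taking values in it. Such maps commute with each other
and with signed mutations, and `m` mutations compose boundedly many fixed shifts, each used at most
`m` times. This bounds the number of seeds polynomially. If one vertex of the quiver is isolated,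
the seeds are described by a dihedral recurrence.

Growth rate. For an acyclic triangle let `ω` be the skew form with `ω(v_i, v_j) = b_ij` and let `δ`
be the constant function 1. The derivative along the belt line is, up to a negative factor, `slope =
ω(δ, ·)`. Two normal forms of triples, one acyclic and one cyclic, are preserved by all mutations,
and the matrix always consists of the values of the same `ω` (`IsBeltSeed.mutateSeed`). Hence
mutation is an involution, and seeds of one type differ by a translation along the belt line. The
translations form a group acting freely and with finitely many orbits on the connected, locally
finite exchange graph, so its rank is the growth rate; scaling by a fixed length identifies this
group with `L`.

Odd denominator `N`. For each unit `κ` modulo `N` the Vieta orbit contains a triple with absolute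
values `2, ρ, ρ` and `4 - ρ² = 4 sin²(πκ/N)`. The corresponding seed bounds a strip, and two
mutations move it by a multiple of `1/sin²(πκ/N)` with a constant independent of `κ`. These numbers,
taken up to `κ ↦ -κ`, are independent over `ℤ`: a relation can be conjugated so that its largest
coefficient stands at `κ = ±1`, where the squared cosecant exceeds what all other terms can cancel.
This gives rank at least `φ(N)/2`. Conversely, coordinates of seeds lie in a real field of degree at
most `φ(N)/2`, and so does the translation group up to a homothety. -/

/-! ### Mutations with a prescribed choice of sign -/

section SignedMutation

variable {V : Type*} [AddCommGroup V] [Module ℝ V]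

/-- Seed mutation at `k`, where the sign of `v_k` is prescribed by `ε`. -/
noncomputable def signedMutation (Q : LinearMap.BilinForm ℝ V) (ε : Bool) (k : Fin 3)
    (s : Seed V) : Seed V where
  vec i :=
    if i = k then -s.vec k
    else if (ε = true ∧ s.mat i k < 0) ∨ (ε = false ∧ 0 < s.mat i k) then
      s.vec i - Q (s.vec i) (s.vec k) • s.vec k
    else s.vec i
  mat := mutateMatrix k s.mat

-- With the sign as a free parameter, mutation depends only on the form and the matrix. Counting
-- seeds over all sign choices then bounds the exchange graph for every `pos` at once.
open Classical in
theorem mutateSeed_eq_signedMutation (Q : LinearMap.BilinForm ℝ V) (pos : Set V) (k : Fin 3)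
    (s : Seed V) : mutateSeed Q pos k s = signedMutation Q (decide (s.vec k ∈ pos)) k s := by
  ext i
  · simp [mutateSeed, signedMutation]
  · rfl

/-- Simultaneous renumbering of vectors and of rows and columns. -/
def relabel {V : Type*} (σ : Equiv.Perm (Fin 3)) (s : Seed V) : Seed V where
  vec := s.vec ∘ σ
  mat := s.mat.submatrix σ σ

theorem unlabelled_eq_iff {V : Type*} {s t : Seed V} :
    s.unlabelled = t.unlabelled ↔ ∃ σ, t = relabel σ s := by
  unfold Seed.unlabelled
  rw [Quotient.eq]
  constructor
  · rintro ⟨σ, h1, h2⟩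
    exact ⟨σ, Seed.ext h1 h2⟩
  · rintro ⟨σ, rfl⟩
    exact ⟨σ, rfl, rfl⟩

@[simp] theorem relabel_unlabelled {V : Type*} (σ : Equiv.Perm (Fin 3)) (s : Seed V) :
    (relabel σ s).unlabelled = s.unlabelled :=
  (unlabelled_eq_iff.2 ⟨σ, rfl⟩).symm

theorem exists_unlabelled {V : Type*} (x : USeed V) : ∃ s : Seed V, s.unlabelled = x :=
  Quotient.exists_rep x

theorem mutateMatrix_submatrix (σ : Equiv.Perm (Fin 3)) (k : Fin 3)
    (B : Matrix (Fin 3) (Fin 3) ℝ) :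
    mutateMatrix k (B.submatrix σ σ) = (mutateMatrix (σ k) B).submatrix σ σ := by
  ext i j
  simp [mutateMatrix]

theorem signedMutation_relabel (Q : LinearMap.BilinForm ℝ V) (ε : Bool) (k : Fin 3)
    (σ : Equiv.Perm (Fin 3)) (s : Seed V) :
    signedMutation Q ε k (relabel σ s) = relabel σ (signedMutation Q ε (σ k) s) := by
  ext1
  · funext i
    simp only [signedMutation, relabel, Function.comp_apply, Matrix.submatrix_apply,
      EmbeddingLike.apply_eq_iff_eq]
    congr
  · exact mutateMatrix_submatrix σ k s.mat

theorem mutateSeed_relabel (Q : LinearMap.BilinForm ℝ V) (pos : Set V) (k : Fin 3)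
    (σ : Equiv.Perm (Fin 3)) (s : Seed V) :
    mutateSeed Q pos k (relabel σ s) = relabel σ (mutateSeed Q pos (σ k) s) := by
  simp only [mutateSeed_eq_signedMutation, signedMutation_relabel]
  rfl

@[simp] theorem mutateMatrix_mutateMatrix (k : Fin 3) (B : Matrix (Fin 3) (Fin 3) ℝ) :
    mutateMatrix k (mutateMatrix k B) = B := by
  ext i j
  by_cases h : i = k ∨ j = k
  · simp [mutateMatrix, h]
  · simp only [mutateMatrix, Matrix.of_apply, h, if_false, or_true, true_or, if_true, abs_neg]
    ring

theorem mutateMatrix_skew {B : Matrix (Fin 3) (Fin 3) ℝ} (hB : B.transpose = -B) (k : Fin 3) :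
    (mutateMatrix k B).transpose = -mutateMatrix k B := by
  have h : ∀ i j, B j i = -B i j := fun i j => congrFun (congrFun hB i) j
  ext i j
  by_cases hij : i = k ∨ j = k
  · have hij' : j = k ∨ i = k := hij.symm
    simp [mutateMatrix, hij, hij', h i j]
  · have hij' : ¬ (j = k ∨ i = k) := fun h => hij h.symm
    simp only [Matrix.transpose_apply, Matrix.neg_apply, mutateMatrix, Matrix.of_apply, hij, hij',
      if_false]
    rw [h i j, h k j, h i k, abs_neg, abs_neg]
    ring

/-- The first mutation negates `v_k` and the entries `b_ik`, so the opposite sign selects the same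
vectors, and these are reflected in the same hyperplane a second time. -/
theorem signedMutation_not_signedMutation {Q : LinearMap.BilinForm ℝ V} {s : Seed V} {k : Fin 3}
    (hk : Q (s.vec k) (s.vec k) = 2) (ε : Bool) :
    signedMutation Q (!ε) k (signedMutation Q ε k s) = s := by
  ext1
  · funext i
    by_cases h : i = k
    · subst h; simp [signedMutation]
    · by_cases h2 : (ε = true ∧ s.mat i k < 0) ∨ (ε = false ∧ 0 < s.mat i k)
      · have h3 : ((!ε) = true ∧ mutateMatrix k s.mat i k < 0) ∨
            ((!ε) = false ∧ 0 < mutateMatrix k s.mat i k) := by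
          simp only [mutateMatrix, Matrix.of_apply, or_true, if_true]
          cases ε <;> simpa using h2
        simp only [signedMutation, if_neg h, if_pos h2, if_pos h3, if_true]
        simp only [map_sub, map_smul, map_neg, LinearMap.sub_apply, LinearMap.smul_apply,
          smul_eq_mul, hk]
        module
      · have h3 : ¬ (((!ε) = true ∧ mutateMatrix k s.mat i k < 0) ∨
            ((!ε) = false ∧ 0 < mutateMatrix k s.mat i k)) := by
          simp only [mutateMatrix, Matrix.of_apply, or_true, if_true]
          cases ε <;> simpa using h2
        simp only [signedMutation, if_neg h, if_neg h2, if_neg h3]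
  · exact mutateMatrix_mutateMatrix k s.mat

/-- A property of vectors that is closed under negation and reflections is inherited by
mutations. -/
theorem signedMutation_induct {Q : LinearMap.BilinForm ℝ V} {P : V → Prop}
    (hneg : ∀ v, P v → P (-v)) (hrefl : ∀ v w, P v → P w → P (v - Q v w • w)) {s : Seed V}
    (hs : ∀ i, P (s.vec i)) (ε : Bool) (k i : Fin 3) : P ((signedMutation Q ε k s).vec i) := by
  simp only [signedMutation]
  split_ifs
  · exact hneg _ (hs k)
  · exact hrefl _ _ (hs i) (hs k)
  · exact hs i

theorem self_eq_two_signedMutation {Q : LinearMap.BilinForm ℝ V} (hQ : ∀ x y, Q x y = Q y x)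
    {s : Seed V} (hs : ∀ i, Q (s.vec i) (s.vec i) = 2) (ε : Bool) (k i : Fin 3) :
    Q ((signedMutation Q ε k s).vec i) ((signedMutation Q ε k s).vec i) = 2 := by
  refine signedMutation_induct (P := fun v => Q v v = 2) ?_ ?_ hs ε k i
  · intro v hv; simpa using hv
  · intro v w hv hw
    simp only [map_sub, map_smul, LinearMap.sub_apply, LinearMap.smul_apply, smul_eq_mul, hv, hw,
      hQ w v]
    ring

/-- `ReachedIn Q s m t`: at most `m` mutations, with free choice of signs, lead from `s`
to `t`. -/
inductive ReachedIn (Q : LinearMap.BilinForm ℝ V) (s : Seed V) : ℕ → Seed V → Prop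
  | refl : ReachedIn Q s 0 s
  | step {m : ℕ} {t : Seed V} (ε : Bool) (k : Fin 3) :
      ReachedIn Q s m t → ReachedIn Q s (m + 1) (signedMutation Q ε k t)
  | stay {m : ℕ} {t : Seed V} : ReachedIn Q s m t → ReachedIn Q s (m + 1) t

theorem ReachedIn.self_eq_two {Q : LinearMap.BilinForm ℝ V} (hQ : ∀ x y, Q x y = Q y x)
    {s : Seed V} (hs : ∀ i, Q (s.vec i) (s.vec i) = 2) {m : ℕ} {t : Seed V}
    (h : ReachedIn Q s m t) : ∀ i, Q (t.vec i) (t.vec i) = 2 := by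
  induction h with
  | refl => exact hs
  | step ε k _ ih => exact self_eq_two_signedMutation hQ ih ε k
  | stay _ ih => exact ih

theorem mutateMatrix_mem_mutationClass {B B' : Matrix (Fin 3) (Fin 3) ℝ}
    (h : B' ∈ mutationClass B) (k : Fin 3) : mutateMatrix k B' ∈ mutationClass B := by
  obtain ⟨ks, rfl⟩ := h
  exact ⟨ks ++ [k], by simp⟩

theorem self_mem_mutationClass (B : Matrix (Fin 3) (Fin 3) ℝ) : B ∈ mutationClass B :=
  ⟨[], rfl⟩

theorem ReachedIn.mat_mem {Q : LinearMap.BilinForm ℝ V} {s : Seed V} {m : ℕ} {t : Seed V}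
    (h : ReachedIn Q s m t) : t.mat ∈ mutationClass s.mat := by
  induction h with
  | refl => exact self_mem_mutationClass _
  | step ε k _ ih => exact mutateMatrix_mem_mutationClass ih k
  | stay _ ih => exact ih

theorem ReachedIn.mono {Q : LinearMap.BilinForm ℝ V} {s : Seed V} {m n : ℕ} {t : Seed V}
    (h : ReachedIn Q s m t) (hmn : m ≤ n) : ReachedIn Q s n t := by
  induction hmn with
  | refl => exact h
  | step _ ih => exact ih.stay

/-- The labelled seeds which are obtained from `s` by mutations. -/
def labelledSeeds (Q : LinearMap.BilinForm ℝ V) (pos : Set V) (s : Seed V) : Set (Seed V) :=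
  {t | ∃ ks : List (Fin 3), t = ks.foldl (fun t k => mutateSeed Q pos k t) s}

theorem mem_labelledSeeds_self (Q : LinearMap.BilinForm ℝ V) (pos : Set V) (s : Seed V) :
    s ∈ labelledSeeds Q pos s := ⟨[], rfl⟩

theorem mutateSeed_mem_labelledSeeds {Q : LinearMap.BilinForm ℝ V} {pos : Set V} {s t : Seed V}
    (h : t ∈ labelledSeeds Q pos s) (k : Fin 3) :
    mutateSeed Q pos k t ∈ labelledSeeds Q pos s := by
  obtain ⟨ks, rfl⟩ := h
  exact ⟨ks ++ [k], by simp⟩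

theorem labelledSeeds_induction {Q : LinearMap.BilinForm ℝ V} {pos : Set V} {s : Seed V}
    {P : Seed V → Prop} (h0 : P s)
    (h1 : ∀ t ∈ labelledSeeds Q pos s, ∀ k, P t → P (mutateSeed Q pos k t)) :
    ∀ t ∈ labelledSeeds Q pos s, P t := by
  rintro t ⟨ks, rfl⟩
  induction ks using List.reverseRecOn with
  | nil => exact h0
  | append_singleton ks k ih =>
    rw [List.foldl_append]
    exact h1 _ ⟨ks, rfl⟩ k ih

theorem mem_exchangeVertices {Q : LinearMap.BilinForm ℝ V} {pos : Set V} {s : Seed V}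
    {x : USeed V} :
    x ∈ exchangeVertices Q pos s ↔ ∃ t ∈ labelledSeeds Q pos s, x = t.unlabelled := by
  constructor
  · rintro ⟨ks, h⟩
    exact ⟨_, ⟨ks, rfl⟩, h⟩
  · rintro ⟨_, ⟨ks, rfl⟩, h⟩
    exact ⟨ks, h⟩

theorem mutateSeed_mem_exchangeVertices {Q : LinearMap.BilinForm ℝ V} {pos : Set V} {s t : Seed V}
    (h : t.unlabelled ∈ exchangeVertices Q pos s) (k : Fin 3) :
    (mutateSeed Q pos k t).unlabelled ∈ exchangeVertices Q pos s := by
  obtain ⟨u, hu, hut⟩ := mem_exchangeVertices.1 h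
  obtain ⟨σ, rfl⟩ := unlabelled_eq_iff.1 hut.symm
  rw [mutateSeed_relabel, relabel_unlabelled]
  exact mem_exchangeVertices.2 ⟨_, mutateSeed_mem_labelledSeeds hu _, rfl⟩

theorem ReachedIn.of_mem_labelledSeeds {Q : LinearMap.BilinForm ℝ V} {pos : Set V} {s t : Seed V}
    (h : t ∈ labelledSeeds Q pos s) : ∃ m, ReachedIn Q s m t := by
  refine labelledSeeds_induction (P := fun t => ∃ m, ReachedIn Q s m t) ⟨0, .refl⟩ ?_ t h
  rintro t - k ⟨m, hm⟩
  exact ⟨m + 1, by rw [mutateSeed_eq_signedMutation]; exact hm.step _ k⟩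

/-- Every exchange graph is connected. -/
theorem exchangeGraph_connected (Q : LinearMap.BilinForm ℝ V) (pos : Set V) (s : Seed V) :
    (exchangeGraph Q pos s).Connected := by
  have key : ∀ t (ht : t ∈ labelledSeeds Q pos s), (exchangeGraph Q pos s).Reachable
      ⟨s.unlabelled, mem_exchangeVertices.2 ⟨s, mem_labelledSeeds_self Q pos s, rfl⟩⟩
      ⟨t.unlabelled, mem_exchangeVertices.2 ⟨t, ht, rfl⟩⟩ := by
    intro t ht
    have := labelledSeeds_induction (Q := Q) (pos := pos) (s := s) (P := fun t =>
      ∀ ht : t ∈ labelledSeeds Q pos s, (exchangeGraph Q pos s).Reachable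
      ⟨s.unlabelled, mem_exchangeVertices.2 ⟨s, mem_labelledSeeds_self Q pos s, rfl⟩⟩
      ⟨t.unlabelled, mem_exchangeVertices.2 ⟨t, ht, rfl⟩⟩) (fun _ => .refl _) ?_ t ht ht
    · exact this
    · intro t ht k ih hk
      refine (ih ht).trans ?_
      by_cases hne : t.unlabelled = (mutateSeed Q pos k t).unlabelled
      · simp only [hne]; exact .refl _
      · exact SimpleGraph.Adj.reachable
          ⟨fun h => hne (congrArg Subtype.val h), t, k, Or.inl ⟨rfl, rfl⟩⟩
  have : Nonempty (exchangeVertices Q pos s) :=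
    ⟨⟨s.unlabelled, mem_exchangeVertices.2 ⟨s, mem_labelledSeeds_self Q pos s, rfl⟩⟩⟩
  refine SimpleGraph.Connected.mk ?_
  rintro ⟨x, hx⟩ ⟨y, hy⟩
  obtain ⟨t, ht, rfl⟩ := mem_exchangeVertices.1 hx
  obtain ⟨u, hu, rfl⟩ := mem_exchangeVertices.1 hy
  exact (key t ht).symm.trans (key u hu)

open Classical in
/-- A vertex at distance at most `m` from `x` is represented by a seed that is reached by `m`
further signed mutations. -/
theorem exists_reachedIn_of_dist_le {Q : LinearMap.BilinForm ℝ V} (hQ : ∀ x y, Q x y = Q y x)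
    {pos : Set V} {s : Seed V} (hs : ∀ i, Q (s.vec i) (s.vec i) = 2)
    (x : exchangeVertices Q pos s) :
    ∃ l, ∀ m (y : exchangeVertices Q pos s), (exchangeGraph Q pos s).dist x y ≤ m →
      ∃ t, ReachedIn Q s (l + m) t ∧ t.unlabelled = y.1 := by
  obtain ⟨t, ht, htx⟩ := mem_exchangeVertices.1 x.2
  obtain ⟨l, hl⟩ := ReachedIn.of_mem_labelledSeeds ht
  refine ⟨l, ?_⟩
  have key : ∀ (u v : exchangeVertices Q pos s) (p : (exchangeGraph Q pos s).Walk u v),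
      ∀ n t, ReachedIn Q s n t → t.unlabelled = u.1 →
      ∃ t', ReachedIn Q s (n + p.length) t' ∧ t'.unlabelled = v.1 := by
    intro u v p
    induction p with
    | nil => intro n t h1 h2; exact ⟨t, h1, h2⟩
    | @cons u v w huv p ih =>
      intro n t h1 h2
      have : ∃ t', ReachedIn Q s (n + 1) t' ∧ t'.unlabelled = v.1 := by
        obtain ⟨-, r, k, h | h⟩ := huv
        · obtain ⟨σ, rfl⟩ := unlabelled_eq_iff.1 (h2.trans h.1)
          refine ⟨_, h1.step (decide ((relabel σ t).vec k ∈ pos)) (σ k), ?_⟩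
          rw [h.2, mutateSeed_eq_signedMutation, signedMutation_relabel, relabel_unlabelled]
        -- Here it is `v` that mutates to `u`. Mutation with an arbitrary `pos` need not be an
        -- involution, but the opposite sign inverts it.
        · obtain ⟨q, hq, hqv⟩ := mem_exchangeVertices.1 v.2
          obtain ⟨σ, rfl⟩ := unlabelled_eq_iff.1 (hqv.symm.trans h.1)
          obtain ⟨_, hqr⟩ := ReachedIn.of_mem_labelledSeeds hq
          have hq2 := hqr.self_eq_two hQ hs
          rw [h.2, mutateSeed_eq_signedMutation] at h2
          obtain ⟨τ, hτ⟩ := unlabelled_eq_iff.1 h2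
          set ε := decide ((relabel σ q).vec k ∈ pos)
          have := signedMutation_not_signedMutation (Q := Q) (s := relabel σ q) (k := k)
            (hq2 (σ k)) ε
          rw [hτ, signedMutation_relabel] at this
          refine ⟨_, h1.step (!ε) (τ k), ?_⟩
          rw [h.1, ← this, relabel_unlabelled]
      obtain ⟨t', h3, h4⟩ := this
      obtain ⟨t'', h5, h6⟩ := ih (n + 1) t' h3 h4
      exact ⟨t'', by simpa [add_assoc, add_comm, add_left_comm] using h5, h6⟩
  intro m y hy
  obtain ⟨p, hp⟩ := (exchangeGraph_connected Q pos s).exists_walk_length_eq_dist x y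
  obtain ⟨t', h1, h2⟩ := key x y p l t hl htx.symm
  exact ⟨t', h1.mono (by omega), h2⟩

end SignedMutation

/-- Polynomial growth from a polynomial bound for the number of seeds reached in `m` steps. -/
theorem hasPolynomialGrowth_of_card_le {V : Type*} [AddCommGroup V] [Module ℝ V]
    {Q : LinearMap.BilinForm ℝ V} (hQ : ∀ x y, Q x y = Q y x)
    {pos : Set V} {s : Seed V} (hs : ∀ i, Q (s.vec i) (s.vec i) = 2) (C r : ℕ)
    (hC : ∀ m, {t | ReachedIn Q s m t}.Finite ∧
      {t | ReachedIn Q s m t}.ncard ≤ C * (m + 1) ^ r)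
    (x : exchangeVertices Q pos s) : HasPolynomialGrowth (exchangeGraph Q pos s) x := by
  obtain ⟨l, hl⟩ := exists_reachedIn_of_dist_le hQ hs x
  have hsub : ∀ m, Subtype.val '' {y | (exchangeGraph Q pos s).dist x y ≤ m} ⊆
      Seed.unlabelled '' {t | ReachedIn Q s (l + m) t} := by
    rintro m _ ⟨y, hy, rfl⟩
    exact hl m y hy
  have hfin : ∀ m, {y | (exchangeGraph Q pos s).dist x y ≤ m}.Finite := fun m =>
    Set.Finite.of_finite_image (((hC (l + m)).1.image _).subset (hsub m))
      Subtype.val_injective.injOn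
  refine ⟨hfin, r, ?_⟩
  -- The number `l` accounts for the way from `s` to the base vertex; the constant comes from `l + m
  -- + 1 ≤ (l + 2) m` for `m ≥ 1`.
  refine IsBigO.of_bound (C * (l + 2 : ℝ) ^ r) ?_
  filter_upwards [eventually_ge_atTop 1] with m hm
  have h1 : growth (exchangeGraph Q pos s) x m ≤ C * (l + m + 1) ^ r := by
    unfold growth
    rw [← Set.ncard_image_of_injective _ Subtype.val_injective]
    refine (Set.ncard_le_ncard (hsub m) ((hC (l + m)).1.image _)).trans ?_
    exact (Set.ncard_image_le (hC (l + m)).1).trans (hC (l + m)).2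
  rw [Real.norm_of_nonneg (by positivity), Real.norm_of_nonneg (by positivity), mul_assoc,
    ← mul_pow]
  have hm' : (1 : ℝ) ≤ m := by exact_mod_cast hm
  calc (growth (exchangeGraph Q pos s) x m : ℝ) ≤ C * (l + m + 1 : ℝ) ^ r := by
        exact_mod_cast h1
    _ ≤ C * ((l + 2 : ℝ) * m) ^ r := by
        gcongr
        nlinarith [Nat.cast_nonneg (α := ℝ) l]



/-! ### Acyclicity, and Vieta involutions on triples of numbers -/

/-- The three entries of a skew-symmetric matrix. -/
def arrows (B : Matrix (Fin 3) (Fin 3) ℝ) (k : Fin 3) : ℝ := B (k + 1) (k + 2)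

theorem isAcyclic_of_rank {B : Matrix (Fin 3) (Fin 3) ℝ} (f : Fin 3 → ℕ)
    (hf : ∀ a b, 0 < B a b → f a < f b) : IsAcyclic B := by
  intro i hi
  have : ∀ a b, Relation.TransGen (fun a b => 0 < B a b) a b → f a < f b := by
    intro a b h
    induction h with
    | single h => exact hf _ _ h
    | tail _ h ih => exact ih.trans (hf _ _ h)
  exact lt_irrefl _ (this i i hi)

theorem skew_apply {B : Matrix (Fin 3) (Fin 3) ℝ} (hB : B.transpose = -B) (i j : Fin 3) :
    B j i = -B i j := congrFun (congrFun hB i) j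

theorem skew_diag {B : Matrix (Fin 3) (Fin 3) ℝ} (hB : B.transpose = -B) (i : Fin 3) :
    B i i = 0 := by
  have := skew_apply hB i i
  linarith

theorem isAcyclic_iff {B : Matrix (Fin 3) (Fin 3) ℝ} (hB : B.transpose = -B) :
    IsAcyclic B ↔
      ¬ ((0 < B 0 1 ∧ 0 < B 1 2 ∧ 0 < B 2 0) ∨ (B 0 1 < 0 ∧ B 1 2 < 0 ∧ B 2 0 < 0)) := by
  have h10 := skew_apply hB 0 1
  have h21 := skew_apply hB 1 2
  have h02 := skew_apply hB 2 0
  have h00 := skew_diag hB 0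
  have h11 := skew_diag hB 1
  have h22 := skew_diag hB 2
  constructor
  · rintro h (⟨h1, h2, h3⟩ | ⟨h1, h2, h3⟩)
    · exact h 0 (((Relation.TransGen.single (b := 1) h1).tail (c := 2) h2).tail h3)
    · refine h 0 (((Relation.TransGen.single (b := 2) ?_).tail (c := 1) ?_).tail ?_) <;>
        simp only [h10, h21, h02] <;> linarith
  · intro h
    -- A compatible ranking of the three vertices excludes cycles, and each sign pattern other than
    -- the two cyclic ones admits one of the six orders.
    have mk : ∀ x y z : ℕ, (0 < B 0 1 → x < y) → (B 0 1 < 0 → y < x) → (0 < B 1 2 → y < z) →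
        (B 1 2 < 0 → z < y) → (0 < B 2 0 → z < x) → (B 2 0 < 0 → x < z) → IsAcyclic B := by
      intro x y z a1 a2 a3 a4 a5 a6
      refine isAcyclic_of_rank ![x, y, z] ?_
      intro a b hab
      fin_cases a <;> fin_cases b <;> simp [h10, h21, h02, h00, h11, h22] at hab ⊢ <;> tauto
    rcases lt_trichotomy (B 0 1) 0 with h1 | h1 | h1 <;>
    rcases lt_trichotomy (B 1 2) 0 with h2 | h2 | h2 <;>
    rcases lt_trichotomy (B 2 0) 0 with h3 | h3 | h3 <;>
    first
    | (exfalso; exact h (Or.inl ⟨h1, h2, h3⟩))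
    | (exfalso; exact h (Or.inr ⟨h1, h2, h3⟩))
    | (refine mk 0 1 2 ?_ ?_ ?_ ?_ ?_ ?_ <;> intro h' <;> first | omega | (exfalso; linarith))
    | (refine mk 0 2 1 ?_ ?_ ?_ ?_ ?_ ?_ <;> intro h' <;> first | omega | (exfalso; linarith))
    | (refine mk 1 0 2 ?_ ?_ ?_ ?_ ?_ ?_ <;> intro h' <;> first | omega | (exfalso; linarith))
    | (refine mk 2 0 1 ?_ ?_ ?_ ?_ ?_ ?_ <;> intro h' <;> first | omega | (exfalso; linarith))
    | (refine mk 1 2 0 ?_ ?_ ?_ ?_ ?_ ?_ <;> intro h' <;> first | omega | (exfalso; linarith))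
    | (refine mk 2 1 0 ?_ ?_ ?_ ?_ ?_ ?_ <;> intro h' <;> first | omega | (exfalso; linarith))

theorem Fin.three_add_one_add_one (k : Fin 3) : k + 1 + 1 = k + 2 := by revert k; decide

theorem Fin.three_add_one_add_two (k : Fin 3) : k + 1 + 2 = k := by revert k; decide

theorem Fin.three_add_two_add_one (k : Fin 3) : k + 2 + 1 = k := by revert k; decide

theorem Fin.three_add_two_add_two (k : Fin 3) : k + 2 + 2 = k + 1 := by revert k; decide

theorem Fin.three_cases (k i : Fin 3) : i = k ∨ i = k + 1 ∨ i = k + 2 := by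
  revert k i; decide

/-! ### Vieta involutions and their orbits. -/

section Vieta

variable {R S : Type*} [CommRing R] [CommRing S]

/-- The Vieta involution which replaces `t_k` by `t_i t_j - t_k`. -/
def vieta (k : Fin 3) (t : Fin 3 → R) : Fin 3 → R :=
  Function.update t k (t (k + 1) * t (k + 2) - t k)

def vietaOrbit (t : Fin 3 → R) : Set (Fin 3 → R) :=
  {u | ∃ ks : List (Fin 3), u = ks.foldl (fun u k => vieta k u) t}

theorem self_mem_vietaOrbit (t : Fin 3 → R) : t ∈ vietaOrbit t := ⟨[], rfl⟩

theorem vieta_mem_vietaOrbit {t u : Fin 3 → R} (h : u ∈ vietaOrbit t) (k : Fin 3) :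
    vieta k u ∈ vietaOrbit t := by
  obtain ⟨ks, rfl⟩ := h
  exact ⟨ks ++ [k], by simp⟩

theorem vietaOrbit_induction {t : Fin 3 → R} {P : (Fin 3 → R) → Prop} (h0 : P t)
    (h1 : ∀ u k, P u → P (vieta k u)) : ∀ u ∈ vietaOrbit t, P u := by
  rintro u ⟨ks, rfl⟩
  induction ks using List.reverseRecOn with
  | nil => exact h0
  | append_singleton ks k ih =>
    rw [List.foldl_append]
    exact h1 _ k ih

theorem vietaOrbit_subset {t u : Fin 3 → R} (h : u ∈ vietaOrbit t) :
    vietaOrbit u ⊆ vietaOrbit t := fun v hv =>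
  vietaOrbit_induction (P := fun v => v ∈ vietaOrbit t) h
    (fun _ k hu => vieta_mem_vietaOrbit hu k) v hv

theorem vieta_self (k : Fin 3) (t : Fin 3 → R) : vieta k t k = t (k + 1) * t (k + 2) - t k := by
  simp [vieta]

theorem vieta_of_ne {k l : Fin 3} (h : l ≠ k) (t : Fin 3 → R) : vieta k t l = t l := by
  simp [vieta, h]

theorem vieta_add_one (k : Fin 3) (t : Fin 3 → R) : vieta k t (k + 1) = t (k + 1) :=
  vieta_of_ne (by revert k; decide) t

theorem vieta_add_two (k : Fin 3) (t : Fin 3 → R) : vieta k t (k + 2) = t (k + 2) :=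
  vieta_of_ne (by revert k; decide) t

theorem map_vieta (f : R →+* S) (k : Fin 3) (t : Fin 3 → R) :
    f ∘ vieta k t = vieta k (f ∘ t) := by
  funext l
  by_cases h : l = k
  · subst h; simp [vieta]
  · simp [vieta, h]

theorem vietaOrbit_map (f : R →+* S) (t : Fin 3 → R) :
    vietaOrbit (f ∘ t) ⊆ (fun u => f ∘ u) '' vietaOrbit t := by
  refine vietaOrbit_induction (P := fun u => u ∈ (fun u => f ∘ u) '' vietaOrbit t)
    ⟨t, self_mem_vietaOrbit t, rfl⟩ ?_
  rintro _ k ⟨u, hu, rfl⟩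
  exact ⟨vieta k u, vieta_mem_vietaOrbit hu k, map_vieta f k u⟩

theorem map_mem_vietaOrbit (f : R →+* S) {t u : Fin 3 → R} (h : u ∈ vietaOrbit t) :
    f ∘ u ∈ vietaOrbit (f ∘ t) := by
  refine vietaOrbit_induction (P := fun u => f ∘ u ∈ vietaOrbit (f ∘ t))
    (self_mem_vietaOrbit _) ?_ u h
  intro u k hu
  rw [map_vieta]
  exact vieta_mem_vietaOrbit hu k

/-- At least two of the three numbers are nonzero. -/
def IsConnectedTriple (t : Fin 3 → R) : Prop := ∀ k, t (k + 1) ≠ 0 ∨ t (k + 2) ≠ 0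

end Vieta

/-! ### Realising Vieta involutions by mutations -/

/-- A triple `(x, y, z)` has the absolute values of a skew-symmetric matrix with entries
`(a, b, c)`, and the sign of its product tells whether the quiver is cyclic. -/
def CompatTriple (a b c x y z : ℝ) : Prop :=
  |x| = |a| ∧ |y| = |b| ∧ |z| = |c| ∧
  ((0 < a ∧ 0 < b ∧ 0 < c) ∨ (a < 0 ∧ b < 0 ∧ c < 0) → 0 < x * y * z) ∧
  (¬ ((0 < a ∧ 0 < b ∧ 0 < c) ∨ (a < 0 ∧ b < 0 ∧ c < 0)) → x * y * z ≤ 0)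

theorem CompatTriple.rotate {a b c x y z : ℝ} (h : CompatTriple a b c x y z) :
    CompatTriple b c a y z x := by
  obtain ⟨h1, h2, h3, h4, h5⟩ := h
  refine ⟨h2, h3, h1, ?_, ?_⟩
  · intro h; have := h4 (by tauto); linarith
  · intro h; have := h5 (by tauto); linarith

theorem CompatTriple.neg {a b c x y z : ℝ} (h : CompatTriple a b c x y z) :
    CompatTriple (-a) (-b) (-c) x y z := by
  obtain ⟨h1, h2, h3, h4, h5⟩ := h
  refine ⟨by simpa, by simpa, by simpa, ?_, ?_⟩
  · intro h; apply h4; simpa [and_comm, or_comm] using h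
  · intro h; apply h5; simpa [and_comm, or_comm] using h

/-- The sign of the product ties `x` to `y z`: either `x = a` and `y z = b c`, or both hold with a
minus sign. So `y z - x` is `b c - a` up to that same sign. -/
theorem compatTriple_vieta_of_pos {a b c x y z : ℝ} (h : CompatTriple a b c x y z) (hb : 0 < b)
    (hc : 0 < c) : CompatTriple (b * c - a) b c (y * z - x) y z := by
  obtain ⟨h1, h2, h3, h4, h5⟩ := h
  have hyz : |y * z| = b * c := by rw [abs_mul, h2, h3, abs_of_pos hb, abs_of_pos hc]
  have hbc : 0 < b * c := mul_pos hb hc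
  have h4' : 0 < a → 0 < x * (y * z) := fun h => by
    have := h4 (Or.inl ⟨h, hb, hc⟩); linarith
  have h5' : a ≤ 0 → x * (y * z) ≤ 0 := fun h => by
    have := h5 (by rintro (⟨h, -⟩ | ⟨-, h, -⟩) <;> linarith); linarith
  have key : (y * z - x) = b * c - a ∧ y * z = b * c ∨
      (y * z - x) = -(b * c - a) ∧ y * z = -(b * c) := by
    rcases (abs_eq hbc.le).1 hyz with e | e
    · left
      rw [e] at h4' h5' ⊢
      refine ⟨?_, rfl⟩
      rcases lt_trichotomy a 0 with ha | ha | ha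
      · have : x ≤ 0 := by
          have := h5' ha.le; exact nonpos_of_mul_nonpos_left this hbc
        rw [abs_of_nonpos this, abs_of_neg ha] at h1; linarith
      · subst ha; simp at h1; simp [h1]
      · have : 0 < x := pos_of_mul_pos_left (h4' ha) hbc.le
        rw [abs_of_pos this, abs_of_pos ha] at h1; linarith
    · right
      rw [e] at h4' h5' ⊢
      refine ⟨?_, rfl⟩
      rcases lt_trichotomy a 0 with ha | ha | ha
      · have : 0 ≤ x := by
          have := h5' ha.le; by_contra! hx; nlinarith
        rw [abs_of_nonneg this, abs_of_neg ha] at h1; linarith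
      · subst ha; simp at h1; simp [h1]
      · have : x < 0 := by
          have := h4' ha; by_contra! hx; nlinarith
        rw [abs_of_neg this, abs_of_pos ha] at h1; linarith
  have hprod : (y * z - x) * y * z = (b * c - a) * (b * c) := by
    rcases key with ⟨e1, e2⟩ | ⟨e1, e2⟩ <;> rw [mul_assoc, e1, e2] ; ring
  refine ⟨?_, h2, h3, ?_, ?_⟩
  · rcases key with ⟨e1, -⟩ | ⟨e1, -⟩ <;> rw [e1]; rw [abs_neg]
  · rintro (⟨h, -⟩ | ⟨-, h, -⟩)
    · rw [hprod]; exact mul_pos h hbc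
    · linarith
  · intro h
    rw [hprod]
    have : b * c - a ≤ 0 := by
      by_contra! h'; exact h (Or.inl ⟨h', hb, hc⟩)
    exact mul_nonpos_of_nonpos_of_nonneg this hbc.le

/-- `CompatTriple` for the entries of a matrix. -/
def CompatMatrix (B : Matrix (Fin 3) (Fin 3) ℝ) (t : Fin 3 → ℝ) : Prop :=
  CompatTriple (arrows B 0) (arrows B 1) (arrows B 2) (t 0) (t 1) (t 2)

theorem CompatMatrix.apply {B : Matrix (Fin 3) (Fin 3) ℝ} {t : Fin 3 → ℝ}
    (h : CompatMatrix B t) (k : Fin 3) :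
    CompatTriple (arrows B k) (arrows B (k + 1)) (arrows B (k + 2)) (t k) (t (k + 1))
      (t (k + 2)) := by
  fin_cases k
  · exact h
  · exact h.rotate
  · exact h.rotate.rotate

theorem CompatMatrix.of_apply {B : Matrix (Fin 3) (Fin 3) ℝ} {t : Fin 3 → ℝ} (k : Fin 3)
    (h : CompatTriple (arrows B k) (arrows B (k + 1)) (arrows B (k + 2)) (t k) (t (k + 1))
      (t (k + 2))) : CompatMatrix B t := by
  fin_cases k
  · exact h
  · exact h.rotate.rotate
  · exact h.rotate

theorem arrows_mutateMatrix {B : Matrix (Fin 3) (Fin 3) ℝ} (hB : B.transpose = -B) (k : Fin 3) :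
    arrows (mutateMatrix k B) k = arrows B k -
      (arrows B (k + 2) * |arrows B (k + 1)| + |arrows B (k + 2)| * arrows B (k + 1)) / 2 ∧
    arrows (mutateMatrix k B) (k + 1) = -arrows B (k + 1) ∧
    arrows (mutateMatrix k B) (k + 2) = -arrows B (k + 2) := by
  have h10 := skew_apply hB 0 1
  have h21 := skew_apply hB 1 2
  have h02 := skew_apply hB 2 0
  fin_cases k <;> refine ⟨?_, ?_, ?_⟩ <;> simp [arrows, mutateMatrix, h10, h21, h02] <;> ring

/-- Equal strict signs of these two entries mean a path through `k`. Otherwise `k` is a source or a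
sink, or an arrow at `k` is missing, and the mutation contributes nothing to the opposite weight. -/
theorem arrows_mutateMatrix_of_mul_nonpos {B : Matrix (Fin 3) (Fin 3) ℝ}
    (hB : B.transpose = -B) (k : Fin 3) (h : arrows B (k + 1) * arrows B (k + 2) ≤ 0) :
    arrows (mutateMatrix k B) k = arrows B k := by
  rw [(arrows_mutateMatrix hB k).1]
  rcases le_total 0 (arrows B (k + 1)) with h1 | h1 <;>
  rcases le_total 0 (arrows B (k + 2)) with h2 | h2
  · have : arrows B (k + 1) * arrows B (k + 2) = 0 := le_antisymm h (mul_nonneg h1 h2)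
    rw [abs_of_nonneg h1, abs_of_nonneg h2]; linarith
  · rw [abs_of_nonneg h1, abs_of_nonpos h2]; ring
  · rw [abs_of_nonpos h1, abs_of_nonneg h2]; ring
  · have : arrows B (k + 1) * arrows B (k + 2) = 0 :=
      le_antisymm h (mul_nonneg_of_nonpos_of_nonpos h1 h2)
    rw [abs_of_nonpos h1, abs_of_nonpos h2]; linarith

theorem compatMatrix_vieta_of_mul_pos {B : Matrix (Fin 3) (Fin 3) ℝ} (hB : B.transpose = -B)
    {t : Fin 3 → ℝ} (h : CompatMatrix B t) (k : Fin 3)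
    (hk : 0 < arrows B (k + 1) * arrows B (k + 2)) :
    CompatMatrix (mutateMatrix k B) (vieta k t) := by
  refine CompatMatrix.of_apply k ?_
  obtain ⟨e1, e2, e3⟩ := arrows_mutateMatrix hB k
  rw [e1, e2, e3, vieta_self, vieta_add_one, vieta_add_two]
  have h := h.apply k
  rcases pos_and_pos_or_neg_and_neg_of_mul_pos hk with ⟨h1, h2⟩ | ⟨h1, h2⟩
  · rw [abs_of_pos h1, abs_of_pos h2]
    convert (compatTriple_vieta_of_pos h h1 h2).neg using 1; ring
  · rw [abs_of_neg h1, abs_of_neg h2]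
    convert compatTriple_vieta_of_pos h.neg (neg_pos.2 h1) (neg_pos.2 h2) using 1; ring

/-- Every Vieta involution is realised by one or two mutations. -/
theorem exists_compatMatrix_vieta {B₀ B : Matrix (Fin 3) (Fin 3) ℝ} (hB₀ : B ∈ mutationClass B₀)
    (hB : B.transpose = -B) {t : Fin 3 → ℝ} (h : CompatMatrix B t) (k : Fin 3) :
    ∃ B' ∈ mutationClass B₀, B'.transpose = -B' ∧ CompatMatrix B' (vieta k t) := by
  rcases lt_trichotomy 0 (arrows B (k + 1) * arrows B (k + 2)) with hk | hk | hk
  · exact ⟨_, mutateMatrix_mem_mutationClass hB₀ k, mutateMatrix_skew hB k,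
      compatMatrix_vieta_of_mul_pos hB h k hk⟩
  -- An arrow at `k` is missing, so the involution only negates `t k`, and `B` itself still fits.
  · refine ⟨B, hB₀, hB, CompatMatrix.of_apply k ?_⟩
    rw [vieta_self, vieta_add_one, vieta_add_two]
    obtain ⟨h1, h2, h3, h4, h5⟩ := h.apply k
    have h0 : t (k + 1) * t (k + 2) = 0 := by
      rw [← abs_eq_zero, abs_mul, h2, h3, ← abs_mul, ← hk, abs_zero]
    refine ⟨by rw [h0, zero_sub, abs_neg, h1], h2, h3, ?_, ?_⟩
    · rintro (⟨-, e1, e2⟩ | ⟨-, e1, e2⟩)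
      · exact absurd hk (mul_pos e1 e2).ne
      · exact absurd hk (mul_pos_of_neg_of_neg e1 e2).ne
    · intro; rw [mul_assoc, h0, mul_zero]
  · have hkc := h.apply k
    have hnc : t k * t (k + 1) * t (k + 2) ≤ 0 := by
      refine hkc.2.2.2.2 ?_
      rintro (⟨-, e1, e2⟩ | ⟨-, e1, e2⟩)
      · exact absurd hk (mul_pos e1 e2).not_gt
      · exact absurd hk (mul_pos_of_neg_of_neg e1 e2).not_gt
    have e21 := Fin.three_add_two_add_one k
    have e22 := Fin.three_add_two_add_two k
    have e11 := Fin.three_add_one_add_one k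
    have e12 := Fin.three_add_one_add_two k
    -- after a mutation at a source or a sink, the vertex `k` has an incoming and an outgoing arrow
    obtain ⟨l, hl1, hl2, hl3⟩ : ∃ l, 0 < arrows (mutateMatrix l B) (k + 1) *
        arrows (mutateMatrix l B) (k + 2) ∧
        (∀ i, |arrows (mutateMatrix l B) i| = |arrows B i|) ∧
        (arrows (mutateMatrix l B) k * arrows (mutateMatrix l B) (k + 1) ≤ 0 ∨
          arrows (mutateMatrix l B) k * arrows (mutateMatrix l B) (k + 2) ≤ 0) := by
      -- The three entries are not all of one strict sign, so no path passes through one of the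
      -- vertices `k + 1`, `k + 2`; mutating there keeps all absolute values and reverses one of the
      -- two arrows at `k`.
      rcases le_or_gt (arrows B k * arrows B (k + 2)) 0 with h1 | h1
      · refine ⟨k + 1, ?_⟩
        obtain ⟨-, f2, f3⟩ := arrows_mutateMatrix hB (k + 1)
        have f1 := arrows_mutateMatrix_of_mul_nonpos hB (k + 1) (by
          rw [e11, e12]; linarith)
        rw [e11] at f2
        rw [e12] at f3
        refine ⟨by rw [f1, f2]; linarith, ?_, ?_⟩
        · intro i
          rcases Fin.three_cases k i with rfl | rfl | rfl
          · rw [f3, abs_neg]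
          · rw [f1]
          · rw [f2, abs_neg]
        · right; rw [f2, f3]; linarith
      · refine ⟨k + 2, ?_⟩
        obtain ⟨-, f2, f3⟩ := arrows_mutateMatrix hB (k + 2)
        have h2 : arrows B k * arrows B (k + 1) ≤ 0 := by
          by_contra! h2
          nlinarith [mul_self_nonneg (arrows B k), mul_pos h1 h2]
        have f1 := arrows_mutateMatrix_of_mul_nonpos hB (k + 2) (by
          rw [e21, e22]; linarith)
        rw [e21] at f2
        rw [e22] at f3
        refine ⟨by rw [f1, f3]; linarith, ?_, ?_⟩
        · intro i
          rcases Fin.three_cases k i with rfl | rfl | rfl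
          · rw [f2, abs_neg]
          · rw [f3, abs_neg]
          · rw [f1]
        · left; rw [f2, f3]; linarith
    have hc' : CompatMatrix (mutateMatrix l B) t := by
      refine CompatMatrix.of_apply k ⟨by rw [hl2, hkc.1], by rw [hl2, hkc.2.1],
        by rw [hl2, hkc.2.2.1], ?_, fun _ => hnc⟩
      rintro (⟨d1, d2, d3⟩ | ⟨d1, d2, d3⟩) <;> rcases hl3 with hl3 | hl3
      · exact absurd hl3 (mul_pos d1 d2).not_ge
      · exact absurd hl3 (mul_pos d1 d3).not_ge
      · exact absurd hl3 (mul_pos_of_neg_of_neg d1 d2).not_ge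
      · exact absurd hl3 (mul_pos_of_neg_of_neg d1 d3).not_ge
    exact ⟨_, mutateMatrix_mem_mutationClass (mutateMatrix_mem_mutationClass hB₀ l) k,
      mutateMatrix_skew (mutateMatrix_skew hB l) k,
      compatMatrix_vieta_of_mul_pos (mutateMatrix_skew hB l) hc' k hl1⟩

theorem exists_compatMatrix_of_mem_vietaOrbit {B : Matrix (Fin 3) (Fin 3) ℝ}
    (hB : B.transpose = -B) {t : Fin 3 → ℝ} (h : CompatMatrix B t) :
    ∀ u ∈ vietaOrbit t, ∃ B' ∈ mutationClass B, B'.transpose = -B' ∧ CompatMatrix B' u := by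
  refine vietaOrbit_induction ⟨B, self_mem_mutationClass B, hB, h⟩ ?_
  rintro u k ⟨B', h1, h2, h3⟩
  exact exists_compatMatrix_vieta h1 h2 h3 k

/-- Up to signs every triple of the orbit consists of entries of some matrix of the finite mutation
class. -/
theorem finite_vietaOrbit_of_isMutationFinite {B : Matrix (Fin 3) (Fin 3) ℝ}
    (hB : B.transpose = -B) (hfin : IsMutationFinite B) {t : Fin 3 → ℝ} (h : CompatMatrix B t) :
    (vietaOrbit t).Finite := by
  have hS : ∀ k, {r : ℝ | ∃ B' ∈ mutationClass B, |r| = |arrows B' k|}.Finite := by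
    intro k
    have h1 : ((fun B' => arrows B' k) '' mutationClass B ∪
        (fun B' => -arrows B' k) '' mutationClass B).Finite :=
      (hfin.image _).union (hfin.image _)
    refine h1.subset ?_
    rintro r ⟨B', hB', hr⟩
    rcases abs_eq_abs.1 hr with hr | hr
    · exact Or.inl ⟨B', hB', hr.symm⟩
    · exact Or.inr ⟨B', hB', hr.symm⟩
  refine (Set.Finite.pi' hS).subset ?_
  intro u hu k
  obtain ⟨B', h1, -, h3⟩ := exists_compatMatrix_of_mem_vietaOrbit hB h u hu
  exact ⟨B', h1, (h3.apply k).1⟩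



/-! ### Triples with a finite orbit under the Vieta involutions -/

theorem IsConnectedTriple.vieta {R : Type*} [CommRing R] [IsDomain R] {t : Fin 3 → R}
    (h : IsConnectedTriple t) (k : Fin 3) : IsConnectedTriple (vieta k t) := by
  have h0 := h k
  have h1 := h (k + 1)
  have h2 := h (k + 2)
  simp only [Fin.three_add_one_add_one, Fin.three_add_one_add_two, Fin.three_add_two_add_one,
    Fin.three_add_two_add_two] at h1 h2
  intro l
  rcases Fin.three_cases k l with rfl | rfl | rfl
  · rwa [vieta_add_one, vieta_add_two]
  · rw [Fin.three_add_one_add_one, Fin.three_add_one_add_two, vieta_self, vieta_add_two]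
    by_cases h3 : t (k + 2) = 0
    · simp only [h3, mul_zero, zero_sub, neg_ne_zero] at *
      tauto
    · exact Or.inl h3
  · rw [Fin.three_add_two_add_one, Fin.three_add_two_add_two, vieta_self, vieta_add_one]
    by_cases h3 : t (k + 1) = 0
    · simp only [h3, zero_mul, zero_sub, neg_ne_zero] at *
      tauto
    · exact Or.inr h3

/-- The region in which the Gram matrix of a triple is positive semidefinite. -/
def IsBoundedTriple (t : Fin 3 → ℝ) : Prop :=
  (∀ k, |t k| ≤ 2) ∧ t 0 ^ 2 + t 1 ^ 2 + t 2 ^ 2 - t 0 * t 1 * t 2 ≤ 4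

/-- As a polynomial in `t_k` the cubic is quadratic with sum of roots `t_{k+1} t_{k+2}`; the
involution exchanges the two arguments at which it takes the same value. -/
theorem markovConst_vieta {R : Type*} [CommRing R] (t : Fin 3 → R) (k : Fin 3) :
    vieta k t 0 ^ 2 + vieta k t 1 ^ 2 + vieta k t 2 ^ 2 - vieta k t 0 * vieta k t 1 * vieta k t 2
      = t 0 ^ 2 + t 1 ^ 2 + t 2 ^ 2 - t 0 * t 1 * t 2 := by
  fin_cases k <;> simp [vieta, Function.update] <;> ring

theorem markovConst_rotate {R : Type*} [CommRing R] (t : Fin 3 → R) (k : Fin 3) :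
    t k ^ 2 + t (k + 1) ^ 2 + t (k + 2) ^ 2 - t k * t (k + 1) * t (k + 2)
      = t 0 ^ 2 + t 1 ^ 2 + t 2 ^ 2 - t 0 * t 1 * t 2 := by
  fin_cases k <;> simp <;> ring

theorem IsBoundedTriple.sq_le {t : Fin 3 → ℝ} (h : IsBoundedTriple t) (k : Fin 3) :
    (2 * t k - t (k + 1) * t (k + 2)) ^ 2 ≤ (4 - t (k + 1) ^ 2) * (4 - t (k + 2) ^ 2) := by
  have := h.2
  rw [← markovConst_rotate t k] at this
  nlinarith

/-- By `2|yz| ≤ y² + z²` the right-hand side is at most `(4 - |yz|)²`, whence `|2x - yz| ≤ 4 -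
|yz|`. -/
theorem abs_sub_le_two {x y z : ℝ} (hy : |y| ≤ 2) (hz : |z| ≤ 2)
    (h : (2 * x - y * z) ^ 2 ≤ (4 - y ^ 2) * (4 - z ^ 2)) : |x| ≤ 2 := by
  have hy2 : y ^ 2 ≤ 4 := by rw [← sq_abs]; nlinarith [abs_nonneg y]
  have hz2 : z ^ 2 ≤ 4 := by rw [← sq_abs]; nlinarith [abs_nonneg z]
  have hyz : |y * z| ≤ 4 := by rw [abs_mul]; nlinarith [abs_nonneg y, abs_nonneg z]
  have key : (2 * x - y * z) ^ 2 ≤ (4 - |y * z|) ^ 2 := by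
    have : |y * z| ^ 2 = y ^ 2 * z ^ 2 := by rw [sq_abs]; ring
    have h3 : 2 * |y * z| ≤ y ^ 2 + z ^ 2 := by
      rw [abs_mul, ← sq_abs y, ← sq_abs z]; nlinarith [sq_nonneg (|y| - |z|)]
    nlinarith
  have h4 := abs_le_of_sq_le_sq' key (by linarith)
  have h5 := neg_abs_le (y * z)
  have h6 := le_abs_self (y * z)
  rw [abs_le]; constructor <;> linarith

theorem IsBoundedTriple.vieta {t : Fin 3 → ℝ} (h : IsBoundedTriple t) (k : Fin 3) :
    IsBoundedTriple (vieta k t) := by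
  refine ⟨?_, by rw [markovConst_vieta]; exact h.2⟩
  intro l
  by_cases hl : l = k
  · subst hl
    rw [vieta_self]
    refine abs_sub_le_two (h.1 (l + 1)) (h.1 (l + 2)) ?_
    have := h.sq_le l
    linarith [this, (by ring : (2 * (t (l + 1) * t (l + 2) - t l) - t (l + 1) * t (l + 2)) ^ 2
      = (2 * t l - t (l + 1) * t (l + 2)) ^ 2)]
  · rw [vieta_of_ne hl]; exact h.1 l

theorem vieta_vieta {R : Type*} [CommRing R] (t : Fin 3 → R) (k : Fin 3) :
    vieta k (vieta k t) = t := by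
  funext l
  by_cases hl : l = k
  · subst hl
    rw [vieta_self, vieta_add_one, vieta_add_two, vieta_self]; ring
  · rw [vieta_of_ne hl, vieta_of_ne hl]

theorem mem_vietaOrbit_symm {R : Type*} [CommRing R] {t u : Fin 3 → R} (h : u ∈ vietaOrbit t) :
    t ∈ vietaOrbit u := by
  refine vietaOrbit_induction (P := fun u => t ∈ vietaOrbit u) (self_mem_vietaOrbit t) ?_ u h
  intro u k hu
  refine vietaOrbit_subset ?_ hu
  have := vieta_mem_vietaOrbit (self_mem_vietaOrbit (vieta k u)) k
  rwa [vieta_vieta] at this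

/-- The claim is equivalent to `(2a - bc)² ≤ (4 - b²)(4 - c²)`. Since `0 ≤ 2a - bc ≤ b(2 - c)`, it
suffices that `b²(2 - c) ≤ (4 - b²)(2 + c)`, which amounts to `b² ≤ 2 + c`. -/
theorem sq_add_sq_add_sq_le_of_sorted {a b c : ℝ} (hb : 0 < b) (hab : a ≤ b)
    (hbc : b ≤ c) (hc : c ≤ 2) (h : b * c ≤ 2 * a) :
    a ^ 2 + b ^ 2 + c ^ 2 - a * b * c ≤ 4 := by
  have h1 : (2 * a - b * c) ^ 2 ≤ (b * (2 - c)) ^ 2 := by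
    apply pow_le_pow_left₀ <;> nlinarith
  have h2 : b ^ 2 * (2 - c) ≤ (4 - b ^ 2) * (2 + c) := by nlinarith
  nlinarith [mul_le_mul_of_nonneg_left h2 (by linarith : 0 ≤ 2 - c)]

theorem sq_add_sq_add_sq_le {a b c : ℝ} (ha : 0 < a) (hb : 0 < b) (hc : 0 < c)
    (h1 : b * c ≤ 2 * a) (h2 : c * a ≤ 2 * b) (h3 : a * b ≤ 2 * c) :
    a ≤ 2 ∧ b ≤ 2 ∧ c ≤ 2 ∧ a ^ 2 + b ^ 2 + c ^ 2 - a * b * c ≤ 4 := by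
  -- If `c > 2`, then `2a ≥ bc > 2b ≥ ca > 2a`.
  have bd : ∀ {a b c : ℝ}, 0 < a → 0 < b → 0 < c → b * c ≤ 2 * a → c * a ≤ 2 * b → c ≤ 2 := by
    intro a b c ha hb hc h1 h2
    by_contra! h
    nlinarith [mul_pos ha hb]
  have h4 : c ≤ 2 := bd ha hb hc h1 h2
  have h5 : a ≤ 2 := bd hb hc ha h2 h3
  have h6 : b ≤ 2 := bd hc ha hb h3 h1
  refine ⟨h5, h6, h4, ?_⟩
  rcases le_total a b with l1 | l1 <;> rcases le_total b c with l2 | l2 <;>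
    rcases le_total a c with l3 | l3
  · exact sq_add_sq_add_sq_le_of_sorted hb l1 l2 h4 h1
  · exact sq_add_sq_add_sq_le_of_sorted hb l1 l2 h4 h1
  · linarith [sq_add_sq_add_sq_le_of_sorted hc l3 l2 h6 (by linarith)]
  · linarith [sq_add_sq_add_sq_le_of_sorted ha l3 l1 h6 (by linarith)]
  · linarith [sq_add_sq_add_sq_le_of_sorted ha l1 l3 h4 (by linarith)]
  · linarith [sq_add_sq_add_sq_le_of_sorted hc l2 l3 h5 (by linarith)]
  · linarith [sq_add_sq_add_sq_le_of_sorted hb l2 l1 h5 (by linarith)]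
  · linarith [sq_add_sq_add_sq_le_of_sorted hb l2 l1 h5 (by linarith)]

/-- Squaring the hypothesis gives `(t_{k+1} t_{k+2})² ≤ 2 t_0 t_1 t_2` for all `k`. The product is
thus nonnegative, and nonzero by connectedness; dividing leaves `|t_{k+1} t_{k+2}| ≤ 2 |t_k|`. -/
theorem isBoundedTriple_of_maximal {t : Fin 3 → ℝ} (hc : IsConnectedTriple t)
    (h : ∀ k, |t (k + 1) * t (k + 2) - t k| ≤ |t k|) : IsBoundedTriple t := by
  have h0 := sq_le_sq.2 (h 0)
  have h1 := sq_le_sq.2 (h 1)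
  have h2 := sq_le_sq.2 (h 2)
  have c0 := hc 0
  have c1 := hc 1
  have c2 := hc 2
  simp only [zero_add, Fin.isValue, Fin.reduceAdd] at h0 h1 h2 c0 c1 c2
  have hP : 0 < t 0 * t 1 * t 2 := by
    by_contra! hP
    have e0 : t 1 * t 2 = 0 := by nlinarith
    have e1 : t 2 * t 0 = 0 := by nlinarith
    have e2 : t 0 * t 1 = 0 := by nlinarith
    simp only [mul_eq_zero] at e0 e1 e2
    tauto
  have hP' : |t 0| * |t 1| * |t 2| = t 0 * t 1 * t 2 := by
    rw [← abs_mul, ← abs_mul, abs_of_pos hP]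
  have n0 : 0 < |t 0| := abs_pos.2 (by rintro h; simp [h] at hP)
  have n1 : 0 < |t 1| := abs_pos.2 (by rintro h; simp [h] at hP)
  have n2 : 0 < |t 2| := abs_pos.2 (by rintro h; simp [h] at hP)
  have q0 := sq_abs (t 0)
  have q1 := sq_abs (t 1)
  have q2 := sq_abs (t 2)
  obtain ⟨a0, a1, a2, a3⟩ := sq_add_sq_add_sq_le n0 n1 n2
    (by
      have : |t 1| * |t 2| * (|t 1| * |t 2|) ≤ |t 1| * |t 2| * (2 * |t 0|) := by nlinarith
      exact le_of_mul_le_mul_left this (mul_pos n1 n2))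
    (by
      have : |t 2| * |t 0| * (|t 2| * |t 0|) ≤ |t 2| * |t 0| * (2 * |t 1|) := by nlinarith
      exact le_of_mul_le_mul_left this (mul_pos n2 n0))
    (by
      have : |t 0| * |t 1| * (|t 0| * |t 1|) ≤ |t 0| * |t 1| * (2 * |t 2|) := by nlinarith
      exact le_of_mul_le_mul_left this (mul_pos n0 n1))
  refine ⟨?_, by nlinarith⟩
  intro k; fin_cases k <;> assumption

theorem isConnectedTriple_of_mem_vietaOrbit {R : Type*} [CommRing R] [IsDomain R]
    {t : Fin 3 → R} (hc : IsConnectedTriple t) : ∀ u ∈ vietaOrbit t, IsConnectedTriple u :=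
  vietaOrbit_induction hc (fun _ k hu => hu.vieta k)

/-- A connected real triple with a finite orbit is bounded. -/
theorem isBoundedTriple_of_finite {t : Fin 3 → ℝ} (hc : IsConnectedTriple t)
    (hf : (vietaOrbit t).Finite) : IsBoundedTriple t := by
  -- At a triple with the largest sum of absolute values no involution enlarges an entry, so this
  -- triple is bounded. Boundedness is invariant and thus passes back to `t`.
  obtain ⟨u, hu, hmax⟩ := Set.exists_max_image (vietaOrbit t) (fun u => ∑ k, |u k|) hf
    ⟨t, self_mem_vietaOrbit t⟩
  have hub : IsBoundedTriple u := by
    refine isBoundedTriple_of_maximal (isConnectedTriple_of_mem_vietaOrbit hc u hu) ?_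
    intro k
    have h1 := hmax _ (vieta_mem_vietaOrbit hu k)
    have hsum : ∀ v : Fin 3 → ℝ, ∑ l, |v l| = |v k| + |v (k + 1)| + |v (k + 2)| := by
      intro v
      rw [Fin.sum_univ_three]
      fin_cases k <;> simp <;> ring
    rw [hsum, hsum, vieta_self, vieta_add_one, vieta_add_two] at h1
    linarith
  exact vietaOrbit_induction hub (fun v k hv => hv.vieta k) t (mem_vietaOrbit_symm hu)

/-- The entries of a connected complex triple with a finite orbit are of the form `ζ + ζ⁻¹`
with roots of unity `ζ`. -/
theorem exists_rootOfUnity_of_finite {t : Fin 3 → ℂ} (hc : IsConnectedTriple t)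
    (hf : (vietaOrbit t).Finite) (k : Fin 3) :
    ∃ (z : ℂ) (n : ℕ), 0 < n ∧ z ^ n = 1 ∧ t k = z + z⁻¹ := by
  -- The numbers `(t k ± s) / 2` are the roots `z` and `z⁻¹` of `X² - t_k X + 1`.
  obtain ⟨s, hs⟩ := IsAlgClosed.exists_pow_nat_eq (t k ^ 2 - 4) (n := 2) (by norm_num)
  -- `Φ` fixes the entry `k` and acts linearly on the other two, multiplying `u_{k+2} - z u_{k+1}`
  -- by `z⁻²`. If this value is nonzero at `t`, a finite orbit forces `z` to be a root of unity.
  set Φ : (Fin 3 → ℂ) → (Fin 3 → ℂ) := fun u => vieta (k + 2) (vieta (k + 1) u) with hΦ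
  have hk : ∀ u, Φ u k = u k := by
    intro u
    have e1 : k ≠ k + 1 := by clear_value Φ; clear * -; revert k; decide
    have e2 : k ≠ k + 2 := by clear * -; revert k; decide
    rw [hΦ]; dsimp only; rw [vieta_of_ne e2, vieta_of_ne e1]
  have h1 : ∀ u, Φ u (k + 1) = u (k + 2) * u k - u (k + 1) := by
    intro u
    have e2 : k + 1 ≠ k + 2 := by clear * -; revert k; decide
    rw [hΦ]; dsimp only
    rw [vieta_of_ne e2, vieta_self, Fin.three_add_one_add_one, Fin.three_add_one_add_two]
  have h2 : ∀ u, Φ u (k + 2) = u k * Φ u (k + 1) - u (k + 2) := by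
    intro u
    have e1 : k ≠ k + 1 := by clear * -; revert k; decide
    have e2 : k + 2 ≠ k + 1 := by clear * -; revert k; decide
    rw [h1]
    rw [hΦ]; dsimp only
    rw [vieta_self, Fin.three_add_two_add_one, Fin.three_add_two_add_two, vieta_of_ne e1,
      vieta_of_ne e2, vieta_self, Fin.three_add_one_add_one, Fin.three_add_one_add_two]
  have horb : ∀ m, Φ^[m] t ∈ vietaOrbit t := by
    intro m
    induction m with
    | zero => exact self_mem_vietaOrbit t
    | succ m ih =>
      rw [Function.iterate_succ_apply']
      exact vieta_mem_vietaOrbit (vieta_mem_vietaOrbit ih _) _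
  have hkm : ∀ m, Φ^[m] t k = t k := by
    intro m
    induction m with
    | zero => rfl
    | succ m ih => rw [Function.iterate_succ_apply', hk, ih]
  -- the linear recurrence, diagonalised
  have key : ∀ z w : ℂ, z * w = 1 → z + w = t k → t (k + 2) - z * t (k + 1) ≠ 0 →
      ∃ n : ℕ, 0 < n ∧ z ^ n = 1 := by
    intro z w hzw hzk hne
    have hrec : ∀ m, t (k + 2) - z * t (k + 1) =
        z ^ (2 * m) * (Φ^[m] t (k + 2) - z * Φ^[m] t (k + 1)) := by
      intro m
      induction m with
      | zero => simp
      | succ m ih =>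
        rw [ih, Function.iterate_succ_apply', h2, h1, hkm, ← hzk]
        have : z ^ (2 * (m + 1)) = z ^ (2 * m) * z ^ 2 := by ring
        rw [this, mul_assoc]
        congr 1
        linear_combination (-(z ^ 2 * Φ^[m] t (k + 2)) - Φ^[m] t (k + 2) * (z * w + 1)
          + z * Φ^[m] t (k + 1)) * hzw
    obtain ⟨m, -, n, -, hmn, he⟩ := Set.infinite_univ.exists_ne_map_eq_of_mapsTo
      (f := fun m => Φ^[m] t) (fun m _ => horb m) hf
    wlog hlt : m < n generalizing m n
    · exact this n m hmn.symm he.symm (by omega)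
    refine ⟨2 * (n - m), by omega, ?_⟩
    have hm := hrec m
    have hn := hrec n
    rw [← he] at hn
    have hz : z ≠ 0 := left_ne_zero_of_mul_eq_one hzw
    have hx : Φ^[m] t (k + 2) - z * Φ^[m] t (k + 1) ≠ 0 := by
      intro h0; rw [h0, mul_zero] at hm; exact hne hm
    have : z ^ (2 * n) = z ^ (2 * m) := mul_right_cancel₀ hx (hn.symm.trans hm)
    have h3 : z ^ (2 * m) * z ^ (2 * (n - m)) = z ^ (2 * m) * 1 := by
      rw [← pow_add, mul_one, ← this]; congr 1; omega
    exact mul_left_cancel₀ (pow_ne_zero _ hz) h3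
  have hzw : (t k + s) / 2 * ((t k - s) / 2) = 1 := by linear_combination (-1 / 4) * hs
  by_cases c1 : t (k + 2) - (t k + s) / 2 * t (k + 1) = 0
  · by_cases c2 : t (k + 2) - (t k - s) / 2 * t (k + 1) = 0
    -- Both eigenforms vanish at `t`: either the roots coincide, and `z = t_k / 2 = ±1`, or the two
    -- other entries are zero, which connectedness forbids.
    · have h3 : s * t (k + 1) = 0 := by linear_combination c2 - c1
      rcases mul_eq_zero.1 h3 with h3 | h3
      · subst h3
        refine ⟨t k / 2, 2, by norm_num, ?_, ?_⟩
        · linear_combination (-1 / 4) * hs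
        · have : (t k / 2)⁻¹ = t k / 2 :=
            inv_eq_of_mul_eq_one_left (by linear_combination (-1 / 4) * hs)
          rw [this]; ring
      · rw [h3, mul_zero, sub_zero] at c1
        rcases hc k with h4 | h4
        · exact absurd h3 h4
        · exact absurd c1 h4
    · obtain ⟨n, hn, hn1⟩ := key ((t k - s) / 2) ((t k + s) / 2) (by rw [mul_comm]; exact hzw)
        (by ring) c2
      refine ⟨_, n, hn, hn1, ?_⟩
      rw [inv_eq_of_mul_eq_one_left hzw]; ring
  · obtain ⟨n, hn, hn1⟩ := key ((t k + s) / 2) ((t k - s) / 2) hzw (by ring) c1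
    refine ⟨_, n, hn, hn1, ?_⟩
    rw [inv_eq_of_mul_eq_one_right hzw]; ring

theorem isIntegral_of_finite {t : Fin 3 → ℂ} (hc : IsConnectedTriple t)
    (hf : (vietaOrbit t).Finite) (k : Fin 3) : IsIntegral ℤ (t k) := by
  obtain ⟨z, n, hn, hz, hk⟩ := exists_rootOfUnity_of_finite hc hf k
  rw [hk]
  refine IsIntegral.add ?_ ?_
  · exact IsIntegral.of_pow hn (by rw [hz]; exact isIntegral_one)
  · exact IsIntegral.of_pow hn (by rw [inv_pow, hz, inv_one]; exact isIntegral_one)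

theorem im_eq_zero_of_finite {t : Fin 3 → ℂ} (hc : IsConnectedTriple t)
    (hf : (vietaOrbit t).Finite) (k : Fin 3) : (t k).im = 0 := by
  obtain ⟨z, n, hn, hz, hk⟩ := exists_rootOfUnity_of_finite hc hf k
  have h1 : ‖z‖ = 1 := Complex.norm_eq_one_of_pow_eq_one hz (by omega)
  rw [hk, Complex.inv_eq_conj h1]
  simp



/-! ### Integrality and finiteness of the pairings of vectors of square length two -/

/-- The Gram matrix with diagonal entries `2` whose entry off the diagonal at the place
`(i, j)` is `t_k`, where `{i, j, k} = {0, 1, 2}`. -/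
def gramOf {R : Type*} [CommRing R] (t : Fin 3 → R) : Matrix (Fin 3) (Fin 3) R :=
  Matrix.of fun i j => if i = j then 2 else t (-(i + j))

theorem gramOf_map {R S : Type*} [CommRing R] [CommRing S] (f : R →+* S) (t : Fin 3 → R)
    (i j : Fin 3) : gramOf (f ∘ t) i j = f (gramOf t i j) := by
  by_cases h : i = j
  · simp only [gramOf, Matrix.of_apply, if_pos h, map_ofNat]
  · simp only [gramOf, Matrix.of_apply, if_neg h, Function.comp_apply]

theorem quadratic_nonneg {p q r b c : ℝ} (hp : 0 ≤ p) (hr : 0 ≤ r) (h : q ^ 2 ≤ p * r) :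
    0 ≤ p * b ^ 2 + 2 * q * (b * c) + r * c ^ 2 := by
  have h1 : |q| ≤ √p * √r := by
    rw [← Real.sqrt_mul hp, ← Real.sqrt_sq_eq_abs]
    exact Real.sqrt_le_sqrt h
  have h2 : -(√p * √r * (|b| * |c|)) ≤ q * (b * c) := by
    have : |q * (b * c)| ≤ √p * √r * (|b| * |c|) := by
      rw [abs_mul, abs_mul]; gcongr
    exact (neg_le_neg this).trans (neg_abs_le _)
  have h3 : 0 ≤ (√p * |b| - √r * |c|) ^ 2 := sq_nonneg _
  have h4 : (√p * |b| - √r * |c|) ^ 2 = p * b ^ 2 + r * c ^ 2 - 2 * (√p * √r * (|b| * |c|)) := by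
    rw [sub_sq, mul_pow, mul_pow, Real.sq_sqrt hp, Real.sq_sqrt hr, sq_abs, sq_abs]; ring
  linarith

/-- Completing the square in `x 0` leaves a binary form whose discriminant condition is
`IsBoundedTriple.sq_le` for the index `0`. -/
theorem IsBoundedTriple.gram_nonneg {t : Fin 3 → ℝ} (h : IsBoundedTriple t) (x : Fin 3 → ℝ) :
    0 ≤ ∑ i, ∑ j, x i * gramOf t i j * x j := by
  have h1 := h.1 1
  have h2 := h.1 2
  have h0 := h.sq_le 0
  have h1' : t 1 ^ 2 ≤ 4 := by rw [← sq_abs]; nlinarith [abs_nonneg (t 1)]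
  have h2' : t 2 ^ 2 ≤ 4 := by rw [← sq_abs]; nlinarith [abs_nonneg (t 2)]
  simp only [zero_add] at h0
  have := quadratic_nonneg (b := x 1) (c := x 2) (p := 4 - t 2 ^ 2) (r := 4 - t 1 ^ 2)
    (q := 2 * t 0 - t 1 * t 2) (by linarith) (by linarith) (by linarith)
  have e : 2 * ∑ i, ∑ j, x i * gramOf t i j * x j = (2 * x 0 + t 2 * x 1 + t 1 * x 2) ^ 2 +
      ((4 - t 2 ^ 2) * x 1 ^ 2 + 2 * (2 * t 0 - t 1 * t 2) * (x 1 * x 2) +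
        (4 - t 1 ^ 2) * x 2 ^ 2) := by
    have n1 : (-1 : Fin 3) = 2 := by decide
    have n2 : (-2 : Fin 3) = 1 := by decide
    simp only [Fin.sum_univ_three, gramOf, Matrix.of_apply]
    simp [n1, n2]
    ring
  nlinarith [sq_nonneg (2 * x 0 + t 2 * x 1 + t 1 * x 2)]

theorem gramOf_comm {R : Type*} [CommRing R] (t : Fin 3 → R) (i j : Fin 3) :
    gramOf t i j = gramOf t j i := by
  simp only [gramOf, Matrix.of_apply, eq_comm (a := i), add_comm i j]

/-- Cauchy–Schwarz: with `s` the pairing of `x` and `e_j`, the form takes the value `2 - s²/2` at `x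
- (s/2) e_j`. -/
theorem IsBoundedTriple.abs_pairing_le {t : Fin 3 → ℝ} (h : IsBoundedTriple t) {x : Fin 3 → ℝ}
    (hx : ∑ i, ∑ j, x i * gramOf t i j * x j = 2) (j : Fin 3) :
    |∑ i, x i * gramOf t i j| ≤ 2 := by
  set s := ∑ i, x i * gramOf t i j with hs
  have h1 := h.gram_nonneg (fun i => x i - if i = j then s / 2 else 0)
  have e : ∑ i, ∑ l, (x i - if i = j then s / 2 else 0) * gramOf t i l *
      (x l - if l = j then s / 2 else 0) = (∑ i, ∑ l, x i * gramOf t i l * x l) - s ^ 2 / 2 := by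
    have hjj : gramOf t j j = 2 := by simp [gramOf]
    have hs' : ∑ i, gramOf t j i * x i = s := by
      rw [hs]; refine Finset.sum_congr rfl fun i _ => ?_
      rw [gramOf_comm t j i, mul_comm]
    have e1 : ∀ i l, (x i - if i = j then s / 2 else 0) * gramOf t i l *
        (x l - if l = j then s / 2 else 0) = x i * gramOf t i l * x l
        - (if l = j then x i * gramOf t i j * (s / 2) else 0)
        - (if i = j then gramOf t j l * x l * (s / 2) else 0)
        + (if i = j then (if l = j then gramOf t j j * (s / 2) * (s / 2) else 0) else 0) := by
      intro i l
      split_ifs with a b b <;> subst_vars <;> ring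
    simp only [e1, Finset.sum_add_distrib, Finset.sum_sub_distrib, Finset.sum_ite_eq',
      Finset.mem_univ, if_true]
    have e2 : ∑ i, ∑ l, (if i = j then gramOf t j l * x l * (s / 2) else 0) = s * (s / 2) := by
      rw [Finset.sum_comm]
      simp only [Finset.sum_ite_eq', Finset.mem_univ, if_true]
      rw [← Finset.sum_mul, hs']
    have e3 : ∑ i, x i * gramOf t i j * (s / 2) = s * (s / 2) := by
      rw [← Finset.sum_mul]
    have e4 : ∑ i, ∑ l, (if i = j then (if l = j then gramOf t j j * (s / 2) * (s / 2) else 0)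
        else 0) = gramOf t j j * (s / 2) * (s / 2) := by
      rw [Finset.sum_comm]; simp
    rw [e2, e3, e4, hjj]
    ring
  rw [e, hx] at h1
  rw [abs_le]
  constructor <;> nlinarith

theorem finite_vietaOrbit_of_injective {R S : Type*} [CommRing R] [CommRing S] (f : R →+* S)
    (hf : Function.Injective f) {t : Fin 3 → R} (h : (vietaOrbit (f ∘ t)).Finite) :
    (vietaOrbit t).Finite := by
  refine Set.Finite.of_finite_image (h.subset ?_) (f := fun u => f ∘ u) ?_
  · rintro _ ⟨u, hu, rfl⟩; exact map_mem_vietaOrbit f hu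
  · intro u _ v _ huv
    funext i; exact hf (congrFun huv i)

theorem IsConnectedTriple.map {R S : Type*} [CommRing R] [CommRing S] {f : R →+* S}
    (hf : Function.Injective f) {t : Fin 3 → R} (h : IsConnectedTriple t) :
    IsConnectedTriple (f ∘ t) := by
  intro k
  simpa only [Function.comp_apply, ne_eq, map_eq_zero_iff f hf] using h k

theorem IsConnectedTriple.of_map {R S : Type*} [CommRing R] [CommRing S] {f : R →+* S}
    {t : Fin 3 → R} (h : IsConnectedTriple (f ∘ t)) : IsConnectedTriple t := by
  intro k
  refine (h k).imp ?_ ?_ <;>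
  · intro h1 h2; apply h1; simp [h2]

/-- Vectors of square length `2` with integral coordinates have finitely many pairings with
the basis vectors: all conjugates of the Gram matrix are positive semidefinite. -/
theorem finite_pairings {t : Fin 3 → ℝ} (hc : IsConnectedTriple t) (hf : (vietaOrbit t).Finite) :
    ∃ O : Subring ℝ, (∀ k, t k ∈ O) ∧
      {g : Fin 3 → ℝ | ∃ c : Fin 3 → ℝ, (∀ i, c i ∈ O) ∧
        ∑ i, ∑ j, c i * gramOf t i j * c j = 2 ∧ g = fun j => ∑ i, c i * gramOf t i j}.Finite := by
  have htint : ∀ k, IsIntegral ℤ (t k) := by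
    intro k
    have h1 := isIntegral_of_finite (hc.map (f := Complex.ofRealHom) Complex.ofReal_injective)
      ((hf.image _).subset (vietaOrbit_map Complex.ofRealHom t)) k
    exact (isIntegral_algHom_iff (Complex.ofRealAm.restrictScalars ℤ)
      Complex.ofReal_injective).1 h1
  let K : IntermediateField ℚ ℝ := IntermediateField.adjoin ℚ (Set.range t)
  have hfd : FiniteDimensional ℚ K :=
    IntermediateField.finiteDimensional_adjoin (by
      rintro _ ⟨k, rfl⟩; exact (htint k).tower_top)
  have hnf : NumberField K := ⟨⟩
  let tK : Fin 3 → K := fun k => ⟨t k, IntermediateField.subset_adjoin ℚ _ ⟨k, rfl⟩⟩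
  have htK : (algebraMap K ℝ) ∘ tK = t := rfl
  have hcK : IsConnectedTriple tK := IsConnectedTriple.of_map (f := algebraMap K ℝ) (by rwa [htK])
  have hfK : (vietaOrbit tK).Finite :=
    finite_vietaOrbit_of_injective (algebraMap K ℝ) (algebraMap K ℝ).injective (by rwa [htK])
  -- `K` is totally real: an embedding carries the triple to one with a finite orbit, whose entries
  -- `ζ + ζ⁻¹` are real.
  have hreal : ∀ (φ : K →+* ℂ) (x : K), (φ x).im = 0 := by
    rintro φ ⟨x, hx⟩
    induction hx using IntermediateField.adjoin_induction with
    | mem x hx =>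
      obtain ⟨k, rfl⟩ := hx
      exact im_eq_zero_of_finite (hcK.map (f := φ) φ.injective)
        ((hfK.image _).subset (vietaOrbit_map φ tK)) k
    | algebraMap q =>
      have : (⟨algebraMap ℚ ℝ q, K.algebraMap_mem q⟩ : K) = (q : K) := by
        apply Subtype.ext; simp
      exact (congrArg (fun y => (φ y).im) this).trans (by simp)
    | add x y hx hy h1 h2 =>
      have : (⟨x + y, add_mem hx hy⟩ : K) = ⟨x, hx⟩ + ⟨y, hy⟩ := rfl
      exact (congrArg (fun y => (φ y).im) this).trans (by
        simp only [map_add, Complex.add_im]; exact (by rw [h1, h2, add_zero]))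
    | inv x hx h1 =>
      have : (⟨x⁻¹, inv_mem hx⟩ : K) = (⟨x, hx⟩ : K)⁻¹ := rfl
      exact (congrArg (fun y => (φ y).im) this).trans (by
        simp only [map_inv₀, Complex.inv_im]; rw [h1]; simp)
    | mul x y hx hy h1 h2 =>
      have : (⟨x * y, mul_mem hx hy⟩ : K) = ⟨x, hx⟩ * ⟨y, hy⟩ := rfl
      exact (congrArg (fun y => (φ y).im) this).trans (by
        simp only [map_mul, Complex.mul_im]; rw [h1, h2]; simp)
  have hre : ∀ (φ : K →+* ℂ) (x : K), φ x = ((φ x).re : ℂ) := fun φ x =>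
    Complex.ext (by simp) (by simp [hreal φ x])
  -- The ring `O` consists of the algebraic integers of `K`. Finitely many of them have all
  -- conjugates of absolute value at most 2.
  refine ⟨K.toSubring ⊓ (integralClosure ℤ ℝ).toSubring, fun k => ⟨(tK k).2, htint k⟩, ?_⟩
  have hfin := NumberField.Embeddings.finite_of_norm_le K ℂ 2
  refine ((Set.Finite.pi' (fun _ : Fin 3 => hfin)).image (fun g i => (g i : ℝ))).subset ?_
  rintro g ⟨c, hcO, hc2, rfl⟩
  let cK : Fin 3 → K := fun i => ⟨c i, (hcO i).1⟩
  have hcKint : ∀ i, IsIntegral ℤ (cK i) := fun i =>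
    (isIntegral_algHom_iff (K.val.restrictScalars ℤ) Subtype.val_injective).1 (hcO i).2
  have htKint : ∀ k, IsIntegral ℤ (tK k) := fun i =>
    (isIntegral_algHom_iff (K.val.restrictScalars ℤ) Subtype.val_injective).1 (htint i)
  have hgram : ∀ i j, ((gramOf tK i j : K) : ℝ) = gramOf t i j := fun i j =>
    (gramOf_map (algebraMap K ℝ) tK i j).symm
  have hgint : ∀ i j, IsIntegral ℤ (gramOf tK i j) := by
    intro i j
    by_cases h : i = j
    · simp only [gramOf, Matrix.of_apply, if_pos h]
      exact isIntegral_algebraMap (x := (2 : ℤ))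
    · simp only [gramOf, Matrix.of_apply, if_neg h]; exact htKint _
  have hcK2 : ∑ i, ∑ j, cK i * gramOf tK i j * cK j = 2 := by
    apply Subtype.val_injective
    push_cast
    simp only [hgram]
    exact hc2
  refine ⟨fun j => ∑ i, cK i * gramOf tK i j, ?_, ?_⟩
  · intro j
    refine ⟨IsIntegral.sum _ fun i _ => (hcKint i).mul (hgint i j), ?_⟩
    intro φ
    let u : Fin 3 → ℝ := fun k => (φ (tK k)).re
    have hu : Complex.ofRealHom ∘ u = φ ∘ tK := funext fun k => (hre φ (tK k)).symm
    have huf : (vietaOrbit u).Finite := by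
      refine finite_vietaOrbit_of_injective Complex.ofRealHom Complex.ofReal_injective ?_
      rw [hu]
      exact (hfK.image _).subset (vietaOrbit_map φ tK)
    have huc : IsConnectedTriple u := by
      refine IsConnectedTriple.of_map (f := Complex.ofRealHom) ?_
      rw [hu]; exact hcK.map φ.injective
    have hub := isBoundedTriple_of_finite huc huf
    have hg : ∀ i j, ((gramOf u i j : ℝ) : ℂ) = φ (gramOf tK i j) := by
      intro i j
      rw [← gramOf_map, ← hu]
      exact (gramOf_map Complex.ofRealHom u i j).symm
    -- Conjugation preserves the equation expressing square length 2, and the conjugate Gram matrix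
    -- is again positive semidefinite, so the conjugate pairing is bounded by 2 too.
    have h2 := hub.abs_pairing_le (x := fun i => (φ (cK i)).re) (by
      apply Complex.ofReal_injective
      have := congrArg φ hcK2
      simp only [map_sum, map_mul, map_ofNat] at this
      push_cast
      rw [← this]
      refine Finset.sum_congr rfl fun i _ => Finset.sum_congr rfl fun j _ => ?_
      rw [hg, ← hre, ← hre]) j
    rw [map_sum]
    have e : ∑ i, φ (cK i * gramOf tK i j) = ((∑ i, (φ (cK i)).re * gramOf u i j : ℝ) : ℂ) := by
      push_cast
      refine Finset.sum_congr rfl fun i _ => ?_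
      rw [hg, ← hre, map_mul]
    rw [e, Complex.norm_real]
    exact h2
  · funext j
    simp only
    push_cast
    refine Finset.sum_congr rfl fun i _ => ?_
    rw [hgram]



/-! ### Seeds, their Gram triples and the radical of the quadratic space -/

section SeedBasis

variable {V : Type*} [AddCommGroup V] [Module ℝ V]

/-- The three products of a triple of vectors. -/
def gramTriple (Q : LinearMap.BilinForm ℝ V) (v : Fin 3 → V) (k : Fin 3) : ℝ :=
  Q (v (k + 1)) (v (k + 2))

theorem gramOf_gramTriple {Q : LinearMap.BilinForm ℝ V} (hQ : ∀ x y, Q x y = Q y x)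
    {v : Fin 3 → V} (hv : ∀ i, Q (v i) (v i) = 2) (i j : Fin 3) :
    gramOf (gramTriple Q v) i j = Q (v i) (v j) := by
  have n1 : (-1 : Fin 3) = 2 := by decide
  have n2 : (-2 : Fin 3) = 1 := by decide
  fin_cases i <;> fin_cases j <;> simp [gramOf, gramTriple, hv, n1, n2] <;> exact hQ _ _

theorem ncard_pairs (P : Fin 3 → Fin 3 → Prop) [∀ i j, Decidable (P i j)] :
    {p : Fin 3 × Fin 3 | p.1 < p.2 ∧ P p.1 p.2}.ncard =
      (if P 0 1 then 1 else 0) + (if P 0 2 then 1 else 0) + (if P 1 2 then 1 else 0) := by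
  have : {p : Fin 3 × Fin 3 | p.1 < p.2 ∧ P p.1 p.2} =
      ((Finset.univ.filter fun p : Fin 3 × Fin 3 => p.1 < p.2 ∧ P p.1 p.2 : Finset _) :
        Set (Fin 3 × Fin 3)) := by
    ext; simp
  rw [this, Set.ncard_coe_finset, Finset.card_filter, Fintype.sum_prod_type]
  simp only [Fin.sum_univ_three]
  simp

theorem mul_pos_of_odd {x y z : ℝ} (hx : x ≠ 0) (hy : y ≠ 0) (hz : z ≠ 0)
    (h : Odd ((if 0 < x then 1 else 0) + (if 0 < y then 1 else 0) + (if 0 < z then 1 else 0))) :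
    0 < x * y * z := by
  rcases lt_or_gt_of_ne hx with a | a <;> rcases lt_or_gt_of_ne hy with b | b <;>
    rcases lt_or_gt_of_ne hz with c | c <;>
    simp only [a, b, c, a.not_gt, b.not_gt, c.not_gt, if_true, if_false] at h
  · exact absurd h (by decide)
  · exact mul_pos (mul_pos_of_neg_of_neg a b) c
  · exact mul_pos_of_neg_of_neg (mul_neg_of_neg_of_pos a b) c
  · exact absurd h (by decide)
  · exact mul_pos_of_neg_of_neg (mul_neg_of_pos_of_neg a b) c
  · exact absurd h (by decide)
  · exact absurd h (by decide)
  · positivity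

theorem mul_nonpos_of_even {x y z : ℝ} (hx : x ≠ 0) (hy : y ≠ 0) (hz : z ≠ 0)
    (h : Even ((if 0 < x then 1 else 0) + (if 0 < y then 1 else 0) + (if 0 < z then 1 else 0))) :
    x * y * z ≤ 0 := by
  have := mul_pos_of_odd (neg_ne_zero.2 hx) (neg_ne_zero.2 hy) (neg_ne_zero.2 hz) (by
    rcases lt_or_gt_of_ne hx with a | a <;> rcases lt_or_gt_of_ne hy with b | b <;>
    rcases lt_or_gt_of_ne hz with c | c <;>
    simp only [neg_pos, a, b, c, a.not_gt, b.not_gt, c.not_gt, if_true, if_false] at h ⊢ <;>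
    first | decide | exact absurd h (by decide))
  linarith [(by ring : -x * -y * -z = -(x * y * z))]

-- Among three nonzero numbers an odd number of positive ones means a positive product; this turns
-- the parity axioms of a seed into the sign conditions of `CompatTriple`.
open Classical in
theorem IsSeed.compatMatrix {Q : LinearMap.BilinForm ℝ V} (hQ : ∀ x y, Q x y = Q y x)
    {s : Seed V} (hs : IsSeed Q s) : CompatMatrix s.mat (gramTriple Q s.vec) := by
  have habs := hs.realisation.abs_eq
  have hac := isAcyclic_iff hs.skew
  have he := hs.realisation.even_of_acyclic
  have ho := hs.realisation.odd_of_cyclic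
  rw [ncard_pairs (fun i j => 0 < Q (s.vec i) (s.vec j))] at he ho
  have a0 : |Q (s.vec 1) (s.vec 2)| = |s.mat 1 2| := habs 1 2 (by decide)
  have a1 : |Q (s.vec 2) (s.vec 0)| = |s.mat 2 0| := habs 2 0 (by decide)
  have a2 : |Q (s.vec 0) (s.vec 1)| = |s.mat 0 1| := habs 0 1 (by decide)
  have e10 := hQ (s.vec 1) (s.vec 0)
  have e21 := hQ (s.vec 2) (s.vec 1)
  have e02 := hQ (s.vec 0) (s.vec 2)
  have hne : Q (s.vec 1) (s.vec 2) ≠ 0 → Q (s.vec 2) (s.vec 0) ≠ 0 →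
      Q (s.vec 0) (s.vec 1) ≠ 0 → ∀ i j, i ≠ j → Q (s.vec i) (s.vec j) ≠ 0 := by
    intro h0 h1 h2 i j hij
    fin_cases i <;> fin_cases j <;> simp [e10, e21, e02, h0, h1, h2] at hij ⊢
  rw [e02] at he ho
  refine ⟨a0, a1, a2, ?_, ?_⟩
  · simp only [arrows, gramTriple, zero_add, Fin.isValue, Fin.reduceAdd]
    intro hcyc
    have n0 : Q (s.vec 1) (s.vec 2) ≠ 0 := by
      rw [← abs_pos, a0, abs_pos]; rcases hcyc with h | h
      exacts [h.1.ne', h.1.ne]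
    have n1 : Q (s.vec 2) (s.vec 0) ≠ 0 := by
      rw [← abs_pos, a1, abs_pos]; rcases hcyc with h | h
      exacts [h.2.1.ne', h.2.1.ne]
    have n2 : Q (s.vec 0) (s.vec 1) ≠ 0 := by
      rw [← abs_pos, a2, abs_pos]; rcases hcyc with h | h
      exacts [h.2.2.ne', h.2.2.ne]
    have := mul_pos_of_odd n2 n1 n0 (ho (hne n0 n1 n2) fun h => hac.1 h
      (hcyc.imp (fun ⟨a, b, c⟩ => ⟨c, a, b⟩) (fun ⟨a, b, c⟩ => ⟨c, a, b⟩)))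
    linarith
  · simp only [arrows, gramTriple, zero_add, Fin.isValue, Fin.reduceAdd]
    intro hcyc
    by_contra! hpos
    have n0 : Q (s.vec 1) (s.vec 2) ≠ 0 := by rintro h; simp [h] at hpos
    have n1 : Q (s.vec 2) (s.vec 0) ≠ 0 := by rintro h; simp [h] at hpos
    have n2 : Q (s.vec 0) (s.vec 1) ≠ 0 := by rintro h; simp [h] at hpos
    have := mul_nonpos_of_even n2 n1 n0 (he (hne n0 n1 n2) (hac.2 fun h => hcyc
      (h.imp (fun ⟨a, b, c⟩ => ⟨b, c, a⟩) (fun ⟨a, b, c⟩ => ⟨b, c, a⟩))))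
    linarith

/-- The basis of `V` given by a seed. -/
noncomputable def IsSeed.basis {Q : LinearMap.BilinForm ℝ V} {s : Seed V} (hs : IsSeed Q s) :
    Module.Basis (Fin 3) ℝ V :=
  Module.Basis.mk hs.realisation.linearIndependent hs.realisation.span_eq_top.ge

@[simp] theorem IsSeed.basis_apply {Q : LinearMap.BilinForm ℝ V} {s : Seed V} (hs : IsSeed Q s)
    (i : Fin 3) : hs.basis i = s.vec i := by simp [IsSeed.basis]

theorem basis_det_of_partial_transvection (b : Module.Basis (Fin 3) ℝ V) {v w : Fin 3 → V}
    (k : Fin 3) (hk : w k = -v k) (h : ∀ i, i ≠ k → ∃ a : ℝ, w i = v i + a • v k) :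
    b.det w = -b.det v := by
  obtain ⟨a, ha⟩ := h (k + 1) (by clear * -; revert k; decide)
  obtain ⟨c, hc⟩ := h (k + 2) (by clear * -; revert k; decide)
  simp only [Module.Basis.det_apply, Matrix.det_fin_three, Module.Basis.toMatrix_apply]
  fin_cases k
  · simp only [Fin.zero_eta, zero_add, Fin.isValue] at ha hc hk
    simp only [ha, hc, hk, map_add, map_neg, map_smul, Finsupp.add_apply, Finsupp.neg_apply,
      Finsupp.smul_apply, smul_eq_mul]
    ring
  · simp only [Fin.mk_one, Fin.isValue, Fin.reduceAdd] at ha hc hk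
    simp only [ha, hc, hk, map_add, map_neg, map_smul, Finsupp.add_apply, Finsupp.neg_apply,
      Finsupp.smul_apply, smul_eq_mul]
    ring
  · simp only [Fin.reduceFinMk, Fin.isValue, Fin.reduceAdd] at ha hc hk
    simp only [ha, hc, hk, map_add, map_neg, map_smul, Finsupp.add_apply, Finsupp.neg_apply,
      Finsupp.smul_apply, smul_eq_mul]
    ring

theorem basis_det_signedMutation (b : Module.Basis (Fin 3) ℝ V) (Q : LinearMap.BilinForm ℝ V)
    (ε : Bool) (k : Fin 3) (s : Seed V) :
    b.det (signedMutation Q ε k s).vec = -b.det s.vec := by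
  refine basis_det_of_partial_transvection b k (by simp [signedMutation]) ?_
  intro i hi
  simp only [signedMutation, if_neg hi]
  split_ifs
  · exact ⟨-Q (s.vec i) (s.vec k), by rw [neg_smul, sub_eq_add_neg]⟩
  · exact ⟨0, by simp⟩

theorem ReachedIn.det {Q : LinearMap.BilinForm ℝ V} {s : Seed V} (hs : IsSeed Q s) {m : ℕ}
    {t : Seed V} (h : ReachedIn Q s m t) :
    hs.basis.det t.vec = 1 ∨ hs.basis.det t.vec = -1 := by
  induction h with
  | refl =>
    left
    have : s.vec = hs.basis := by funext i; simp
    rw [this, Module.Basis.det_self]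
  | step ε k _ ih =>
    rw [basis_det_signedMutation]
    rcases ih with ih | ih <;> simp [ih]
  | stay _ ih => exact ih

/-- The seeds that are reached from `s` by any sequence of signed mutations. -/
def reached (Q : LinearMap.BilinForm ℝ V) (s : Seed V) : Set (Seed V) :=
  {t | ∃ m, ReachedIn Q s m t}

/-- The type of a seed: its vectors modulo the radical, its matrix and its orientation. -/
noncomputable def IsSeed.typeOf {Q : LinearMap.BilinForm ℝ V} {s : Seed V} (hs : IsSeed Q s)
    (t : Seed V) : (Fin 3 → Fin 3 → ℝ) × Matrix (Fin 3) (Fin 3) ℝ × ℝ :=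
  (fun i j => Q (t.vec i) (s.vec j), t.mat, hs.basis.det t.vec)

theorem IsSeed.bilin_eq_sum {Q : LinearMap.BilinForm ℝ V} (hQ : ∀ x y, Q x y = Q y x)
    {s : Seed V} (hs : IsSeed Q s) (v w : V) :
    Q v w = ∑ i, ∑ j, hs.basis.repr v i * gramOf (gramTriple Q s.vec) i j * hs.basis.repr w j := by
  conv_lhs => rw [← hs.basis.sum_repr v, ← hs.basis.sum_repr w]
  simp only [map_sum, LinearMap.sum_apply, map_smul, LinearMap.smul_apply, smul_eq_mul,
    IsSeed.basis_apply, gramOf_gramTriple hQ hs.realisation.self_eq_two]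
  rw [Finset.sum_comm]
  refine Finset.sum_congr rfl fun j _ => ?_
  rw [Finset.mul_sum]
  exact Finset.sum_congr rfl fun i _ => by ring

/-- The coordinates of the vectors of all seeds belong to every ring which contains the Gram
matrix. -/
theorem IsSeed.repr_mem_of_mem_reached {Q : LinearMap.BilinForm ℝ V} (hQ : ∀ x y, Q x y = Q y x)
    {s : Seed V} (hs : IsSeed Q s) {O : Subring ℝ}
    (hgO : ∀ i j, gramOf (gramTriple Q s.vec) i j ∈ O) :
    ∀ t ∈ reached Q s, ∀ i j, hs.basis.repr (t.vec i) j ∈ O := by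
  rintro t ⟨m, hm⟩
  induction hm with
  | refl =>
    intro i j
    rw [← hs.basis_apply, Module.Basis.repr_self, Finsupp.single_apply]
    split_ifs
    exacts [O.one_mem, O.zero_mem]
  | step ε k _ ih =>
    intro i
    refine signedMutation_induct (P := fun v => ∀ j, hs.basis.repr v j ∈ O) ?_ ?_ ih ε k i
    · intro v hv j
      rw [map_neg, Finsupp.neg_apply]
      exact O.neg_mem (hv j)
    · intro v w hv hw j
      rw [map_sub, map_smul, Finsupp.sub_apply, Finsupp.smul_apply, smul_eq_mul,
        hs.bilin_eq_sum hQ]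
      exact O.sub_mem (hv j) (O.mul_mem (O.sum_mem fun a _ => O.sum_mem fun b _ =>
        O.mul_mem (O.mul_mem (hv a) (hgO a b)) (hw b)) (hw j))
  | stay _ ih => exact ih

/-- Vectors of reached seeds have square length 2 and coordinates in `O`, so `finite_pairings`
applies to them. Matrices are finite in number by assumption, and the determinant is `±1`. -/
theorem IsSeed.finite_types {Q : LinearMap.BilinForm ℝ V} (hQ : ∀ x y, Q x y = Q y x)
    {s : Seed V} (hs : IsSeed Q s) (hfin : IsMutationFinite s.mat)
    (hc : IsConnectedTriple (gramTriple Q s.vec)) : (hs.typeOf '' reached Q s).Finite := by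
  have horb := finite_vietaOrbit_of_isMutationFinite hs.skew hfin (hs.compatMatrix hQ)
  obtain ⟨O, htO, hO⟩ := finite_pairings hc horb
  have hgO : ∀ i j, gramOf (gramTriple Q s.vec) i j ∈ O := by
    intro i j
    by_cases h : i = j
    · simp only [gramOf, Matrix.of_apply, if_pos h]; exact ofNat_mem O 2
    · simp only [gramOf, Matrix.of_apply, if_neg h]; exact htO _
  have hint := hs.repr_mem_of_mem_reached hQ hgO
  refine ((Set.Finite.pi' (fun _ : Fin 3 => hO)).prod (hfin.prod
    (Set.toFinite {1, -1}))).subset ?_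
  rintro _ ⟨t, ht, rfl⟩
  have h2 := ht
  obtain ⟨m, hm⟩ := ht
  refine ⟨?_, hm.mat_mem, ?_⟩
  · intro i
    refine ⟨hs.basis.repr (t.vec i), hint t h2 i, ?_, ?_⟩
    · rw [← hs.bilin_eq_sum hQ]
      exact hm.self_eq_two hQ hs.realisation.self_eq_two i
    · funext j
      change Q (t.vec i) (s.vec j) = _
      rw [hs.bilin_eq_sum hQ]
      refine Finset.sum_congr rfl fun a _ => ?_
      rw [← hs.basis_apply, Module.Basis.repr_self]
      simp [Finsupp.single_apply]
  · simpa [IsSeed.typeOf] using hm.det hs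

/-- In the connected case apart from the Markov quiver, some weight is less than two. -/
theorem IsSeed.exists_abs_gramTriple_lt {Q : LinearMap.BilinForm ℝ V} (hQ : ∀ x y, Q x y = Q y x)
    {s : Seed V} (hs : IsSeed Q s) (hfin : IsMutationFinite s.mat)
    (hc : IsConnectedTriple (gramTriple Q s.vec)) (hm : s.mat ≠ markovMatrix)
    (hm' : s.mat ≠ -markovMatrix) : ∃ k, |gramTriple Q s.vec k| < 2 := by
  have hcomp := hs.compatMatrix hQ
  have hb := isBoundedTriple_of_finite hc
    (finite_vietaOrbit_of_isMutationFinite hs.skew hfin hcomp)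
  by_contra! h
  have habs : ∀ k, |gramTriple Q s.vec k| = 2 := fun k => le_antisymm (hb.1 k) (h k)
  have hsq : ∀ k, gramTriple Q s.vec k ^ 2 = 4 := fun k => by
    rw [← sq_abs, habs]; norm_num
  -- If all absolute values are 2, boundedness reads `12 - t_0 t_1 t_2 ≤ 4`. The product is then
  -- positive, the quiver is cyclic, and only the two Markov quivers remain.
  have h3 := hb.2
  rw [hsq, hsq, hsq] at h3
  have hcyc : ¬ ¬ ((0 < arrows s.mat 0 ∧ 0 < arrows s.mat 1 ∧ 0 < arrows s.mat 2) ∨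
      (arrows s.mat 0 < 0 ∧ arrows s.mat 1 < 0 ∧ arrows s.mat 2 < 0)) := fun hn => by
    linarith [hcomp.2.2.2.2 hn]
  rw [not_not] at hcyc
  have e0 := hcomp.1
  have e1 := hcomp.2.1
  have e2 := hcomp.2.2.1
  rw [habs] at e0 e1 e2
  have h10 := skew_apply hs.skew 0 1
  have h21 := skew_apply hs.skew 1 2
  have h02 := skew_apply hs.skew 2 0
  have h00 := skew_diag hs.skew 0
  have h11 := skew_diag hs.skew 1
  have h22 := skew_diag hs.skew 2
  simp only [arrows, zero_add, Fin.isValue, Fin.reduceAdd] at hcyc e0 e1 e2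
  rcases hcyc with ⟨c0, c1, c2⟩ | ⟨c0, c1, c2⟩
  · rw [abs_of_pos c0] at e0; rw [abs_of_pos c1] at e1; rw [abs_of_pos c2] at e2
    refine hm ?_
    ext i j
    fin_cases i <;> fin_cases j <;>
      simp [markovMatrix, h10, h21, h02, h00, h11, h22, ← e0, ← e1, ← e2]
  · rw [abs_of_neg c0] at e0; rw [abs_of_neg c1] at e1; rw [abs_of_neg c2] at e2
    refine hm' ?_
    ext i j
    fin_cases i <;> fin_cases j <;>
      simp [markovMatrix, h10, h21, h02, h00, h11, h22] <;> linarith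

/-- The radical is at most one-dimensional as soon as some weight is less than two. -/
theorem IsSeed.eq_zero_of_mem_radical {Q : LinearMap.BilinForm ℝ V} (hQ : ∀ x y, Q x y = Q y x)
    {s : Seed V} (hs : IsSeed Q s) {k : Fin 3} (hk : |gramTriple Q s.vec k| < 2) {n : V}
    (hn : ∀ y, Q n y = 0) (hnk : hs.basis.repr n k = 0) : n = 0 := by
  set g := gramTriple Q s.vec k with hg
  have hg2 : g ^ 2 < 4 := by rw [← sq_abs]; nlinarith [abs_nonneg g]
  have hsum : n = hs.basis.repr n k • s.vec k + hs.basis.repr n (k + 1) • s.vec (k + 1) +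
      hs.basis.repr n (k + 2) • s.vec (k + 2) := by
    conv_lhs => rw [← hs.basis.sum_repr n]
    simp only [IsSeed.basis_apply, Fin.sum_univ_three]
    fin_cases k <;> simp <;> abel
  rw [hnk, zero_smul, zero_add] at hsum
  set a := hs.basis.repr n (k + 1)
  set c := hs.basis.repr n (k + 2)
  have h1 := hn (s.vec (k + 1))
  have h2 := hn (s.vec (k + 2))
  rw [hsum] at h1 h2
  have hg' : Q (s.vec (k + 2)) (s.vec (k + 1)) = g := by rw [hQ]; rfl
  have hg'' : Q (s.vec (k + 1)) (s.vec (k + 2)) = g := rfl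
  simp only [map_add, map_smul, LinearMap.add_apply, LinearMap.smul_apply, smul_eq_mul,
    hs.realisation.self_eq_two, hg', hg''] at h1 h2
  have ha : (4 - g ^ 2) * a = 0 := by linear_combination 2 * h1 - g * h2
  have hc : (4 - g ^ 2) * c = 0 := by linear_combination 2 * h2 - g * h1
  have h4 : 4 - g ^ 2 ≠ 0 := by linarith
  rw [hsum, (mul_eq_zero.1 ha).resolve_left h4, (mul_eq_zero.1 hc).resolve_left h4]
  simp

/-- A linear map `h` with values in the radical which vanishes on the radical; then `1 + h` is
an isometry. -/
structure IsRadicalShift (Q : LinearMap.BilinForm ℝ V) (h : V →ₗ[ℝ] V) : Prop where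
  mem : ∀ x y, Q (h x) y = 0
  eq_zero : ∀ x, (∀ y, Q x y = 0) → h x = 0

theorem IsRadicalShift.zero (Q : LinearMap.BilinForm ℝ V) : IsRadicalShift Q 0 :=
  ⟨by simp, by simp⟩

theorem IsRadicalShift.add {Q : LinearMap.BilinForm ℝ V} {h h' : V →ₗ[ℝ] V}
    (H : IsRadicalShift Q h) (H' : IsRadicalShift Q h') : IsRadicalShift Q (h + h') :=
  ⟨fun x y => by simp [H.mem, H'.mem], fun x hx => by simp [H.eq_zero x hx, H'.eq_zero x hx]⟩

theorem IsRadicalShift.nsmul {Q : LinearMap.BilinForm ℝ V} {h : V →ₗ[ℝ] V}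
    (H : IsRadicalShift Q h) (n : ℕ) : IsRadicalShift Q (n • h) :=
  ⟨fun x y => by simp [H.mem], fun x hx => by simp [H.eq_zero x hx]⟩

theorem IsRadicalShift.sum {Q : LinearMap.BilinForm ℝ V} {ι : Type*} (s : Finset ι)
    {h : ι → V →ₗ[ℝ] V} (H : ∀ i, IsRadicalShift Q (h i)) :
    IsRadicalShift Q (∑ i ∈ s, h i) := by
  classical
  induction s using Finset.induction_on with
  | empty => simpa using IsRadicalShift.zero Q
  | insert a s ha ih => rw [Finset.sum_insert ha]; exact (H a).add ih

/-- The image of a seed under `1 + h`. -/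
def shiftSeed (h : V →ₗ[ℝ] V) (s : Seed V) : Seed V where
  vec i := s.vec i + h (s.vec i)
  mat := s.mat

/-- Each shift vanishes on the radical, where the others take their values, so `(1 + h)(1 + h') = 1
+ h + h'`. -/
theorem shiftSeed_shiftSeed {Q : LinearMap.BilinForm ℝ V} {h h' : V →ₗ[ℝ] V}
    (H : IsRadicalShift Q h) (H' : IsRadicalShift Q h') (s : Seed V) :
    shiftSeed h (shiftSeed h' s) = shiftSeed (h + h') s := by
  ext1
  · funext i
    simp only [shiftSeed, map_add, LinearMap.add_apply]
    rw [H.eq_zero (h' (s.vec i)) (H'.mem _)]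
    abel
  · rfl

theorem shiftSeed_zero (s : Seed V) : shiftSeed 0 s = s := by
  ext1
  · funext i; simp [shiftSeed]
  · rfl

/-- `1 + h` is a linear isometry, and a mutation with a prescribed sign refers only to the linear
structure, the form and the matrix. -/
theorem signedMutation_shiftSeed {Q : LinearMap.BilinForm ℝ V} (hQ : ∀ x y, Q x y = Q y x)
    {h : V →ₗ[ℝ] V} (H : IsRadicalShift Q h) (ε : Bool) (k : Fin 3) (s : Seed V) :
    signedMutation Q ε k (shiftSeed h s) = shiftSeed h (signedMutation Q ε k s) := by
  ext1
  · funext i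
    have e : ∀ x y, Q (x + h x) (y + h y) = Q x y := by
      intro x y
      simp only [map_add, LinearMap.add_apply, H.mem, hQ x (h y)]
      simp
    simp only [signedMutation, shiftSeed, e]
    split_ifs
    · simp [add_comm]
    · simp only [map_sub, map_smul, smul_add]; abel
    · rfl
  · rfl

/-- Seeds of the same type differ by a radical shift. -/
theorem IsSeed.exists_shift {Q : LinearMap.BilinForm ℝ V} (hQ : ∀ x y, Q x y = Q y x)
    {s : Seed V} (hs : IsSeed Q s) {k : Fin 3} (hk : |gramTriple Q s.vec k| < 2) {t u : Seed V}
    (ht : t ∈ reached Q s) (htu : hs.typeOf t = hs.typeOf u) :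
    ∃ h, IsRadicalShift Q h ∧ u = shiftSeed h t := by
  obtain ⟨m, hm⟩ := ht
  simp only [IsSeed.typeOf, Prod.mk.injEq] at htu
  obtain ⟨h1, h2, h3⟩ := htu
  have hdet := hm.det hs
  have hunit : IsUnit (hs.basis.det t.vec) := by
    rcases hdet with h | h <;> rw [h] <;> simp
  obtain ⟨hli, hsp⟩ := (Module.Basis.is_basis_iff_det hs.basis).2 hunit
  let b := Module.Basis.mk hli hsp.ge
  let h : V →ₗ[ℝ] V := b.constr ℝ (fun i => u.vec i - t.vec i)
  have hb : ∀ i, b i = t.vec i := fun i => by simp [b]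
  have hh : ∀ i, h (t.vec i) = u.vec i - t.vec i := fun i => by
    have := Module.Basis.constr_basis (M' := V) b ℝ (fun i => u.vec i - t.vec i) i
    rwa [hb] at this
  -- Equal types mean that `u_i` and `t_i` have the same products with a basis, so their difference
  -- lies in the radical.
  have hmem : ∀ x y, Q (h x) y = 0 := by
    have hle : LinearMap.range h ≤ LinearMap.ker Q := by
      rw [b.constr_range (S := ℝ), Submodule.span_le]
      rintro _ ⟨i, rfl⟩
      refine LinearMap.mem_ker.2 (hs.basis.ext fun j => ?_)
      simp only [map_sub, LinearMap.sub_apply, IsSeed.basis_apply, LinearMap.zero_apply]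
      rw [congrFun (congrFun h1 i) j, sub_self]
    intro x y
    rw [LinearMap.mem_ker.1 (hle ⟨x, rfl⟩), LinearMap.zero_apply]
  have hu : u = shiftSeed h t := by
    ext1
    · funext i; simp [shiftSeed, hh]
    · exact h2.symm
  refine ⟨h, ⟨hmem, ?_⟩, hu⟩
  intro n hn
  -- For `n ≠ 0` the radical is the line through `n`, and `1 + h` is a transvection `x ↦ x + f x •
  -- n` of determinant `1 + f n`. Since the two seeds have the same nonzero determinant, `f n = 0`.
  by_cases hn0 : n = 0
  · rw [hn0, map_zero]
  set ℓ := hs.basis.coord k with hℓ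
  have hℓn : ℓ n ≠ 0 := fun h0 => hn0 (hs.eq_zero_of_mem_radical hQ hk hn h0)
  have hhx : ∀ x, h x = (ℓ (h x) / ℓ n) • n := by
    intro x
    rw [← sub_eq_zero]
    refine hs.eq_zero_of_mem_radical hQ hk (k := k) ?_ ?_
    · intro y; simp [hmem, hn]
    · change ℓ _ = 0
      rw [map_sub, map_smul, smul_eq_mul, div_mul_cancel₀ _ hℓn, sub_self]
  set f : V →ₗ[ℝ] ℝ := (ℓ n)⁻¹ • (ℓ ∘ₗ h) with hf
  have hT : (LinearMap.id + h : V →ₗ[ℝ] V) = LinearMap.transvection f n := by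
    ext x
    rw [LinearMap.transvection.apply, LinearMap.add_apply, LinearMap.id_apply]
    conv_lhs => rw [hhx x]
    simp [hf, div_eq_inv_mul]
  have : Module.Finite ℝ V := Module.Finite.of_basis hs.basis
  have hdetT : LinearMap.det (LinearMap.id + h : V →ₗ[ℝ] V) = 1 := by
    have e := hs.basis.det_comp (LinearMap.id + h : V →ₗ[ℝ] V) t.vec
    have e2 : (⇑(LinearMap.id + h : V →ₗ[ℝ] V) ∘ t.vec) = u.vec := by
      rw [hu]; rfl
    rw [e2, ← h3] at e
    exact (mul_eq_right₀ hunit.ne_zero).1 e.symm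
  rw [hT, LinearMap.transvection.det] at hdetT
  have hfn : f n = 0 := by linarith
  rw [hhx]
  have : ℓ (h n) / ℓ n = f n := by simp [hf, div_eq_inv_mul]
  rw [this, hfn, zero_smul]

end SeedBasis



/-! ### Polynomial growth for connected quivers -/

section Polynomial

variable {V : Type*} [AddCommGroup V] [Module ℝ V]

/-- A mutation of a chosen representative of a type leads to another representative, shifted by one
of finitely many `H i`. As shifts commute with mutations and add up, only the number of uses of each
`H i` matters. -/
theorem IsSeed.hasPolynomialGrowth_of_connected {Q : LinearMap.BilinForm ℝ V}
    (hQ : ∀ x y, Q x y = Q y x) {s : Seed V} (hs : IsSeed Q s) (hfin : IsMutationFinite s.mat)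
    (hc : IsConnectedTriple (gramTriple Q s.vec)) (hm : s.mat ≠ markovMatrix)
    (hm' : s.mat ≠ -markovMatrix) (pos : Set V) (x : exchangeVertices Q pos s) :
    HasPolynomialGrowth (exchangeGraph Q pos s) x := by
  classical
  obtain ⟨k₀, hk₀⟩ := hs.exists_abs_gramTriple_lt hQ hfin hc hm hm'
  set T := hs.typeOf '' reached Q s with hT
  have hTfin : T.Finite := hs.finite_types hQ hfin hc
  have := hTfin.fintype
  choose rep hrep hreptype using fun τ : T => τ.2
  have hex : ∀ t ∈ reached Q s, ∃ (τ : T) (h : V →ₗ[ℝ] V), IsRadicalShift Q h ∧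
      t = shiftSeed h (rep τ) := by
    intro t ht
    refine ⟨⟨hs.typeOf t, t, ht, rfl⟩, ?_⟩
    exact hs.exists_shift hQ hk₀ (hrep _) (hreptype _)
  have hstep : ∀ p : T × Bool × Fin 3,
      signedMutation Q p.2.1 p.2.2 (rep p.1) ∈ reached Q s := by
    intro p
    obtain ⟨m, hm⟩ := hrep p.1
    exact ⟨m + 1, hm.step _ _⟩
  choose next H hH hnext using fun p => hex _ (hstep p)
  obtain ⟨τ₀, h₀, hh₀, hsh₀⟩ := hex s ⟨0, .refl⟩
  have key : ∀ m t, ReachedIn Q s m t → ∃ (τ : T) (n : T × Bool × Fin 3 → ℕ), (∀ i, n i ≤ m) ∧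
      t = shiftSeed (h₀ + ∑ i, n i • H i) (rep τ) := by
    intro m t h
    induction h with
    | refl => exact ⟨τ₀, 0, by simp, by simpa using hsh₀⟩
    | @step m t ε k _ ih =>
      obtain ⟨τ, n, hn, rfl⟩ := ih
      refine ⟨next (τ, ε, k), n + Pi.single (τ, ε, k) 1, ?_, ?_⟩
      · intro i
        have : (Pi.single (τ, ε, k) 1 : T × Bool × Fin 3 → ℕ) i ≤ 1 := by
          rw [Pi.single_apply]; split_ifs <;> simp
        exact add_le_add (hn i) this
      · have hsum : IsRadicalShift Q (h₀ + ∑ i, n i • H i) :=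
          hh₀.add (IsRadicalShift.sum _ fun i => (hH i).nsmul _)
        have e := hnext (τ, ε, k)
        simp only at e
        rw [signedMutation_shiftSeed hQ hsum, e, shiftSeed_shiftSeed hsum (hH _)]
        congr 1
        simp only [Pi.add_apply, add_smul, Finset.sum_add_distrib]
        have : ∑ i, (Pi.single (τ, ε, k) 1 : T × Bool × Fin 3 → ℕ) i • H i = H (τ, ε, k) := by
          rw [Fintype.sum_eq_single (τ, ε, k) fun b hb => by rw [Pi.single_eq_of_ne hb, zero_smul],
            Pi.single_eq_same, one_smul]
        rw [this, add_assoc]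
    | stay _ ih =>
      obtain ⟨τ, n, hn, rfl⟩ := ih
      exact ⟨τ, n, fun i => (hn i).trans (Nat.le_succ _), rfl⟩
  -- There is one multiplicity in `{0, …, m}` for each choice of type, sign and vertex, which
  -- explains the exponent.
  refine hasPolynomialGrowth_of_card_le hQ hs.realisation.self_eq_two (Fintype.card T)
    (Fintype.card (T × Bool × Fin 3)) ?_ x
  intro m
  have hsub : {t | ReachedIn Q s m t} ⊆ (fun p : T × (T × Bool × Fin 3 → Fin (m + 1)) =>
      shiftSeed (h₀ + ∑ i, (p.2 i : ℕ) • H i) (rep p.1)) '' Set.univ := by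
    intro t ht
    obtain ⟨τ, n, hn, rfl⟩ := key m t ht
    exact ⟨(τ, fun i => ⟨n i, Nat.lt_succ_of_le (hn i)⟩), trivial, rfl⟩
  have hfin' := (Set.finite_univ (α := T × (T × Bool × Fin 3 → Fin (m + 1)))).image
    (fun p => shiftSeed (h₀ + ∑ i, (p.2 i : ℕ) • H i) (rep p.1))
  refine ⟨hfin'.subset hsub, (Set.ncard_le_ncard hsub hfin').trans ?_⟩
  refine (Set.ncard_image_le Set.finite_univ).trans ?_
  rw [Set.ncard_univ, Nat.card_eq_fintype_card, Fintype.card_prod, Fintype.card_fun,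
    Fintype.card_fin]

/-! ### Polynomial growth for disconnected quivers -/

/-- One step of the recurrence `p_{n+1} = z p_n - p_{n-1}` for the vectors of a dihedral group. -/
def dihedralStep (z : ℝ) : (V × V) ≃ (V × V) where
  toFun p := (p.2, z • p.2 - p.1)
  invFun p := (z • p.1 - p.2, p.1)
  left_inv p := by simp
  right_inv p := by simp

def dihedralVec (z : ℝ) (p : V × V) (n : ℤ) : V := ((dihedralStep z ^ n) p).1

theorem dihedralVec_add_two (z : ℝ) (p : V × V) (n : ℤ) :
    dihedralVec z p (n + 2) = z • dihedralVec z p (n + 1) - dihedralVec z p n := by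
  have h1 : ∀ n : ℤ, (dihedralStep (V := V) z ^ (n + 1)) p =
      dihedralStep z ((dihedralStep z ^ n) p) := by
    intro n; rw [add_comm n 1, zpow_add, zpow_one]; rfl
  have h2 : n + 2 = n + 1 + 1 := by ring
  simp only [dihedralVec]
  rw [h2, h1, h1]
  rfl

theorem dihedralVec_zero (z : ℝ) (p : V × V) : dihedralVec z p 0 = p.1 := by
  simp [dihedralVec]

theorem dihedralVec_one (z : ℝ) (p : V × V) : dihedralVec z p 1 = p.2 := by
  simp [dihedralVec, dihedralStep]

theorem dihedralVec_pairing {Q : LinearMap.BilinForm ℝ V} (hQ : ∀ x y, Q x y = Q y x) {z : ℝ}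
    {p : V × V} (h1 : Q p.1 p.1 = 2) (h2 : Q p.2 p.2 = 2) (h3 : Q p.1 p.2 = z) (n : ℤ) :
    Q (dihedralVec z p n) (dihedralVec z p (n + 1)) = z ∧
      Q (dihedralVec z p n) (dihedralVec z p n) = 2 ∧
      Q (dihedralVec z p (n + 1)) (dihedralVec z p (n + 1)) = 2 := by
  induction n using Int.induction_on with
  | zero => simp [dihedralVec_zero, dihedralVec_one, h1, h2, h3]
  | succ n ih =>
    obtain ⟨e1, e2, e3⟩ := ih
    have e := dihedralVec_add_two z p n
    have e4 : ((n : ℤ) + 1 + 1) = n + 2 := by ring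
    rw [e4, e]
    have e1' := e1
    rw [hQ] at e1'
    refine ⟨?_, e3, ?_⟩ <;>
      simp only [map_sub, map_smul, LinearMap.sub_apply, LinearMap.smul_apply, smul_eq_mul, e1,
        e2, e3, e1'] <;> ring
  | pred n ih =>
    obtain ⟨e1, e2, e3⟩ := ih
    have e := dihedralVec_add_two z p (-n - 1)
    have e4 : (-(n : ℤ) - 1 + 2) = -n + 1 := by ring
    have e5 : (-(n : ℤ) - 1 + 1) = -n := by ring
    rw [e4, e5] at e
    have e' : dihedralVec z p (-n - 1) = z • dihedralVec z p (-n) - dihedralVec z p (-n + 1) := by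
      rw [e]; abel
    rw [e5, e']
    have e1' := e1
    rw [hQ] at e1'
    refine ⟨?_, ?_, e2⟩ <;>
      simp only [map_sub, map_smul, LinearMap.sub_apply, LinearMap.smul_apply, smul_eq_mul, e1,
        e2, e3, e1'] <;> ring

/-- No path of two arrows joins distinct vertices, so mutation can only change signs: at `k` nothing
happens, elsewhere the single possible edge is reversed. -/
theorem mutateMatrix_of_isolated {B : Matrix (Fin 3) (Fin 3) ℝ} (hB : B.transpose = -B) {k : Fin 3}
    (h1 : B k (k + 1) = 0) (h2 : B k (k + 2) = 0) (l : Fin 3) :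
    mutateMatrix l B = B ∨ mutateMatrix l B = -B := by
  have h1' : B (k + 1) k = 0 := by rw [skew_apply hB k (k + 1), h1, neg_zero]
  have h2' : B (k + 2) k = 0 := by rw [skew_apply hB k (k + 2), h2, neg_zero]
  have h0 := skew_diag hB
  by_cases hl : l = k
  · left
    rw [hl]
    ext i j
    rcases Fin.three_cases k i with h | h | h <;>
      rcases Fin.three_cases k j with h' | h' | h' <;> rw [h, h'] <;>
      simp [mutateMatrix, h0, h1, h2, h1', h2']
  · right
    ext i j
    have hlk : B l k = 0 ∧ B k l = 0 := by
      rcases Fin.three_cases k l with h | h | h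
      · exact absurd h hl
      · rw [h]; exact ⟨h1', h1⟩
      · rw [h]; exact ⟨h2', h2⟩
    by_cases hij : i = l ∨ j = l
    · simp [mutateMatrix, hij]
    · simp only [mutateMatrix, Matrix.of_apply, hij, if_false, Matrix.neg_apply]
      push Not at hij
      have : i = k ∨ j = k ∨ i = j := by
        clear * - hij hl; revert i j k l; decide
      rcases this with rfl | rfl | rfl
      · have : B i j = 0 := by
          rcases Fin.three_cases i j with h | h | h <;> rw [h]
          exacts [h0 i, h1, h2]
        rw [this, hlk.2]; simp
      · have : B i j = 0 := by
          rcases Fin.three_cases j i with h | h | h <;> rw [h]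
          exacts [h0 j, h1', h2']
        rw [this, hlk.1]; simp
      · rw [h0, skew_apply hB i l, abs_neg]; ring

theorem signedMutation_vec_of_zero {Q : LinearMap.BilinForm ℝ V} {ε : Bool} {k i : Fin 3}
    {s : Seed V} (hi : i ≠ k) (h : s.mat i k = 0) :
    (signedMutation Q ε k s).vec i = s.vec i := by
  simp [signedMutation, hi, h]

/-- For `i` and `j` adjacent, the reflection in the `i`-th vector sends the `j`-th to minus the `(2i
- j)`-th, which is the recurrence read forwards or backwards; the signs `b` and `c` pass through. -/
theorem dihedralVec_reflect {Q : LinearMap.BilinForm ℝ V} (hQ : ∀ x y, Q x y = Q y x) {z : ℝ}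
    {p : V × V} (h1 : Q p.1 p.1 = 2) (h2 : Q p.2 p.2 = 2) (h3 : Q p.1 p.2 = z) {i j : ℤ}
    (hij : j = i + 1 ∨ i = j + 1) (b c : ℤˣ) :
    c • dihedralVec z p j - Q (c • dihedralVec z p j) (b • dihedralVec z p i) •
      (b • dihedralVec z p i) = (-c) • dihedralVec z p (2 * i - j) := by
  have key : dihedralVec z p j - Q (dihedralVec z p j) (dihedralVec z p i) • dihedralVec z p i =
      -dihedralVec z p (2 * i - j) := by
    rcases hij with rfl | rfl
    · rw [hQ, (dihedralVec_pairing hQ h1 h2 h3 i).1]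
      have e := dihedralVec_add_two z p (i - 1)
      have e1 : i - 1 + 2 = i + 1 := by ring
      have e2 : i - 1 + 1 = i := by ring
      have e3 : 2 * i - (i + 1) = i - 1 := by ring
      rw [e1, e2] at e
      rw [e, e3]; abel
    · rw [(dihedralVec_pairing hQ h1 h2 h3 j).1]
      have e := dihedralVec_add_two z p j
      have e3 : 2 * (j + 1) - j = j + 2 := by ring
      rw [e3, e]; abel
  have key' := congrArg Neg.neg key
  rw [neg_neg] at key'
  rcases Int.units_eq_one_or b with rfl | rfl <;> rcases Int.units_eq_one_or c with rfl | rfl <;>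
    simp only [one_smul, neg_neg, Units.neg_smul, map_neg, LinearMap.neg_apply, neg_smul,
      smul_neg, ← key'] <;> abel

/-- Every reached seed consists of `±v_k`, two adjacent members of the dihedral sequence up to sign,
and `±B`; one mutation changes an index by at most 2, but adjacency keeps both indices within `m +
1` after `m` steps. -/
theorem IsSeed.hasPolynomialGrowth_of_isolated {Q : LinearMap.BilinForm ℝ V}
    (hQ : ∀ x y, Q x y = Q y x) {s : Seed V} (hs : IsSeed Q s) {k : Fin 3}
    (h1 : s.mat k (k + 1) = 0) (h2 : s.mat k (k + 2) = 0) (pos : Set V)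
    (x : exchangeVertices Q pos s) : HasPolynomialGrowth (exchangeGraph Q pos s) x := by
  have n01 : k + 1 ≠ k := by clear * -; revert k; decide
  have n02 : k + 2 ≠ k := by clear * -; revert k; decide
  have n12 : k + 2 ≠ k + 1 := by clear * -; revert k; decide
  have h1' : s.mat (k + 1) k = 0 := by rw [skew_apply hs.skew k (k + 1), h1, neg_zero]
  have h2' : s.mat (k + 2) k = 0 := by rw [skew_apply hs.skew k (k + 2), h2, neg_zero]
  set z := Q (s.vec (k + 1)) (s.vec (k + 2)) with hz
  set P := dihedralVec z (s.vec (k + 1), s.vec (k + 2)) with hP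
  have hrefl : ∀ {i j : ℤ}, (j = i + 1 ∨ i = j + 1) → ∀ (b c : ℤˣ),
      c • P j - Q (c • P j) (b • P i) • (b • P i) = (-c) • P (2 * i - j) :=
    dihedralVec_reflect hQ (hs.realisation.self_eq_two _) (hs.realisation.self_eq_two _) hz.symm
  -- the seeds that occur
  let S : (ℤ × ℤ) × ℤˣ × ℤˣ × ℤˣ × ℤˣ → Seed V := fun p =>
    ⟨fun i => if i = k then p.2.1 • s.vec k
      else if i = k + 1 then p.2.2.1 • P p.1.1 else p.2.2.2.1 • P p.1.2,
      p.2.2.2.2 • s.mat⟩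
  have key : ∀ m t, ReachedIn Q s m t → ∃ (i j : ℤ) (a b c d : ℤˣ), |i| ≤ m + 1 ∧ |j| ≤ m + 1 ∧
      (j = i + 1 ∨ i = j + 1) ∧ t = S ((i, j), a, b, c, d) := by
    intro m t h
    induction h with
    | refl =>
      refine ⟨0, 1, 1, 1, 1, 1, by simp, by simp, by simp, ?_⟩
      ext1
      · funext i
        rcases Fin.three_cases k i with rfl | rfl | rfl
        · simp [S]
        · simp [S, n01, hP, dihedralVec_zero]
        · simp [S, n02, n12, hP, dihedralVec_one]
      · simp [S]
    | @step m t ε l _ ih =>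
      obtain ⟨i, j, a, b, c, d, hi, hj, hij, rfl⟩ := ih
      obtain ⟨d', hd'⟩ : ∃ d' : ℤˣ, mutateMatrix l (d • s.mat) = d' • s.mat := by
        have hskew : (d • s.mat).transpose = -(d • s.mat) := by
          rcases Int.units_eq_one_or d with rfl | rfl <;> simp [hs.skew]
        have e1 : (d • s.mat) k (k + 1) = 0 := by
          rcases Int.units_eq_one_or d with rfl | rfl <;> simp [h1]
        have e2 : (d • s.mat) k (k + 2) = 0 := by
          rcases Int.units_eq_one_or d with rfl | rfl <;> simp [h2]
        rcases mutateMatrix_of_isolated hskew e1 e2 l with h | h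
        · exact ⟨d, h⟩
        · exact ⟨-d, by rw [h, Units.neg_smul]⟩
      have d1 : (d • s.mat) k (k + 1) = 0 := by
        rcases Int.units_eq_one_or d with rfl | rfl <;> simp [h1]
      have d2 : (d • s.mat) k (k + 2) = 0 := by
        rcases Int.units_eq_one_or d with rfl | rfl <;> simp [h2]
      have d1' : (d • s.mat) (k + 1) k = 0 := by
        rcases Int.units_eq_one_or d with rfl | rfl <;> simp [h1']
      have d2' : (d • s.mat) (k + 2) k = 0 := by
        rcases Int.units_eq_one_or d with rfl | rfl <;> simp [h2']
      rcases Fin.three_cases k l with rfl | rfl | rfl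
      · refine ⟨i, j, -a, b, c, d', by push_cast; linarith, by push_cast; linarith, hij, ?_⟩
        ext1
        · funext q
          rcases Fin.three_cases l q with rfl | rfl | rfl
          · simp [signedMutation, S]
          · exact (signedMutation_vec_of_zero n01 d1').trans (by simp [S, n01])
          · exact (signedMutation_vec_of_zero n02 d2').trans (by simp [S, n02, n12])
        · exact hd'
      · by_cases hr : (ε = true ∧ (d • s.mat) (k + 2) (k + 1) < 0) ∨
            (ε = false ∧ 0 < (d • s.mat) (k + 2) (k + 1))
        · refine ⟨i, 2 * i - j, a, -b, -c, d', by push_cast; linarith, ?_, by omega, ?_⟩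
          · rw [abs_le] at hi ⊢; push_cast; constructor <;> omega
          ext1
          · funext q
            rcases Fin.three_cases k q with rfl | rfl | rfl
            · exact (signedMutation_vec_of_zero n01.symm d1).trans (by simp [S])
            · simp [signedMutation, S, n01]
            · have := hrefl hij b c
              simp only [signedMutation, S, n02, n12, n01, if_false, if_pos hr, if_true]
              exact this
          · exact hd'
        · refine ⟨i, j, a, -b, c, d', by push_cast; linarith, by push_cast; linarith, hij, ?_⟩
          ext1
          · funext q
            rcases Fin.three_cases k q with rfl | rfl | rfl
            · exact (signedMutation_vec_of_zero n01.symm d1).trans (by simp [S])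
            · simp [signedMutation, S, n01]
            · simp only [signedMutation, S, n02, n12, if_false, if_neg hr]
          · exact hd'
      · by_cases hr : (ε = true ∧ (d • s.mat) (k + 1) (k + 2) < 0) ∨
            (ε = false ∧ 0 < (d • s.mat) (k + 1) (k + 2))
        · refine ⟨2 * j - i, j, a, -b, -c, d', ?_, by push_cast; linarith, by omega, ?_⟩
          · rw [abs_le] at hj ⊢; push_cast; constructor <;> omega
          ext1
          · funext q
            rcases Fin.three_cases k q with rfl | rfl | rfl
            · exact (signedMutation_vec_of_zero n02.symm d2).trans (by simp [S])
            · have := hrefl hij.symm c b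
              simp only [signedMutation, S, n02, n12.symm, n12, n01, if_false, if_pos hr, if_true]
              exact this
            · simp [signedMutation, S, n02, n12]
          · exact hd'
        · refine ⟨i, j, a, b, -c, d', by push_cast; linarith, by push_cast; linarith, hij, ?_⟩
          ext1
          · funext q
            rcases Fin.three_cases k q with rfl | rfl | rfl
            · exact (signedMutation_vec_of_zero n02.symm d2).trans (by simp [S])
            · simp only [signedMutation, S, n01, n12.symm, if_false, if_neg hr, if_true]
            · simp [signedMutation, S, n02, n12]
          · exact hd'
    | stay _ ih =>
      obtain ⟨i, j, a, b, c, d, hi, hj, hij, rfl⟩ := ih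
      exact ⟨i, j, a, b, c, d, by push_cast; linarith, by push_cast; linarith, hij, rfl⟩
  -- Two indices of absolute value at most `m + 1` and four signs give `16 (2m + 3)² ≤ 144 (m + 1)²`
  -- possibilities.
  refine hasPolynomialGrowth_of_card_le hQ hs.realisation.self_eq_two 144 2 ?_ x
  intro m
  let A : Finset ((ℤ × ℤ) × ℤˣ × ℤˣ × ℤˣ × ℤˣ) :=
    (Finset.Icc (-(m + 1 : ℤ)) (m + 1) ×ˢ Finset.Icc (-(m + 1 : ℤ)) (m + 1)) ×ˢ Finset.univ
  have hsub : {t | ReachedIn Q s m t} ⊆ S '' (A : Set _) := by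
    intro t ht
    obtain ⟨i, j, a, b, c, d, hi, hj, -, rfl⟩ := key m t ht
    refine ⟨_, ?_, rfl⟩
    rw [abs_le] at hi hj
    simp only [A, Finset.mem_coe, Finset.mem_product, Finset.mem_Icc, Finset.mem_univ, and_true]
    exact ⟨hi, hj⟩
  refine ⟨(A.finite_toSet.image S).subset hsub, (Set.ncard_le_ncard hsub
    (A.finite_toSet.image S)).trans ((Set.ncard_image_le A.finite_toSet).trans ?_)⟩
  rw [Set.ncard_coe_finset]
  simp only [A, Finset.card_product, Int.card_Icc, Finset.card_univ, Fintype.card_prod,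
    Fintype.card_units_int]
  have : (m + 1 + 1 - -(m + 1 : ℤ)).toNat = 2 * m + 3 := by omega
  rw [this]
  have h9 : (2 * m + 3) * (2 * m + 3) ≤ 9 * (m + 1) ^ 2 := by nlinarith
  calc (2 * m + 3) * (2 * m + 3) * (2 * (2 * (2 * 2)))
      ≤ 9 * (m + 1) ^ 2 * (2 * (2 * (2 * 2))) := Nat.mul_le_mul_right _ h9
    _ = 144 * (m + 1) ^ 2 := by ring

/-- Exchange graphs of mutation-finite quivers other than the Markov quiver have polynomial
growth. -/
theorem IsSeed.hasPolynomialGrowth {Q : LinearMap.BilinForm ℝ V}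
    (hQ : ∀ x y, Q x y = Q y x) {s : Seed V} (hs : IsSeed Q s) (hfin : IsMutationFinite s.mat)
    (hm : s.mat ≠ markovMatrix) (hm' : s.mat ≠ -markovMatrix) (pos : Set V)
    (x : exchangeVertices Q pos s) : HasPolynomialGrowth (exchangeGraph Q pos s) x := by
  by_cases hc : IsConnectedTriple (gramTriple Q s.vec)
  · exact hs.hasPolynomialGrowth_of_connected hQ hfin hc hm hm' pos x
  · unfold IsConnectedTriple at hc
    push Not at hc
    obtain ⟨k, hk1, hk2⟩ := hc
    have hne1 : k ≠ k + 1 := by clear * -; revert k; decide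
    have hne2 : k ≠ k + 2 := by clear * -; revert k; decide
    refine hs.hasPolynomialGrowth_of_isolated hQ (k := k) ?_ ?_ pos x
    · rw [← abs_eq_zero, ← hs.realisation.abs_eq _ _ hne1, abs_eq_zero]
      simpa only [gramTriple, Fin.three_add_two_add_one, Fin.three_add_two_add_two] using hk2
    · rw [← abs_eq_zero, ← hs.realisation.abs_eq _ _ hne2, abs_eq_zero, hQ]
      simpa only [gramTriple, Fin.three_add_one_add_one, Fin.three_add_one_add_two] using hk1

end Polynomial



/-! ### Cocompact actions of abelian groups on graphs -/

section Action

variable {X A : Type*} [AddCommGroup A] {G : SimpleGraph X}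

/-- A free action of the abelian group `A` on `G` by graph endomorphisms, with finitely many
orbits. -/
structure IsFreeCocompactAction (G : SimpleGraph X) (T : A → X → X) : Prop where
  zero : ∀ x, T 0 x = x
  add : ∀ a b x, T (a + b) x = T a (T b x)
  free : ∀ a x, T a x = x → a = 0
  adj : ∀ a x y, G.Adj x y → G.Adj (T a x) (T a y)
  cocompact : ∃ R : Set X, R.Finite ∧ ∀ x, ∃ a, ∃ r ∈ R, x = T a r

variable {T : A → X → X}

namespace IsFreeCocompactAction

theorem injective (h : IsFreeCocompactAction G T) (x : X) : Function.Injective fun a => T a x := by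
  intro a b hab
  have : T (-b + a) x = x := by
    rw [h.add, show T a x = T b x from hab, ← h.add, neg_add_cancel, h.zero]
  have := h.free _ _ this
  exact (neg_add_eq_zero.mp this).symm

theorem apply_of_eq (h : IsFreeCocompactAction G T) (c : A) {a : A} {x y : X} (e : x = T a y) :
    T c x = T (c + a) y := by
  rw [h.add, ← e]

theorem dist_le (h : IsFreeCocompactAction G T) (hG : G.Connected) (a : A) (x y : X) :
    G.dist (T a x) (T a y) ≤ G.dist x y := by
  obtain ⟨w, hw⟩ := hG.exists_walk_length_eq_dist x y
  let f : G →g G := ⟨T a, fun {x y} hxy => h.adj a x y hxy⟩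
  have := SimpleGraph.dist_le (w.map f)
  rwa [SimpleGraph.Walk.length_map, hw] at this

/-- Coordinates along the orbits: adjacent vertices have coordinates with difference in a finite
set. -/
theorem exists_coordinates (h : IsFreeCocompactAction G T)
    (hfin : ∀ x, {y | G.dist x y ≤ 1}.Finite) :
    ∃ (p : X → A) (ρ : X → X) (S : Set A), S.Finite ∧ (Set.range ρ).Finite ∧
      (∀ x, x = T (p x) (ρ x)) ∧ ∀ x y, G.Adj x y → p y - p x ∈ S := by
  obtain ⟨R, hR, hcov⟩ := h.cocompact
  choose p ρ hρ hp using hcov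
  refine ⟨p, ρ, ⋃ r ∈ R, ⋃ r' ∈ R, {a | G.Adj r (T a r')}, ?_, hR.subset ?_, hp, ?_⟩
  · refine hR.biUnion fun r _ => hR.biUnion fun r' _ => ?_
    refine Set.Finite.of_finite_image ((hfin r).subset ?_) (f := fun a => T a r')
      (h.injective r').injOn
    rintro _ ⟨a, ha, rfl⟩
    exact (SimpleGraph.dist_eq_one_iff_adj.mpr ha).le
  · rintro _ ⟨x, rfl⟩; exact hρ x
  · intro x y hxy
    simp only [Set.mem_iUnion]
    refine ⟨ρ x, hρ x, ρ y, hρ y, ?_⟩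
    have e := h.adj (-p x) _ _ hxy
    have e1 : T (-p x) x = ρ x := by
      have := h.apply_of_eq (-p x) (hp x)
      rwa [neg_add_cancel, h.zero] at this
    have e2 : T (-p x) y = T (p y - p x) (ρ y) := by
      have := h.apply_of_eq (-p x) (hp y)
      rwa [neg_add_eq_sub] at this
    rwa [e1, e2] at e

/-- Along an edge the coordinate changes by an element of the finite set `S`, so by connectedness
`S` and one coordinate generate all coordinates. -/
theorem finite (h : IsFreeCocompactAction G T) (hG : G.Connected)
    (hfin : ∀ x, {y | G.dist x y ≤ 1}.Finite) : Module.Finite ℤ A := by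
  obtain ⟨p, ρ, S, hS, hρ, hp, hadj⟩ := h.exists_coordinates hfin
  obtain ⟨x₀⟩ := hG.nonempty
  -- An orbit may have several representatives, so the coordinate of `T a x₀` need not be `a` up to
  -- a constant; the finite set `S₀` contains the possible discrepancies.
  set S₀ : Set A := {b | T b x₀ ∈ Set.range ρ}
  have hS₀ : S₀.Finite := by
    refine Set.Finite.of_finite_image (hρ.subset ?_) (f := fun a => T a x₀) (h.injective x₀).injOn
    rintro _ ⟨b, hb, rfl⟩; exact hb
  set N : Submodule ℤ A := Submodule.span ℤ (S ∪ S₀ ∪ {p x₀})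
  have hN : ∀ a ∈ S ∪ S₀ ∪ {p x₀}, a ∈ N := fun a ha => Submodule.subset_span ha
  have hwalk : ∀ x y, G.Walk x y → p x ∈ N → p y ∈ N := by
    intro x y w
    induction w with
    | nil => exact id
    | cons hxy _ ih =>
      intro hx
      refine ih ?_
      have := N.add_mem (hN _ (Or.inl (Or.inl (hadj _ _ hxy)))) hx
      rwa [sub_add_cancel] at this
  have hpN : ∀ x, p x ∈ N := fun x =>
    hwalk x₀ x (hG.preconnected x₀ x).some (hN _ (Or.inr rfl))
  have htop : N = ⊤ := by
    refine Submodule.eq_top_iff'.mpr fun a => ?_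
    have : -p (T a x₀) + a ∈ S₀ := by
      refine ⟨T a x₀, ?_⟩
      have := h.apply_of_eq (-p (T a x₀)) (hp (T a x₀))
      rw [neg_add_cancel, h.zero] at this
      rw [h.add, this]
    have := N.add_mem (hpN (T a x₀)) (hN _ (Or.inl (Or.inr this)))
    rwa [add_neg_cancel_left] at this
  exact ⟨⟨((hS.union hS₀).union (Set.finite_singleton _)).toFinset, by
    rw [Set.Finite.coe_toFinset]; exact htop⟩⟩

variable [Module.Free ℤ A]

/-- Within `m` steps each of the integer coordinates changes by at most `K m`; this leaves at most
`(2 K m + 1)^d` group elements for each of finitely many representatives. -/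
theorem hasGrowthAtMost (h : IsFreeCocompactAction G T) (hG : G.Connected)
    (hfin : ∀ x, {y | G.dist x y ≤ 1}.Finite) (x : X) :
    HasGrowthAtMost G x (Module.finrank ℤ A) := by
  have := h.finite hG hfin
  obtain ⟨p, ρ, S, hS, hρ, hp, hadj⟩ := h.exists_coordinates hfin
  set b := Module.finBasis ℤ A
  obtain ⟨K, hK⟩ : ∃ K : ℕ, ∀ a ∈ S, ∀ i, (b.repr a i).natAbs ≤ K := by
    obtain ⟨K, hK⟩ := (hS.image fun a => ∑ i, (b.repr a i).natAbs).bddAbove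
    refine ⟨K, fun a ha i => le_trans ?_ (hK ⟨a, ha, rfl⟩)⟩
    exact Finset.single_le_sum (f := fun i => (b.repr a i).natAbs) (fun _ _ => Nat.zero_le _)
      (Finset.mem_univ i)
  have hwalk : ∀ x y, ∀ w : G.Walk x y, ∀ i, (b.repr (p y - p x) i).natAbs ≤ K * w.length := by
    intro x y w i
    induction w with
    | nil => simp
    | @cons u v z huv w ih =>
      have e : p z - p u = (p z - p v) + (p v - p u) := by abel
      rw [e, map_add, Finsupp.add_apply, SimpleGraph.Walk.length_cons, mul_add, mul_one]
      exact (Int.natAbs_add_le _ _).trans (add_le_add ih (hK _ (hadj _ _ huv) i))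
  have hcard : ∀ m : ℕ, growth G x m ≤
      (Set.range ρ).ncard * (2 * (K * m) + 1) ^ Module.finrank ℤ A := by
    intro m
    have hR := hρ.fintype
    let f : Set.range ρ × (Fin (Module.finrank ℤ A) → Fin (2 * (K * m) + 1)) → X := fun q =>
      T (p x + ∑ i, ((q.2 i : ℤ) - K * m) • b i) q.1
    have hsub : {y | G.dist x y ≤ m} ⊆ f '' Set.univ := by
      intro y hy
      obtain ⟨w, hw⟩ := hG.exists_walk_length_eq_dist x y
      have hb : ∀ i, |b.repr (p y - p x) i| ≤ (K * m : ℕ) := by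
        intro i
        rw [Int.abs_eq_natAbs]
        exact_mod_cast (hwalk x y w i).trans (Nat.mul_le_mul_left _ (hw.trans_le hy))
      have hnn : ∀ i, 0 ≤ b.repr (p y - p x) i + (K * m : ℕ) := fun i => by
        have := abs_le.mp (hb i); omega
      refine ⟨(⟨ρ y, y, rfl⟩, fun i => ⟨(b.repr (p y - p x) i + (K * m : ℕ)).toNat, ?_⟩),
        trivial, ?_⟩
      · have := abs_le.mp (hb i); have := hnn i; omega
      · have : ∀ i, (((b.repr (p y - p x) i + (K * m : ℕ)).toNat : ℕ) : ℤ) - K * m =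
            b.repr (p y - p x) i := by
          intro i
          rw [Int.toNat_of_nonneg (hnn i)]; push_cast; ring
        simp only [f, this]
        rw [b.sum_repr, add_sub_cancel]
        exact (hp y).symm
    refine (Set.ncard_le_ncard hsub (Set.finite_univ.image f)).trans ?_
    refine (Set.ncard_image_le Set.finite_univ).trans ?_
    rw [Set.ncard_univ, Nat.card_prod, Nat.card_fun, Nat.card_fin, Nat.card_fin,
      Nat.card_coe_set_eq]
  refine IsBigO.of_bound ((Set.range ρ).ncard * (2 * K + 1) ^ Module.finrank ℤ A : ℝ) ?_
  filter_upwards [eventually_ge_atTop 1] with m hm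
  rw [Real.norm_of_nonneg (Nat.cast_nonneg _), Real.norm_of_nonneg (by positivity), mul_assoc,
    ← mul_pow]
  have h1 : ((growth G x m : ℕ) : ℝ) ≤
      (((Set.range ρ).ncard * (2 * (K * m) + 1) ^ Module.finrank ℤ A : ℕ) : ℝ) := by
    exact_mod_cast hcard m
  refine h1.trans ?_
  push_cast
  have hm' : (1 : ℝ) ≤ m := by exact_mod_cast hm
  gcongr
  nlinarith

/-- The translates of `x` by `∑ n_i b_i` with `0 ≤ n_i < m` are `m^d` distinct vertices whose
distance from `x` is linear in `m`. -/
theorem le_of_hasGrowthAtMost (h : IsFreeCocompactAction G T) (hG : G.Connected)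
    (hfin : ∀ x m, {y | G.dist x y ≤ m}.Finite) (x : X) {r : ℕ} (hr : HasGrowthAtMost G x r) :
    Module.finrank ℤ A ≤ r := by
  have := h.finite hG fun x => hfin x 1
  set d := Module.finrank ℤ A
  set b : Module.Basis (Fin d) ℤ A := Module.finBasis ℤ A
  set D := ∑ i, G.dist x (T (b i) x)
  have hD : ∀ i, G.dist x (T (b i) x) ≤ D := fun i =>
    Finset.single_le_sum (f := fun i => G.dist x (T (b i) x)) (fun _ _ => Nat.zero_le _)
      (Finset.mem_univ i)
  have hadd : ∀ a c, G.dist x (T (a + c) x) ≤ G.dist x (T a x) + G.dist x (T c x) := by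
    intro a c
    refine (hG.dist_triangle (v := T a x)).trans (Nat.add_le_add_left ?_ _)
    rw [h.add]; exact h.dist_le hG a _ _
  have hzero : G.dist x (T 0 x) = 0 := by rw [h.zero, SimpleGraph.dist_self]
  have hnsmul : ∀ (n : ℕ) a, G.dist x (T (n • a) x) ≤ n * G.dist x (T a x) := by
    intro n a
    induction n with
    | zero => rw [zero_smul, hzero, zero_mul]
    | succ n ih =>
      rw [add_smul, one_smul, add_mul, one_mul]
      exact (hadd _ _).trans (Nat.add_le_add_right ih _)
  have hsum : ∀ (I : Finset (Fin d)) (n : Fin d → ℕ),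
      G.dist x (T (∑ i ∈ I, n i • b i) x) ≤ ∑ i ∈ I, n i * D := by
    intro I n
    induction I using Finset.cons_induction with
    | empty => rw [Finset.sum_empty, hzero, Finset.sum_empty]
    | cons i I hi ih =>
      rw [Finset.sum_cons, Finset.sum_cons]
      exact (hadd _ _).trans (add_le_add ((hnsmul _ _).trans (Nat.mul_le_mul_left _ (hD i))) ih)
  -- The distance is at most `d D m`; the extra `1` keeps the factor positive, so that the radius
  -- tends to infinity even if `d D = 0`.
  have hlow : ∀ m : ℕ, m ^ d ≤ growth G x ((d * D + 1) * m) := by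
    intro m
    let f : (Fin d → Fin m) → X := fun n => T (∑ i, (n i : ℕ) • b i) x
    have hf : Function.Injective f := by
      intro n n' hnn
      have e := h.injective x hnn
      funext i
      have e' := congrArg (fun a => b.repr a i) e
      simp only [map_sum, map_nsmul, b.repr_self, Finsupp.finsetSum_apply, Finsupp.smul_apply,
        Finsupp.single_apply, smul_ite, smul_zero, Finset.sum_ite_eq', Finset.mem_univ, if_true,
        nsmul_eq_mul, mul_one] at e'
      exact Fin.ext (by exact_mod_cast e')
    have hsub : Set.range f ⊆ {y | G.dist x y ≤ (d * D + 1) * m} := by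
      rintro _ ⟨n, rfl⟩
      refine (hsum _ _).trans ((Finset.sum_le_card_nsmul _ _ (m * D) fun i _ =>
        Nat.mul_le_mul_right _ (n i).2.le).trans ?_)
      rw [Finset.card_univ, Fintype.card_fin, smul_eq_mul]
      nlinarith
    have := Set.ncard_le_ncard hsub (hfin _ _)
    rwa [← Set.image_univ, Set.ncard_image_of_injective _ hf, Set.ncard_univ, Nat.card_fun,
      Nat.card_fin, Nat.card_fin] at this
  by_contra! hlt
  have htend : Tendsto (fun m : ℕ => (d * D + 1) * m) atTop atTop :=
    tendsto_id.const_mul_atTop' (Nat.succ_pos _)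
  have h1 : (fun m : ℕ => (m : ℝ) ^ d) =O[atTop] fun m : ℕ => (m : ℝ) ^ r := by
    have h2 := hr.comp_tendsto htend
    have h3 : (fun m : ℕ => (m : ℝ) ^ d) =O[atTop]
        fun m : ℕ => (growth G x ((d * D + 1) * m) : ℝ) := by
      refine IsBigO.of_bound 1 (Eventually.of_forall fun m => ?_)
      rw [one_mul, Real.norm_of_nonneg (by positivity), Real.norm_of_nonneg (Nat.cast_nonneg _)]
      exact_mod_cast hlow m
    refine h3.trans (h2.trans ?_)
    refine IsBigO.of_bound ((d * D + 1 : ℝ) ^ r) (Eventually.of_forall fun m => ?_)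
    simp only [Function.comp]
    push_cast
    rw [mul_pow, norm_mul, Real.norm_of_nonneg (by positivity)]
  have h4 : (fun m : ℕ => (m : ℝ) ^ r) =o[atTop] fun m : ℕ => (m : ℝ) ^ d :=
    (isLittleO_pow_pow_atTop_of_lt (𝕜 := ℝ) hlt).comp_tendsto tendsto_natCast_atTop_atTop
  have h5 := h1.trans_isLittleO h4
  refine (isLittleO_irrefl ?_) h5
  refine (Eventually.frequently ?_)
  filter_upwards [eventually_ge_atTop 1] with m hm
  positivity

/-- An abelian group acting freely and cocompactly on a locally finite connected graph has rank equal
to the growth rate. -/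
theorem isGrowthRate (h : IsFreeCocompactAction G T) (hG : G.Connected)
    (hfin : ∀ x m, {y | G.dist x y ≤ m}.Finite) (x : X) :
    IsGrowthRate G x (Module.finrank ℤ A) :=
  ⟨hfin x, h.hasGrowthAtMost hG (fun x => hfin x 1) x,
    fun _ hr => h.le_of_hasGrowthAtMost hG hfin x hr⟩

end IsFreeCocompactAction

end Action



/-! ### Seeds with a belt -/

set_option linter.unusedSimpArgs false

/-- A degenerate quadratic space with a radical vector `δ`, a skew form `ω` and a linear form `ν`
which together determine the positive vectors. -/
structure BeltData (V : Type*) [AddCommGroup V] [Module ℝ V] where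
  Q : LinearMap.BilinForm ℝ V
  ω : LinearMap.BilinForm ℝ V
  δ : V
  ν : V →ₗ[ℝ] ℝ
  symm : ∀ x y, Q x y = Q y x
  skew : ∀ x y, ω x y = -ω y x
  radical : ∀ x, Q δ x = 0
  ν_δ : ν δ = 1

namespace BeltData

variable {V : Type*} [AddCommGroup V] [Module ℝ V] (D : BeltData V)

/-- The pairing with the direction of the belt line. -/
def slope (f : V) : ℝ := D.ω D.δ f

/-- In the plane, `slope` is a positive multiple of minus the derivative along the belt line and `ν`
is the value at a point of that line, which breaks ties. -/
def pos : Set V := {f | 0 < D.slope f ∨ (D.slope f = 0 ∧ D.ν f < 0)}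

theorem ω_self (x : V) : D.ω x x = 0 := by
  have := D.skew x x; linarith

/-- Three vectors realising an acyclic quiver `x → y → z`, `x → z`. -/
structure AcyclicTriple (x y z : V) (p q r a b c : ℝ) : Prop where
  xx : D.Q x x = 2
  yy : D.Q y y = 2
  zz : D.Q z z = 2
  xy : D.Q x y = -p
  yz : D.Q y z = -q
  xz : D.Q x z = -r
  ω_xy : D.ω x y = p
  ω_yz : D.ω y z = q
  ω_xz : D.ω x z = r
  p_nonneg : 0 ≤ p
  q_nonneg : 0 ≤ q
  r_nonneg : 0 ≤ r
  a_pos : 0 < a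
  b_pos : 0 < b
  c_pos : 0 < c
  relation : a • x + b • y + c • z = -D.δ
  -- The vector `q x - r y + p z` pairs to zero under `ω` with `x`, `y` and `z`. As `ω` never
  -- changes, mutations preserve this vector up to sign, and the condition survives.
  ν_eq : q * D.ν x - r * D.ν y + p * D.ν z = 0

/-- Three vectors realising a cyclic quiver `x → y → z → x`, the domain being not between the lines
of `x` and `y`. -/
structure CyclicTriple (x y z : V) (r p q a b c : ℝ) : Prop where
  xx : D.Q x x = 2
  yy : D.Q y y = 2
  zz : D.Q z z = 2
  xy : D.Q x y = r
  yz : D.Q y z = -p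
  xz : D.Q x z = -q
  ω_xy : D.ω x y = r
  ω_yz : D.ω y z = p
  ω_xz : D.ω x z = -q
  r_pos : 0 < r
  p_pos : 0 < p
  q_pos : 0 < q
  a_nonneg : 0 ≤ a
  b_pos : 0 < b
  relation : a • x + b • y + c • z = -D.δ
  ν_eq : p * D.ν x + q * D.ν y + r * D.ν z = 0

variable {D} {x y z : V} {p q r a b c : ℝ}

theorem pairing_relation {f : V} (h : a • x + b • y + c • z = -D.δ) :
    a * D.Q x f + b * D.Q y f + c * D.Q z f = 0 := by
  have := congrArg (fun g => D.Q g f) h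
  simpa [D.radical] using this

theorem slope_relation {f : V} (h : a • x + b • y + c • z = -D.δ) :
    a * D.ω x f + b * D.ω y f + c * D.ω z f = -D.slope f := by
  have := congrArg (fun g => D.ω g f) h
  simpa [slope] using this

theorem ν_relation (h : a • x + b • y + c • z = -D.δ) :
    a * D.ν x + b * D.ν y + c * D.ν z = -1 := by
  have := congrArg D.ν h
  simpa [D.ν_δ] using this

namespace AcyclicTriple

variable (h : D.AcyclicTriple x y z p q r a b c)
include h

theorem yx : D.Q y x = -p := by rw [D.symm, h.xy]
theorem zx : D.Q z x = -r := by rw [D.symm, h.xz]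
theorem zy : D.Q z y = -q := by rw [D.symm, h.yz]
theorem ω_yx : D.ω y x = -p := by rw [D.skew, h.ω_xy]
theorem ω_zx : D.ω z x = -r := by rw [D.skew, h.ω_xz]
theorem ω_zy : D.ω z y = -q := by rw [D.skew, h.ω_yz]

theorem eq_a : 2 * a = p * b + r * c := by
  have := pairing_relation (f := x) h.relation
  rw [h.xx, h.yx, h.zx] at this; linarith

theorem eq_b : 2 * b = p * a + q * c := by
  have := pairing_relation (f := y) h.relation
  rw [h.yy, D.symm z, h.xy, h.yz] at this; linarith

theorem eq_c : 2 * c = r * a + q * b := by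
  have := pairing_relation (f := z) h.relation
  rw [h.zz, h.yz, h.xz] at this; linarith

/-- Pairing the relation by `ω` yields `p b + r c`, which pairing by `Q` identifies with `2a`. Hence
a source is always positive, and likewise a sink never is. -/
theorem slope_x : D.slope x = 2 * a := by
  have := slope_relation (f := x) h.relation
  rw [D.ω_self, D.skew y, D.skew z, h.ω_xy, h.ω_xz] at this; linarith [h.eq_a]

theorem slope_y : D.slope y = q * c - p * a := by
  have := slope_relation (f := y) h.relation
  rw [D.ω_self, D.skew z, h.ω_xy, h.ω_yz] at this; linarith

theorem slope_z : D.slope z = -(2 * c) := by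
  have := slope_relation (f := z) h.relation
  rw [D.ω_self, h.ω_xz, h.ω_yz] at this; linarith [h.eq_c]

theorem x_mem_pos : x ∈ D.pos := Or.inl (by rw [h.slope_x]; linarith [h.a_pos])

theorem z_notMem_pos : z ∉ D.pos := by
  have := h.slope_z
  have := h.c_pos
  rintro (h' | ⟨h', -⟩) <;> linarith

/-- The tie is broken in favour of the middle vector. -/
theorem ν_y (hq : 0 < q) (h0 : D.slope y = 0) : D.ν y < 0 := by
  have h1 := h.slope_y
  have h2 := ν_relation h.relation
  have h3 := h.ν_eq
  have h4 := h.eq_c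
  have h5 := h.c_pos
  have key : 2 * c * D.ν y = -q := by
    rw [h0] at h1
    linear_combination q * h2 - a * h3 + D.ν y * h4 + D.ν z * h1
  nlinarith

theorem mem_pos_y_iff (hq : 0 < q) : y ∈ D.pos ↔ p * a ≤ q * c := by
  have h1 := h.slope_y
  constructor
  · rintro (h' | ⟨h', -⟩) <;> linarith
  · intro hle
    rcases hle.lt_or_eq with h' | h'
    · exact Or.inl (by linarith)
    · exact Or.inr ⟨by linarith, h.ν_y hq (by linarith)⟩

/-- The source is positive, so both other vectors are reflected in it: the whole triple is mirrored,
and the source becomes a sink. -/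
theorem source : D.AcyclicTriple (y + p • x) (z + r • x) (-x) q r p b c a := by
  refine ⟨?_, ?_, ?_, ?_, ?_, ?_, ?_, ?_, ?_, h.q_nonneg, h.r_nonneg, h.p_nonneg,
    h.b_pos, h.c_pos, h.a_pos, ?_, ?_⟩
  case refine_10 =>
    rw [← h.relation]
    match_scalars <;> linarith [h.eq_a]
  case refine_11 =>
    have := h.ν_eq
    simp only [map_add, map_neg, map_smul, smul_eq_mul]
    linear_combination -this
  all_goals
    simp only [map_add, map_neg, map_smul, LinearMap.add_apply, LinearMap.neg_apply,
      LinearMap.smul_apply, smul_eq_mul, h.xx, h.yy, h.zz, h.xy, h.yz, h.xz, h.yx, h.zx, h.zy,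
      h.ω_xy, h.ω_yz, h.ω_xz, h.ω_yx, h.ω_zx, h.ω_zy, D.ω_self]
    try ring

theorem sink : D.AcyclicTriple (-z) (x + r • z) (y + q • z) r p q c a b := by
  refine ⟨?_, ?_, ?_, ?_, ?_, ?_, ?_, ?_, ?_, h.r_nonneg, h.p_nonneg, h.q_nonneg,
    h.c_pos, h.a_pos, h.b_pos, ?_, ?_⟩
  case refine_10 =>
    rw [← h.relation]
    match_scalars <;> linarith [h.eq_c]
  case refine_11 =>
    have := h.ν_eq
    simp only [map_add, map_neg, map_smul, smul_eq_mul]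
    linear_combination -this
  all_goals
    simp only [map_add, map_neg, map_smul, LinearMap.add_apply, LinearMap.neg_apply,
      LinearMap.smul_apply, smul_eq_mul, h.xx, h.yy, h.zz, h.xy, h.yz, h.xz, h.yx, h.zx, h.zy,
      h.ω_xy, h.ω_yz, h.ω_xz, h.ω_yx, h.ω_zx, h.ω_zy, D.ω_self]
    try ring

/-- The new coefficient `q c - b` equals `slope y / 2`, so the sign that decides positivity of `y`
is also the one that makes this normal form valid. -/
theorem middle_pos (hp : 0 < p) (hq : 0 < q) (hle : p * a ≤ q * c): 
    D.CyclicTriple (-y) x (z + q • y) p (r + p * q) q (q * c - b) a c := by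
  refine ⟨?_, ?_, ?_, ?_, ?_, ?_, ?_, ?_, ?_, hp,
    by have := h.r_nonneg; positivity, hq, by linarith [h.eq_b], h.a_pos, ?_, ?_⟩
  case refine_10 =>
    rw [← h.relation]
    match_scalars <;> linarith [h.eq_b]
  case refine_11 =>
    have := h.ν_eq
    simp only [map_add, map_neg, map_smul, smul_eq_mul]
    linear_combination this
  all_goals
    simp only [map_add, map_neg, map_smul, LinearMap.add_apply, LinearMap.neg_apply,
      LinearMap.smul_apply, smul_eq_mul, h.xx, h.yy, h.zz, h.xy, h.yz, h.xz, h.yx, h.zx, h.zy,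
      h.ω_xy, h.ω_yz, h.ω_xz, h.ω_yx, h.ω_zx, h.ω_zy, D.ω_self]
    try ring

theorem middle_neg (hp : 0 < p) (hq : 0 < q) (hlt : q * c < p * a): 
    D.CyclicTriple z (-y) (x + p • y) q p (r + p * q) c (p * a - b) a := by
  refine ⟨?_, ?_, ?_, ?_, ?_, ?_, ?_, ?_, ?_, hq, hp,
    by have := h.r_nonneg; positivity, h.c_pos.le, by linarith [h.eq_b], ?_, ?_⟩
  case refine_10 =>
    rw [← h.relation]
    match_scalars <;> linarith [h.eq_b]
  case refine_11 =>
    have := h.ν_eq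
    simp only [map_add, map_neg, map_smul, smul_eq_mul]
    linear_combination this
  all_goals
    simp only [map_add, map_neg, map_smul, LinearMap.add_apply, LinearMap.neg_apply,
      LinearMap.smul_apply, smul_eq_mul, h.xx, h.yy, h.zz, h.xy, h.yz, h.xz, h.yx, h.zx, h.zy,
      h.ω_xy, h.ω_yz, h.ω_xz, h.ω_yx, h.ω_zx, h.ω_zy, D.ω_self]
    try ring

/-- Without an arrow between them the order of `x` and `y` is immaterial; a middle vertex not joined
to `x` may therefore be treated as a source. -/
theorem swap_xy (hp : p = 0) : D.AcyclicTriple y x z 0 r q b a c := by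
  subst hp
  refine ⟨h.yy, h.xx, h.zz, by rw [h.yx], h.xz, h.yz, by rw [h.ω_yx, neg_zero], h.ω_xz, h.ω_yz, le_rfl,
    h.r_nonneg, h.q_nonneg, h.b_pos, h.a_pos, h.c_pos, ?_, ?_⟩
  · rw [← h.relation, add_comm (b • y)]
  · linarith [h.ν_eq]

theorem swap_yz (hq : q = 0) : D.AcyclicTriple x z y r 0 p a c b := by
  subst hq
  refine ⟨h.xx, h.zz, h.yy, h.xz, by rw [h.zy], h.xy, h.ω_xz, by rw [h.ω_zy, neg_zero], h.ω_xy,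
    h.r_nonneg, le_rfl, h.p_nonneg, h.a_pos, h.c_pos, h.b_pos, ?_, ?_⟩
  · rw [← h.relation, add_right_comm]
  · linarith [h.ν_eq]

theorem pos_or_pos : 0 < p ∨ 0 < q := by
  by_contra! hcon
  have h1 := h.eq_b
  have := h.p_nonneg
  have := h.q_nonneg
  rw [le_antisymm hcon.1 h.p_nonneg, le_antisymm hcon.2 h.q_nonneg] at h1
  linarith [h.b_pos]

end AcyclicTriple

namespace CyclicTriple

variable (h : D.CyclicTriple x y z r p q a b c)
include h

theorem yx : D.Q y x = r := by rw [D.symm, h.xy]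
theorem zx : D.Q z x = -q := by rw [D.symm, h.xz]
theorem zy : D.Q z y = -p := by rw [D.symm, h.yz]
theorem ω_yx : D.ω y x = -r := by rw [D.skew, h.ω_xy]
theorem ω_zx : D.ω z x = q := by rw [D.skew, h.ω_xz, neg_neg]
theorem ω_zy : D.ω z y = -p := by rw [D.skew, h.ω_yz]

theorem eq_a : 2 * a + r * b = q * c := by
  have := pairing_relation (f := x) h.relation
  rw [h.xx, h.yx, h.zx] at this; linarith

theorem eq_b : r * a + 2 * b = p * c := by
  have := pairing_relation (f := y) h.relation
  rw [h.yy, h.xy, h.zy] at this; linarith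

theorem eq_c : 2 * c = q * a + p * b := by
  have := pairing_relation (f := z) h.relation
  rw [h.zz, h.yz, h.xz] at this; linarith

theorem c_pos : 0 < c := by
  have := h.eq_c
  have := mul_nonneg h.q_pos.le h.a_nonneg
  have := mul_pos h.p_pos h.b_pos
  linarith

theorem slope_x : D.slope x = -(2 * a) := by
  have := slope_relation (f := x) h.relation
  rw [D.ω_self, h.ω_yx, h.ω_zx] at this; linarith [h.eq_a]

theorem slope_y : D.slope y = 2 * b := by
  have := slope_relation (f := y) h.relation
  rw [D.ω_self, h.ω_xy, h.ω_zy] at this; linarith [h.eq_b]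

theorem slope_z : D.slope z = q * a - p * b := by
  have := slope_relation (f := z) h.relation
  rw [D.ω_self, h.ω_xz, h.ω_yz] at this; linarith

theorem y_mem_pos : y ∈ D.pos := Or.inl (by rw [h.slope_y]; linarith [h.b_pos])

theorem ν_x (h0 : a = 0) : 0 < D.ν x := by
  have h2 := ν_relation h.relation
  have h3 := h.ν_eq
  have h4 := h.eq_a
  subst h0
  have key : c * p * D.ν x = r := by
    linear_combination c * h3 - r * h2 + D.ν y * h4
  have := mul_pos h.c_pos h.p_pos
  by_contra! hneg
  nlinarith [h.r_pos]

theorem x_notMem_pos : x ∉ D.pos := by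
  have h1 := h.slope_x
  have h2 := h.a_nonneg
  rintro (h' | ⟨h', h''⟩)
  · linarith
  · linarith [h.ν_x (by linarith)]

theorem ν_z (h0 : D.slope z = 0) : D.ν z < 0 := by
  have h1 := h.slope_z
  have h2 := ν_relation h.relation
  have h3 := h.ν_eq
  have h4 := h.eq_b
  have h5 := h.b_pos
  rw [h0] at h1
  have key : 2 * b * D.ν z = -p := by
    linear_combination p * h2 - a * h3 + D.ν z * h4 - D.ν y * h1
  have := h.p_pos
  nlinarith

theorem mem_pos_z_iff : z ∈ D.pos ↔ p * b ≤ q * a := by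
  have h1 := h.slope_z
  constructor
  · rintro (h' | ⟨h', -⟩) <;> linarith
  · intro hle
    rcases hle.lt_or_eq with h' | h'
    · exact Or.inl (by linarith)
    · exact Or.inr ⟨by linarith, h.ν_z (by linarith)⟩

/-- The weight opposite to `x` becomes `q r - p`, whose sign separates this case from
`mutate_x_acyclic`. -/
theorem mutate_x (hlt : p < q * r): 
    D.CyclicTriple (z + q • x) y (-x) (q * r - p) r q c b (q * c - a) := by
  refine ⟨?_, ?_, ?_, ?_, ?_, ?_, ?_, ?_, ?_, by linarith, h.r_pos, h.q_pos,
    h.c_pos.le, h.b_pos, ?_, ?_⟩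
  case refine_10 =>
    rw [← h.relation]
    match_scalars <;> linarith [h.eq_a]
  case refine_11 =>
    have := h.ν_eq
    simp only [map_add, map_neg, map_smul, smul_eq_mul]
    linear_combination this
  all_goals
    simp only [map_add, map_neg, map_smul, LinearMap.add_apply, LinearMap.neg_apply,
      LinearMap.smul_apply, smul_eq_mul, h.xx, h.yy, h.zz, h.xy, h.yz, h.xz, h.yx, h.zx, h.zy,
      h.ω_xy, h.ω_yz, h.ω_xz, h.ω_yx, h.ω_zx, h.ω_zy, D.ω_self]
    try ring

theorem mutate_x_acyclic (hle : q * r ≤ p): 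
    D.AcyclicTriple y (-x) (z + q • x) r q (p - q * r) b (q * c - a) c := by
  refine ⟨?_, ?_, ?_, ?_, ?_, ?_, ?_, ?_, ?_, h.r_pos.le, h.q_pos.le,
    by linarith, h.b_pos, by linarith [h.eq_a, h.a_nonneg, mul_pos h.r_pos h.b_pos], h.c_pos, ?_, ?_⟩
  case refine_10 =>
    rw [← h.relation]
    match_scalars <;> linarith [h.eq_a]
  case refine_11 =>
    have := h.ν_eq
    simp only [map_add, map_neg, map_smul, smul_eq_mul]
    linear_combination this
  all_goals
    simp only [map_add, map_neg, map_smul, LinearMap.add_apply, LinearMap.neg_apply,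
      LinearMap.smul_apply, smul_eq_mul, h.xx, h.yy, h.zz, h.xy, h.yz, h.xz, h.yx, h.zx, h.zy,
      h.ω_xy, h.ω_yz, h.ω_xz, h.ω_yx, h.ω_zx, h.ω_zy, D.ω_self]
    try ring

theorem mutate_y (hlt : q < p * r): 
    D.CyclicTriple x (z + p • y) (-y) (p * r - q) p r a c (p * c - b) := by
  refine ⟨?_, ?_, ?_, ?_, ?_, ?_, ?_, ?_, ?_, by linarith, h.p_pos, h.r_pos,
    h.a_nonneg, h.c_pos, ?_, ?_⟩
  case refine_10 =>
    rw [← h.relation]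
    match_scalars <;> linarith [h.eq_b]
  case refine_11 =>
    have := h.ν_eq
    simp only [map_add, map_neg, map_smul, smul_eq_mul]
    linear_combination this
  all_goals
    simp only [map_add, map_neg, map_smul, LinearMap.add_apply, LinearMap.neg_apply,
      LinearMap.smul_apply, smul_eq_mul, h.xx, h.yy, h.zz, h.xy, h.yz, h.xz, h.yx, h.zx, h.zy,
      h.ω_xy, h.ω_yz, h.ω_xz, h.ω_yx, h.ω_zx, h.ω_zy, D.ω_self]
    try ring

theorem a_pos_of_le (hle : p * r ≤ q) : 0 < a := by
  have h1 := h.eq_a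
  have h2 := mul_le_mul_of_nonneg_right hle h.c_pos.le
  have h3 := congrArg (fun t => r * t) h.eq_b
  have h4 := mul_pos h.r_pos h.b_pos
  have h5 := mul_nonneg (mul_nonneg h.r_pos.le h.r_pos.le) h.a_nonneg
  beta_reduce at h3
  linarith

theorem mutate_y_acyclic (hle : p * r ≤ q): 
    D.AcyclicTriple (z + p • y) (-y) x p r (q - p * r) c (p * c - b) a := by
  refine ⟨?_, ?_, ?_, ?_, ?_, ?_, ?_, ?_, ?_, h.p_pos.le, h.r_pos.le,
    by linarith, h.c_pos, by linarith [h.eq_b, mul_nonneg h.r_pos.le h.a_nonneg, h.b_pos],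
    h.a_pos_of_le hle, ?_, ?_⟩
  case refine_10 =>
    rw [← h.relation]
    match_scalars <;> linarith [h.eq_b]
  case refine_11 =>
    have := h.ν_eq
    simp only [map_add, map_neg, map_smul, smul_eq_mul]
    linear_combination this
  all_goals
    simp only [map_add, map_neg, map_smul, LinearMap.add_apply, LinearMap.neg_apply,
      LinearMap.smul_apply, smul_eq_mul, h.xx, h.yy, h.zz, h.xy, h.yz, h.xz, h.yx, h.zx, h.zy,
      h.ω_xy, h.ω_yz, h.ω_xz, h.ω_yx, h.ω_zx, h.ω_zy, D.ω_self]
    try ring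

/-- If `q p ≤ r`, then `2 r a + 4 b = 2 p c = p q a + p² b ≤ 2 p q a ≤ 2 r a`, against `b > 0`. So
mutation at `z` never leads to an acyclic triple. -/
theorem lt_mul_of_le (hle : p * b ≤ q * a) : r < q * p := by
  by_contra! hcon
  have h1 := h.eq_b
  have h2 := congrArg (fun t => p * t) h.eq_c
  have h3 := mul_le_mul_of_nonneg_right hcon h.a_nonneg
  have h4 := mul_le_mul_of_nonneg_left hle h.p_pos.le
  beta_reduce at h2
  linarith [h.b_pos]

theorem lt_mul_of_lt (hlt : q * a < p * b) : r < q * p := by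
  by_contra! hcon
  have h1 := h.eq_a
  have h2 := congrArg (fun t => q * t) h.eq_c
  have h3 := mul_le_mul_of_nonneg_right hcon h.b_pos.le
  have h4 := mul_lt_mul_of_pos_left hlt h.q_pos
  beta_reduce at h2
  linarith [h.a_nonneg]

theorem mutate_z_pos (hle : p * b ≤ q * a): 
    D.CyclicTriple (-z) y (x + q • z) p (q * p - r) q (q * a - c) b a := by
  refine ⟨?_, ?_, ?_, ?_, ?_, ?_, ?_, ?_, ?_, h.p_pos,
    by linarith [h.lt_mul_of_le hle], h.q_pos, by linarith [h.eq_c], h.b_pos, ?_, ?_⟩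
  case refine_10 =>
    rw [← h.relation]
    match_scalars <;> linarith [h.eq_c]
  case refine_11 =>
    have := h.ν_eq
    simp only [map_add, map_neg, map_smul, smul_eq_mul]
    linear_combination this
  all_goals
    simp only [map_add, map_neg, map_smul, LinearMap.add_apply, LinearMap.neg_apply,
      LinearMap.smul_apply, smul_eq_mul, h.xx, h.yy, h.zz, h.xy, h.yz, h.xz, h.yx, h.zx, h.zy,
      h.ω_xy, h.ω_yz, h.ω_xz, h.ω_yx, h.ω_zx, h.ω_zy, D.ω_self]
    try ring

theorem mutate_z_neg (hlt : q * a < p * b): 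
    D.CyclicTriple x (-z) (y + p • z) q p (q * p - r) a (p * b - c) b := by
  refine ⟨?_, ?_, ?_, ?_, ?_, ?_, ?_, ?_, ?_, h.q_pos, h.p_pos,
    by linarith [h.lt_mul_of_lt hlt], h.a_nonneg, by linarith [h.eq_c], ?_, ?_⟩
  case refine_10 =>
    rw [← h.relation]
    match_scalars <;> linarith [h.eq_c]
  case refine_11 =>
    have := h.ν_eq
    simp only [map_add, map_neg, map_smul, smul_eq_mul]
    linear_combination this
  all_goals
    simp only [map_add, map_neg, map_smul, LinearMap.add_apply, LinearMap.neg_apply,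
      LinearMap.smul_apply, smul_eq_mul, h.xx, h.yy, h.zz, h.xy, h.yz, h.xz, h.yx, h.zx, h.zy,
      h.ω_xy, h.ω_yz, h.ω_xz, h.ω_yx, h.ω_zx, h.ω_zy, D.ω_self]
    try ring

end CyclicTriple

end BeltData



/-! ### Belt seeds and their mutations -/

namespace BeltData

variable {V : Type*} [AddCommGroup V] [Module ℝ V] (D : BeltData V)

def IsBeltTriple (x y z : V) : Prop :=
  (∃ p q r a b c, D.AcyclicTriple x y z p q r a b c) ∨
    ∃ r p q a b c, D.CyclicTriple x y z r p q a b c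

/-- A seed whose exchange matrix is given by `ω` and whose vectors form a belt triple in some order. -/
structure IsBeltSeed (s : Seed V) : Prop where
  mat_eq : ∀ i j, s.mat i j = D.ω (s.vec i) (s.vec j)
  exists_triple : ∃ i j k, i ≠ j ∧ j ≠ k ∧ i ≠ k ∧ D.IsBeltTriple (s.vec i) (s.vec j) (s.vec k)

open Classical in
/-- The partial reflection of `f` in `v`. -/
noncomputable def partialReflection (v f : V) : V :=
  if (v ∈ D.pos ∧ D.ω f v < 0) ∨ (v ∉ D.pos ∧ 0 < D.ω f v) then f - D.Q f v • v else f

variable {D} {x y z : V} {p q r a b c : ℝ} {f v : V} {w : ℝ} {s : Seed V}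

theorem partialReflection_of_mem (hv : v ∈ D.pos) (hω : D.ω v f = w) (hw : 0 ≤ w)
    (hQ : D.Q f v = -w) : D.partialReflection v f = f + w • v := by
  unfold partialReflection
  rw [D.skew f v, hω, hQ]
  split_ifs with h
  · module
  · have : w = 0 := by
      by_contra hne
      exact h (Or.inl ⟨hv, by have := lt_of_le_of_ne hw (Ne.symm hne); linarith⟩)
    rw [this]; module

theorem partialReflection_of_notMem (hv : v ∉ D.pos) (hω : D.ω f v = w) (hw : 0 ≤ w)
    (hQ : D.Q f v = -w) : D.partialReflection v f = f + w • v := by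
  unfold partialReflection
  rw [hω, hQ]
  split_ifs with h
  · module
  · have : w = 0 := by
      by_contra hne
      exact h (Or.inr ⟨hv, lt_of_le_of_ne hw (Ne.symm hne)⟩)
    rw [this]; module

theorem partialReflection_eq_self_of_mem (hv : v ∈ D.pos) (hω : 0 ≤ D.ω f v) :
    D.partialReflection v f = f :=
  if_neg (by rintro (h | h); exacts [hω.not_gt h.2, h.1 hv])

theorem partialReflection_eq_self_of_notMem (hv : v ∉ D.pos) (hω : D.ω f v ≤ 0) :
    D.partialReflection v f = f :=
  if_neg (by rintro (h | h); exacts [hv h.1, hω.not_gt h.2])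

theorem mutateSeed_vec_self (k : Fin 3) : (mutateSeed D.Q D.pos k s).vec k = -s.vec k := by
  simp [mutateSeed]

theorem IsBeltSeed.mutateSeed_vec (hs : D.IsBeltSeed s) {i k : Fin 3} (h : i ≠ k) :
    (mutateSeed D.Q D.pos k s).vec i = D.partialReflection (s.vec k) (s.vec i) := by
  simp only [mutateSeed, if_neg h, partialReflection]
  rw [hs.mat_eq]

/-- The partial reflection of `f` in `v` is trivial or a transvection of the form `ω`. -/
def IsTransvective (D : BeltData V) (v f : V) : Prop :=
  D.Q f v = -|D.ω f v| ∨ (v ∈ D.pos ∧ 0 ≤ D.ω f v) ∨ (v ∉ D.pos ∧ D.ω f v ≤ 0)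

theorem IsTransvective.of_mem (h : D.IsTransvective v f) (hv : v ∈ D.pos) :
    D.partialReflection v f = f + ((|D.ω f v| - D.ω f v) / 2) • v := by
  rcases le_or_gt 0 (D.ω f v) with h0 | h0
  · rw [partialReflection_eq_self_of_mem hv h0, abs_of_nonneg h0]; module
  · have hQ : D.Q f v = -|D.ω f v| := by
      rcases h with h | h | h
      exacts [h, absurd h.2 h0.not_ge, absurd hv h.1]
    rw [partialReflection_of_mem hv (w := -D.ω f v) (D.skew v f) (by linarith)
      (by rw [hQ, abs_of_neg h0]), abs_of_neg h0]
    module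

theorem IsTransvective.of_notMem (h : D.IsTransvective v f) (hv : v ∉ D.pos) :
    D.partialReflection v f = f + ((|D.ω f v| + D.ω f v) / 2) • v := by
  rcases le_or_gt (D.ω f v) 0 with h0 | h0
  · rw [partialReflection_eq_self_of_notMem hv h0, abs_of_nonpos h0]; module
  · have hQ : D.Q f v = -|D.ω f v| := by
      rcases h with h | h | h
      exacts [h, absurd h.1 hv, absurd h.2 h0.not_ge]
    rw [partialReflection_of_notMem hv (w := D.ω f v) rfl h0.le
      (by rw [hQ, abs_of_pos h0]), abs_of_pos h0]
    module

/-- Adding the positive or negative part of `ω(v_i, v_k)` times `v_k` to every `v_i` changes the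
values of `ω` exactly by the matrix mutation rule, whichever part is used. Thus one form `ω` serves
all seeds. -/
theorem IsBeltSeed.mutateSeed_mat (hs : D.IsBeltSeed s) {k : Fin 3}
    (h : ∀ i, i ≠ k → D.IsTransvective (s.vec k) (s.vec i)) (i j : Fin 3) :
    (mutateSeed D.Q D.pos k s).mat i j =
      D.ω ((mutateSeed D.Q D.pos k s).vec i) ((mutateSeed D.Q D.pos k s).vec j) := by
  change mutateMatrix k s.mat i j = _
  simp only [mutateMatrix, Matrix.of_apply, hs.mat_eq]
  by_cases hi : i = k
  · subst hi
    rw [if_pos (Or.inl rfl), mutateSeed_vec_self]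
    by_cases hj : j = i
    · subst hj
      rw [mutateSeed_vec_self, D.ω_self, D.ω_self, neg_zero]
    · rw [hs.mutateSeed_vec hj]
      by_cases hpos : s.vec i ∈ D.pos
      · rw [(h j hj).of_mem hpos]; simp [D.ω_self]
      · rw [(h j hj).of_notMem hpos]; simp [D.ω_self]
  by_cases hj : j = k
  · subst hj
    rw [if_pos (Or.inr rfl), mutateSeed_vec_self, hs.mutateSeed_vec hi]
    by_cases hpos : s.vec j ∈ D.pos
    · rw [(h i hi).of_mem hpos]; simp [D.ω_self]
    · rw [(h i hi).of_notMem hpos]; simp [D.ω_self]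
  rw [if_neg (by tauto), hs.mutateSeed_vec hi, hs.mutateSeed_vec hj]
  by_cases hpos : s.vec k ∈ D.pos
  · rw [(h i hi).of_mem hpos, (h j hj).of_mem hpos]
    simp only [map_add, map_smul, LinearMap.add_apply, LinearMap.smul_apply, smul_eq_mul, D.ω_self,
      D.skew (s.vec k) (s.vec j), abs_neg]
    ring
  · rw [(h i hi).of_notMem hpos, (h j hj).of_notMem hpos]
    simp only [map_add, map_smul, LinearMap.add_apply, LinearMap.smul_apply, smul_eq_mul, D.ω_self,
      D.skew (s.vec k) (s.vec j), abs_neg]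
    ring

namespace AcyclicTriple

variable (h : D.AcyclicTriple x y z p q r a b c)
include h

theorem transvective_xy : D.IsTransvective x y :=
  Or.inl (by rw [h.yx, h.ω_yx, abs_neg, abs_of_nonneg h.p_nonneg])
theorem transvective_xz : D.IsTransvective x z :=
  Or.inl (by rw [h.zx, h.ω_zx, abs_neg, abs_of_nonneg h.r_nonneg])
theorem transvective_yx : D.IsTransvective y x :=
  Or.inl (by rw [h.xy, h.ω_xy, abs_of_nonneg h.p_nonneg])
theorem transvective_yz : D.IsTransvective y z :=
  Or.inl (by rw [h.zy, h.ω_zy, abs_neg, abs_of_nonneg h.q_nonneg])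
theorem transvective_zx : D.IsTransvective z x :=
  Or.inl (by rw [h.xz, h.ω_xz, abs_of_nonneg h.r_nonneg])
theorem transvective_zy : D.IsTransvective z y :=
  Or.inl (by rw [h.yz, h.ω_yz, abs_of_nonneg h.q_nonneg])

end AcyclicTriple

namespace CyclicTriple

variable (h : D.CyclicTriple x y z r p q a b c)
include h

theorem transvective_xy : D.IsTransvective x y :=
  Or.inr (Or.inr ⟨h.x_notMem_pos, by rw [h.ω_yx]; linarith [h.r_pos]⟩)
theorem transvective_xz : D.IsTransvective x z :=
  Or.inl (by rw [h.zx, h.ω_zx, abs_of_pos h.q_pos])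
theorem transvective_yx : D.IsTransvective y x :=
  Or.inr (Or.inl ⟨h.y_mem_pos, by rw [h.ω_xy]; exact h.r_pos.le⟩)
theorem transvective_yz : D.IsTransvective y z :=
  Or.inl (by rw [h.zy, h.ω_zy, abs_neg, abs_of_pos h.p_pos])
theorem transvective_zx : D.IsTransvective z x :=
  Or.inl (by rw [h.xz, h.ω_xz, abs_neg, abs_of_pos h.q_pos])
theorem transvective_zy : D.IsTransvective z y :=
  Or.inl (by rw [h.yz, h.ω_yz, abs_of_pos h.p_pos])

end CyclicTriple

/-- Mutation of a belt seed, once the partial reflections are known. -/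
theorem IsBeltSeed.mutateSeed_of (hs : D.IsBeltSeed s) {i j k : Fin 3} (hij : i ≠ j) (hjk : j ≠ k)
    (hik : i ≠ k) (hi : D.IsTransvective (s.vec k) (s.vec i))
    (hj : D.IsTransvective (s.vec k) (s.vec j)) {f g : V}
    (hf : D.partialReflection (s.vec k) (s.vec i) = f)
    (hg : D.partialReflection (s.vec k) (s.vec j) = g)
    (h : D.IsBeltTriple f g (-s.vec k) ∨ D.IsBeltTriple f (-s.vec k) g ∨
      D.IsBeltTriple (-s.vec k) f g ∨ D.IsBeltTriple g f (-s.vec k) ∨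
      D.IsBeltTriple g (-s.vec k) f ∨ D.IsBeltTriple (-s.vec k) g f) :
    D.IsBeltSeed (mutateSeed D.Q D.pos k s) := by
  refine ⟨hs.mutateSeed_mat ?_, ?_⟩
  · intro l hl
    have : l = i ∨ l = j := by clear * - hl hij hjk hik; revert i j k l; decide
    rcases this with rfl | rfl
    exacts [hi, hj]
  · have ei := (hs.mutateSeed_vec hik).trans hf
    have ej := (hs.mutateSeed_vec hjk).trans hg
    have ek := mutateSeed_vec_self (D := D) (s := s) k
    rcases h with h | h | h | h | h | h
    · exact ⟨i, j, k, hij, hjk, hik, by rwa [ei, ej, ek]⟩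
    · exact ⟨i, k, j, hik, hjk.symm, hij, by rwa [ei, ej, ek]⟩
    · exact ⟨k, i, j, hik.symm, hij, hjk.symm, by rwa [ei, ej, ek]⟩
    · exact ⟨j, i, k, hij.symm, hik, hjk, by rwa [ei, ej, ek]⟩
    · exact ⟨j, k, i, hjk, hik.symm, hij.symm, by rwa [ei, ej, ek]⟩
    · exact ⟨k, j, i, hjk.symm, hij.symm, hik.symm, by rwa [ei, ej, ek]⟩

theorem AcyclicTriple.isBeltTriple (h : D.AcyclicTriple x y z p q r a b c) :
    D.IsBeltTriple x y z := Or.inl ⟨_, _, _, _, _, _, h⟩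

theorem CyclicTriple.isBeltTriple (h : D.CyclicTriple x y z r p q a b c) :
    D.IsBeltTriple x y z := Or.inr ⟨_, _, _, _, _, _, h⟩

section Acyclic

variable {i j k : Fin 3} (hs : D.IsBeltSeed s) (hij : i ≠ j) (hjk : j ≠ k) (hik : i ≠ k)
  (h : D.AcyclicTriple (s.vec i) (s.vec j) (s.vec k) p q r a b c)
include hs hij hjk hik h

theorem IsBeltSeed.mutateSeed_source : D.IsBeltSeed (mutateSeed D.Q D.pos i s) :=
  hs.mutateSeed_of hjk hik.symm hij.symm h.transvective_xy h.transvective_xz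
    (partialReflection_of_mem h.x_mem_pos h.ω_xy h.p_nonneg h.yx)
    (partialReflection_of_mem h.x_mem_pos h.ω_xz h.r_nonneg h.zx) (Or.inl h.source.isBeltTriple)

theorem IsBeltSeed.mutateSeed_sink : D.IsBeltSeed (mutateSeed D.Q D.pos k s) :=
  hs.mutateSeed_of hij hjk hik h.transvective_zx h.transvective_zy
    (partialReflection_of_notMem h.z_notMem_pos h.ω_xz h.r_nonneg h.xz)
    (partialReflection_of_notMem h.z_notMem_pos h.ω_yz h.q_nonneg h.yz)
    (Or.inr (Or.inr (Or.inl h.sink.isBeltTriple)))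

theorem IsBeltSeed.mutateSeed_middle : D.IsBeltSeed (mutateSeed D.Q D.pos j s) := by
  rcases h.p_nonneg.eq_or_lt' with hp | hp
  · exact hs.mutateSeed_source hij.symm hik hjk (h.swap_xy hp)
  rcases h.q_nonneg.eq_or_lt' with hq | hq
  · exact hs.mutateSeed_sink hik hjk.symm hij (h.swap_yz hq)
  rcases le_or_gt (p * a) (q * c) with hle | hlt
  · have hpos := (h.mem_pos_y_iff hq).2 hle
    exact hs.mutateSeed_of hik hjk.symm hij h.transvective_yx h.transvective_yz
      (partialReflection_eq_self_of_mem hpos (by rw [h.ω_xy]; exact hp.le))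
      (partialReflection_of_mem hpos h.ω_yz hq.le h.zy)
      (Or.inr (Or.inr (Or.inl (h.middle_pos hp hq hle).isBeltTriple)))
  · have hpos := fun hh => hlt.not_ge ((h.mem_pos_y_iff hq).1 hh)
    exact hs.mutateSeed_of hik hjk.symm hij h.transvective_yx h.transvective_yz
      (partialReflection_of_notMem hpos h.ω_xy hp.le h.xy)
      (partialReflection_eq_self_of_notMem hpos (by rw [h.ω_zy]; linarith))
      (Or.inr (Or.inr (Or.inr (Or.inr (Or.inl (h.middle_neg hp hq hlt).isBeltTriple)))))

end Acyclic

section Cyclic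

variable {i j k : Fin 3} (hs : D.IsBeltSeed s) (hij : i ≠ j) (hjk : j ≠ k) (hik : i ≠ k)
  (h : D.CyclicTriple (s.vec i) (s.vec j) (s.vec k) r p q a b c)
include hs hij hjk hik h

theorem IsBeltSeed.mutateSeed_cyclic_first : D.IsBeltSeed (mutateSeed D.Q D.pos i s) := by
  refine hs.mutateSeed_of hjk hik.symm hij.symm h.transvective_xy h.transvective_xz
    (partialReflection_eq_self_of_notMem h.x_notMem_pos (by rw [h.ω_yx]; linarith [h.r_pos]))
    (partialReflection_of_notMem h.x_notMem_pos h.ω_zx h.q_pos.le h.zx) ?_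
  rcases le_or_gt (q * r) p with hle | hlt
  · exact Or.inr (Or.inl (h.mutate_x_acyclic hle).isBeltTriple)
  · exact Or.inr (Or.inr (Or.inr (Or.inl (h.mutate_x hlt).isBeltTriple)))

theorem IsBeltSeed.mutateSeed_cyclic_second : D.IsBeltSeed (mutateSeed D.Q D.pos j s) := by
  refine hs.mutateSeed_of hik hjk.symm hij h.transvective_yx h.transvective_yz
    (partialReflection_eq_self_of_mem h.y_mem_pos (by rw [h.ω_xy]; exact h.r_pos.le))
    (partialReflection_of_mem h.y_mem_pos h.ω_yz h.p_pos.le h.zy) ?_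
  rcases le_or_gt (p * r) q with hle | hlt
  · exact Or.inr (Or.inr (Or.inr (Or.inr (Or.inl (h.mutate_y_acyclic hle).isBeltTriple))))
  · exact Or.inl (h.mutate_y hlt).isBeltTriple

theorem IsBeltSeed.mutateSeed_cyclic_third : D.IsBeltSeed (mutateSeed D.Q D.pos k s) := by
  rcases le_or_gt (p * b) (q * a) with hle | hlt
  · have hpos := h.mem_pos_z_iff.2 hle
    exact hs.mutateSeed_of hij hjk hik h.transvective_zx h.transvective_zy
      (partialReflection_of_mem hpos h.ω_zx h.q_pos.le h.xz)
      (partialReflection_eq_self_of_mem hpos (by rw [h.ω_yz]; exact h.p_pos.le))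
      (Or.inr (Or.inr (Or.inr (Or.inr (Or.inr (h.mutate_z_pos hle).isBeltTriple)))))
  · have hpos := fun hh => hlt.not_ge (h.mem_pos_z_iff.1 hh)
    exact hs.mutateSeed_of hij hjk hik h.transvective_zx h.transvective_zy
      (partialReflection_eq_self_of_notMem hpos (by rw [h.ω_xz]; linarith [h.q_pos]))
      (partialReflection_of_notMem hpos h.ω_yz h.p_pos.le h.yz)
      (Or.inr (Or.inl (h.mutate_z_neg hlt).isBeltTriple))

end Cyclic

theorem IsBeltSeed.mutateSeed (hs : D.IsBeltSeed s) (l : Fin 3) :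
    D.IsBeltSeed (mutateSeed D.Q D.pos l s) := by
  obtain ⟨i, j, k, hij, hjk, hik, h⟩ := hs.exists_triple
  have : l = i ∨ l = j ∨ l = k := by clear * - hij hjk hik; revert i j k l; decide
  rcases h with ⟨p, q, r, a, b, c, h⟩ | ⟨r, p, q, a, b, c, h⟩
  · rcases this with rfl | rfl | rfl
    exacts [hs.mutateSeed_source hij hjk hik h, hs.mutateSeed_middle hij hjk hik h,
      hs.mutateSeed_sink hij hjk hik h]
  · rcases this with rfl | rfl | rfl
    exacts [hs.mutateSeed_cyclic_first hij hjk hik h, hs.mutateSeed_cyclic_second hij hjk hik h,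
      hs.mutateSeed_cyclic_third hij hjk hik h]

theorem IsBeltSeed.relabel (hs : D.IsBeltSeed s) (σ : Equiv.Perm (Fin 3)) :
    D.IsBeltSeed (relabel σ s) := by
  obtain ⟨i, j, k, hij, hjk, hik, h⟩ := hs.exists_triple
  refine ⟨fun i j => hs.mat_eq _ _, σ⁻¹ i, σ⁻¹ j, σ⁻¹ k, ?_, ?_, ?_, ?_⟩
  · exact σ⁻¹.injective.ne hij
  · exact σ⁻¹.injective.ne hjk
  · exact σ⁻¹.injective.ne hik
  · simpa [_root_.relabel] using h

theorem mem_pos_iff_neg_notMem (h : D.slope f ≠ 0 ∨ D.ν f ≠ 0) : f ∈ D.pos ↔ -f ∉ D.pos := by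
  have e1 : D.slope (-f) = -D.slope f := map_neg _ _
  have e2 : D.ν (-f) = -D.ν f := map_neg _ _
  change _ ∨ _ ↔ ¬ (_ ∨ _)
  rw [e1, e2]
  rcases lt_trichotomy (D.slope f) 0 with h0 | h0 | h0
  · constructor
    · rintro (h' | h') <;> linarith
    · intro h'; exact absurd (Or.inl (by linarith)) h'
  · rw [h0] at h ⊢
    rcases h with h | h
    · exact absurd rfl h
    · rcases lt_or_gt_of_ne h with h | h
      · simp [h.le, h]
      · simp [h.le, h]
  · constructor
    · rintro - (h' | h') <;> linarith
    · intro; exact Or.inl h0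

/-- `slope` and `ν` never vanish simultaneously on a vector of a belt triple, so exactly one of `±f`
is positive. This makes mutation an involution on belt seeds. -/
theorem IsBeltTriple.definite (h : D.IsBeltTriple x y z) :
    ∀ f, f = x ∨ f = y ∨ f = z → (f ∈ D.pos ↔ -f ∉ D.pos) ∧ D.Q f f = 2 := by
  rcases h with ⟨p, q, r, a, b, c, h⟩ | ⟨r, p, q, a, b, c, h⟩
  · rintro f (rfl | rfl | rfl)
    · exact ⟨mem_pos_iff_neg_notMem (Or.inl (by rw [h.slope_x]; linarith [h.a_pos])), h.xx⟩
    · refine ⟨mem_pos_iff_neg_notMem ?_, h.yy⟩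
      by_contra! hcon
      rcases h.pos_or_pos with hp | hq
      · have h1 := h.slope_y
        have h2 := ν_relation h.relation
        have h3 := h.ν_eq
        have h4 := h.eq_a
        have h5 := h.a_pos
        rw [hcon.1] at h1
        have key : 2 * a * D.ν f = -p := by
          linear_combination p * h2 - c * h3 + D.ν f * h4 - D.ν x * h1
        rw [hcon.2] at key; linarith
      · exact (h.ν_y hq hcon.1).ne hcon.2
    · exact ⟨mem_pos_iff_neg_notMem (Or.inl (by rw [h.slope_z]; linarith [h.c_pos])), h.zz⟩
  · rintro f (rfl | rfl | rfl)
    · refine ⟨mem_pos_iff_neg_notMem ?_, h.xx⟩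
      by_contra! hcon
      have := h.slope_x
      exact (h.ν_x (by linarith)).ne' hcon.2
    · exact ⟨mem_pos_iff_neg_notMem (Or.inl (by rw [h.slope_y]; linarith [h.b_pos])), h.yy⟩
    · refine ⟨mem_pos_iff_neg_notMem ?_, h.zz⟩
      by_contra! hcon
      exact (h.ν_z hcon.1).ne hcon.2

theorem IsBeltSeed.definite (hs : D.IsBeltSeed s) (l : Fin 3) :
    (s.vec l ∈ D.pos ↔ -s.vec l ∉ D.pos) ∧ D.Q (s.vec l) (s.vec l) = 2 := by
  obtain ⟨i, j, k, hij, hjk, hik, h⟩ := hs.exists_triple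
  have : l = i ∨ l = j ∨ l = k := by clear * - hij hjk hik; revert i j k l; decide
  exact h.definite _ (by rcases this with rfl | rfl | rfl <;> simp)

theorem IsBeltSeed.mutateSeed_mutateSeed (hs : D.IsBeltSeed s) (l : Fin 3) :
    _root_.mutateSeed D.Q D.pos l (_root_.mutateSeed D.Q D.pos l s) = s := by
  classical
  have h := hs.definite l
  rw [mutateSeed_eq_signedMutation, mutateSeed_vec_self, mutateSeed_eq_signedMutation]
  have : decide (-s.vec l ∈ D.pos) = !decide (s.vec l ∈ D.pos) := by
    by_cases h' : s.vec l ∈ D.pos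
    · simp [h', h.1.1 h']
    · simp [h', not_not.1 fun h'' => h' (h.1.2 h'')]
  rw [this, signedMutation_not_signedMutation h.2]

theorem IsBeltSeed.exists_slope_ne_zero (hs : D.IsBeltSeed s) : ∃ l, D.slope (s.vec l) ≠ 0 := by
  obtain ⟨i, j, k, -, -, -, h⟩ := hs.exists_triple
  rcases h with ⟨p, q, r, a, b, c, h⟩ | ⟨r, p, q, a, b, c, h⟩
  · exact ⟨i, by rw [h.slope_x]; linarith [h.a_pos]⟩
  · exact ⟨j, by rw [h.slope_y]; linarith [h.b_pos]⟩

end BeltData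



/-! ### Translations along the belt -/

namespace BeltData

variable {V : Type*} [AddCommGroup V] [Module ℝ V] (D : BeltData V)

/-- The infinitesimal translation `f ↦ -τ * slope f • δ`. -/
noncomputable def shift (τ : ℝ) : V →ₗ[ℝ] V := (-τ) • (D.ω D.δ).smulRight D.δ

theorem shift_apply (τ : ℝ) (f : V) : D.shift τ f = -(τ * D.slope f) • D.δ := by
  simp [shift, slope, smul_smul]

theorem shift_zero : D.shift 0 = 0 := by
  ext f; simp [shift_apply]

theorem shift_add (τ τ' : ℝ) : D.shift (τ + τ') = D.shift τ + D.shift τ' := by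
  ext f
  simp only [shift_apply, LinearMap.add_apply]
  module

theorem slope_δ : D.slope D.δ = 0 := D.ω_self _

theorem slope_shift (τ : ℝ) (f : V) : D.slope (f + D.shift τ f) = D.slope f := by
  have : D.slope (f + D.shift τ f) = D.slope f + -(τ * D.slope f) * D.slope D.δ := by
    rw [shift_apply]; simp [slope]
  rw [this, slope_δ, mul_zero, add_zero]

/-- A nonzero slope decides positivity and is unchanged; for slope zero the function itself does not
move. -/
theorem mem_pos_shift (τ : ℝ) (f : V) : f + D.shift τ f ∈ D.pos ↔ f ∈ D.pos := by
  change _ ∨ _ ↔ _ ∨ _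
  rw [slope_shift]
  refine or_congr_right (and_congr_right fun h => ?_)
  rw [shift_apply, h]; simp

def IsRadicalSpan : Prop := ∀ f, (∀ g, D.Q f g = 0) → ∃ c : ℝ, f = c • D.δ

variable {D} {s t u : Seed V} {τ : ℝ}

theorem isRadicalShift_shift (hD : D.IsRadicalSpan) (τ : ℝ) : IsRadicalShift D.Q (D.shift τ) := by
  refine ⟨fun x y => ?_, fun x hx => ?_⟩
  · rw [shift_apply]; simp [D.radical]
  · obtain ⟨c, rfl⟩ := hD x hx
    have : D.slope (c • D.δ) = c * D.slope D.δ := by simp [slope]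
    rw [shift_apply, this, slope_δ]; simp

theorem mutateSeed_shiftSeed (hD : D.IsRadicalSpan) (τ : ℝ) (k : Fin 3) (t : Seed V) :
    mutateSeed D.Q D.pos k (shiftSeed (D.shift τ) t) =
      shiftSeed (D.shift τ) (mutateSeed D.Q D.pos k t) := by
  classical
  rw [mutateSeed_eq_signedMutation, mutateSeed_eq_signedMutation,
    signedMutation_shiftSeed D.symm (isRadicalShift_shift hD τ)]
  have : decide ((shiftSeed (D.shift τ) t).vec k ∈ D.pos) = decide (t.vec k ∈ D.pos) :=
    decide_eq_decide.2 (D.mem_pos_shift τ _)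
  rw [this]

/-- The translation of unlabelled seeds. -/
noncomputable def translate (D : BeltData V) (τ : ℝ) : USeed V → USeed V :=
  Quotient.map (shiftSeed (D.shift τ)) (by
    rintro s t ⟨σ, h1, h2⟩
    obtain rfl : t = relabel σ s := Seed.ext h1 h2
    exact ⟨σ, rfl, rfl⟩)

theorem translate_unlabelled (τ : ℝ) (t : Seed V) :
    D.translate τ t.unlabelled = (shiftSeed (D.shift τ) t).unlabelled := rfl

theorem translate_zero (x : USeed V) : D.translate 0 x = x := by
  obtain ⟨t, rfl⟩ := exists_unlabelled x
  rw [translate_unlabelled, shift_zero, shiftSeed_zero]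

theorem translate_add (hD : D.IsRadicalSpan) (τ τ' : ℝ) (x : USeed V) :
    D.translate (τ + τ') x = D.translate τ (D.translate τ' x) := by
  obtain ⟨t, rfl⟩ := exists_unlabelled x
  rw [translate_unlabelled, translate_unlabelled, translate_unlabelled, shift_add,
    shiftSeed_shiftSeed (isRadicalShift_shift hD _) (isRadicalShift_shift hD _)]

theorem translate_neg_translate (hD : D.IsRadicalSpan) (τ : ℝ) (x : USeed V) :
    D.translate (-τ) (D.translate τ x) = x := by
  rw [← translate_add hD, neg_add_cancel, translate_zero]

/-! ### The translation group acting on the exchange graph. -/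

section Graph

variable (hs : D.IsBeltSeed s)
include hs

theorem IsBeltSeed.of_mem_labelledSeeds (ht : t ∈ labelledSeeds D.Q D.pos s) : D.IsBeltSeed t :=
  labelledSeeds_induction (P := fun t => D.IsBeltSeed t) hs (fun _ _ k h => h.mutateSeed k) t ht

theorem IsBeltSeed.of_mem_exchangeVertices
    (ht : t.unlabelled ∈ exchangeVertices D.Q D.pos s) : D.IsBeltSeed t := by
  obtain ⟨u, hu, hut⟩ := mem_exchangeVertices.1 ht
  obtain ⟨σ, rfl⟩ := unlabelled_eq_iff.1 hut.symm
  exact (hs.of_mem_labelledSeeds hu).relabel σ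

/-- A translation which relates two vertices acts on the exchange graph. -/
theorem IsBeltSeed.translate_mem (hD : D.IsRadicalSpan) {x y : USeed V}
    (hx : x ∈ exchangeVertices D.Q D.pos s) (hy : y ∈ exchangeVertices D.Q D.pos s)
    (hτ : D.translate τ x ∈ exchangeVertices D.Q D.pos s) :
    D.translate τ y ∈ exchangeVertices D.Q D.pos s := by
  have key : ∀ (x y : exchangeVertices D.Q D.pos s) (_ : (exchangeGraph D.Q D.pos s).Walk x y),
      D.translate τ x.1 ∈ exchangeVertices D.Q D.pos s →
      D.translate τ y.1 ∈ exchangeVertices D.Q D.pos s := by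
    intro x y w
    induction w with
    | nil => exact id
    | @cons u v w h _ ih =>
      intro hu
      refine ih ?_
      obtain ⟨-, t, k, ⟨h1, h2⟩ | ⟨h1, h2⟩⟩ := h
      · rw [h1, translate_unlabelled] at hu
        rw [h2, translate_unlabelled, ← mutateSeed_shiftSeed hD]
        exact mutateSeed_mem_exchangeVertices hu k
      -- The edge is read backwards, which is legitimate because mutation is an involution on belt
      -- seeds.
      · rw [h2, translate_unlabelled] at hu
        have := mutateSeed_mem_exchangeVertices hu k
        have ht : D.IsBeltSeed t := hs.of_mem_exchangeVertices (h1 ▸ v.2)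
        rw [mutateSeed_shiftSeed hD, ht.mutateSeed_mutateSeed] at this
        rwa [h1, translate_unlabelled]
  exact key ⟨x, hx⟩ ⟨y, hy⟩
    ((exchangeGraph_connected D.Q D.pos s).preconnected ⟨x, hx⟩ ⟨y, hy⟩).some hτ

/-- The group of translations acting on the exchange graph. -/
def IsBeltSeed.translations (hD : D.IsRadicalSpan) : Submodule ℤ ℝ :=
  AddSubgroup.toIntSubmodule
  { carrier := {τ | ∀ x ∈ exchangeVertices D.Q D.pos s,
      D.translate τ x ∈ exchangeVertices D.Q D.pos s}
    zero_mem' := fun x hx => by rwa [translate_zero]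
    add_mem' := fun ha hb x hx => by
      rw [translate_add hD]; exact ha _ (hb _ hx)
    neg_mem' := fun {τ} ha x hx =>
      hs.translate_mem hD (ha x hx) hx (by rwa [translate_neg_translate hD]) }

/-- A translation that permutes the vectors has a positive multiple fixing each of them, and a
vector of nonzero slope is moved by every nonzero translation. -/
theorem IsBeltSeed.translate_free (h : D.translate τ s.unlabelled = s.unlabelled) : τ = 0 := by
  rw [translate_unlabelled, eq_comm, unlabelled_eq_iff] at h
  obtain ⟨σ, hσ⟩ := h
  have h1 : ∀ i, s.vec (σ i) = s.vec i + D.shift τ (s.vec i) := fun i =>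
    (congrFun (congrArg Seed.vec hσ) i).symm
  have h2 : ∀ (n : ℕ) i, s.vec ((σ ^ n) i) = s.vec i + D.shift (n * τ) (s.vec i) := by
    intro n i
    induction n with
    | zero => simp [shift_zero]
    | succ n ih =>
      rw [pow_succ', Equiv.Perm.mul_apply, h1, ih, D.shift_apply τ, slope_shift, shift_apply,
        shift_apply]
      push_cast
      module
  obtain ⟨l, hl⟩ := hs.exists_slope_ne_zero
  have h3 := h2 (orderOf σ) l
  rw [pow_orderOf_eq_one, Equiv.Perm.one_apply, left_eq_add, shift_apply] at h3
  have hδ : D.δ ≠ 0 := fun h0 => by have := D.ν_δ; rw [h0, map_zero] at this; norm_num at this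
  have h4 := (smul_eq_zero.1 h3).resolve_right hδ
  have h5 : (orderOf σ : ℝ) ≠ 0 := by exact_mod_cast (orderOf_pos σ).ne'
  rcases mul_eq_zero.1 (neg_eq_zero.1 h4) with h6 | h6
  · exact (mul_eq_zero.1 h6).resolve_left h5
  · exact absurd h6 hl

/-- Belt seeds with the same matrix and the same vectors up to constants are translates. -/
theorem IsBeltSeed.eq_shiftSeed (ht : D.IsBeltSeed t) (hmat : s.mat = t.mat) {c : Fin 3 → ℝ}
    (hc : ∀ i, t.vec i = s.vec i + c i • D.δ) :
    ∃ τ, t = shiftSeed (D.shift τ) s ∧ ∀ i, c i = -(τ * D.slope (s.vec i)) := by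
  obtain ⟨l, hl⟩ := hs.exists_slope_ne_zero
  -- Both matrices consist of values of the same `ω`; comparing entries makes the constants
  -- proportional to the slopes, so the displacement is along the belt line.
  have h : ∀ i, c i * D.slope (s.vec l) = c l * D.slope (s.vec i) := by
    intro i
    have h1 := hs.mat_eq i l
    rw [hmat, ht.mat_eq, hc i, hc l] at h1
    have h2 := D.skew (s.vec i) D.δ
    simp only [map_add, map_smul, LinearMap.add_apply, LinearMap.smul_apply, smul_eq_mul,
      D.ω_self, slope] at h1 ⊢
    rw [h2] at h1
    linarith
  have hci : ∀ i, c i = -(-(c l / D.slope (s.vec l)) * D.slope (s.vec i)) := fun i => by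
    field_simp; linarith [h i]
  refine ⟨-(c l / D.slope (s.vec l)), ?_, hci⟩
  ext1
  · funext i
    rw [hc i, hci i]
    simp only [shiftSeed, shift_apply]
  · exact hmat.symm

variable (hseed : IsSeed D.Q s) (hfin : IsMutationFinite s.mat)
  (hc : IsConnectedTriple (gramTriple D.Q s.vec)) (hm : s.mat ≠ markovMatrix)
  (hm' : s.mat ≠ -markovMatrix)
include hseed hfin hc hm hm'

/-- Finiteness of the number of orbits comes from finiteness of types: seeds of one type differ by a
radical shift, hence by multiples of `δ`, hence by a belt translation. -/
theorem IsBeltSeed.isFreeCocompactAction (hD : D.IsRadicalSpan) :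
    IsFreeCocompactAction (exchangeGraph D.Q D.pos s)
      (fun (τ : hs.translations hD) x => ⟨D.translate τ x.1, τ.2 x.1 x.2⟩) where
  zero x := Subtype.ext (translate_zero _)
  add a b x := Subtype.ext (translate_add hD _ _ _)
  free τ x h := by
    obtain ⟨x, hx⟩ := x
    obtain ⟨t, ht, rfl⟩ := mem_exchangeVertices.1 hx
    exact Subtype.ext ((hs.of_mem_labelledSeeds ht).translate_free (congrArg Subtype.val h))
  adj τ x y h := by
    obtain ⟨hne, t, k, h⟩ := h
    refine ⟨fun h' => hne ?_, shiftSeed (D.shift τ) t, k, ?_⟩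
    · have := congrArg (fun z => D.translate (-τ) (Subtype.val z)) h'
      simp only [translate_neg_translate hD] at this
      exact Subtype.ext this
    · rw [mutateSeed_shiftSeed hD]
      rcases h with ⟨h1, h2⟩ | ⟨h1, h2⟩
      · exact Or.inl ⟨by simp only [h1, translate_unlabelled], by simp only [h2, translate_unlabelled]⟩
      · exact Or.inr ⟨by simp only [h1, translate_unlabelled], by simp only [h2, translate_unlabelled]⟩
  cocompact := by
    obtain ⟨k₀, hk₀⟩ := hseed.exists_abs_gramTriple_lt D.symm hfin hc hm hm'
    have hreach : labelledSeeds D.Q D.pos s ⊆ reached D.Q s := fun t ht =>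
      ReachedIn.of_mem_labelledSeeds ht
    have hT := (hseed.finite_types D.symm hfin hc).subset (Set.image_mono hreach)
    obtain ⟨R, hRsub, hRfin, hR⟩ := Set.exists_subset_image_finite_and.1 ⟨_, subset_rfl, hT, rfl⟩
    refine ⟨Subtype.val ⁻¹' (Seed.unlabelled '' R), ?_, ?_⟩
    · exact (hRfin.image _).preimage Subtype.val_injective.injOn
    · rintro ⟨x, hx⟩
      obtain ⟨t, ht, rfl⟩ := mem_exchangeVertices.1 hx
      obtain ⟨u, hu, hut⟩ : hseed.typeOf t ∈ hseed.typeOf '' R := hR ▸ ⟨t, ht, rfl⟩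
      obtain ⟨h, hh, hshift⟩ := hseed.exists_shift D.symm hk₀ (hreach (hRsub hu)) hut
      choose c hc using fun i => hD (h (u.vec i)) (hh.mem _)
      have hub := hs.of_mem_labelledSeeds (hRsub hu)
      obtain ⟨τ, hτ, -⟩ := hub.eq_shiftSeed (hs.of_mem_labelledSeeds ht) (by rw [hshift]; rfl)
        (c := c) (fun i => by rw [hshift, ← hc]; rfl)
      have hux := mem_exchangeVertices.2 ⟨u, hRsub hu, rfl⟩
      refine ⟨⟨τ, fun x hx' => hs.translate_mem hD hux hx' ?_⟩, ⟨u.unlabelled, hux⟩,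
        ⟨u, hu, rfl⟩, ?_⟩
      · rw [translate_unlabelled, ← hτ]; exact hx
      · exact Subtype.ext (congrArg Seed.unlabelled hτ)

end Graph

end BeltData



/-! ### The belt of an acyclic triangle -/

theorem planeForm_apply (f g : AffineFun) : planeForm f g = inner ℝ f.1 g.1 := rfl

theorem planeForm_comm (f g : AffineFun) : planeForm f g = planeForm g f := by
  rw [planeForm_apply, planeForm_apply, real_inner_comm]

theorem planeForm_radical {f : AffineFun} (h : ∀ g, planeForm f g = 0) :
    f = f.2 • ((0, 1) : AffineFun) := by
  have : f.1 = 0 := by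
    have := h f
    rwa [planeForm_apply, inner_self_eq_zero] at this
  ext1
  · simp [this]
  · simp

theorem exists_gradient (φ : AffineFun →ₗ[ℝ] ℝ) (h : φ (0, 1) = 0) :
    ∃ d : Plane, ∀ f : AffineFun, φ f = inner ℝ f.1 d := by
  set ψ : Plane →L[ℝ] ℝ := (φ ∘ₗ LinearMap.inl ℝ Plane ℝ).toContinuousLinearMap
  refine ⟨(InnerProductSpace.toDual ℝ Plane).symm ψ, fun f => ?_⟩
  rw [real_inner_comm, InnerProductSpace.toDual_symm_apply]
  have : f = (f.1, 0) + f.2 • ((0, 1) : AffineFun) := by ext1 <;> simp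
  conv_lhs => rw [this, map_add, map_smul, h, smul_zero, add_zero]
  rfl

/-- Evaluation at a point as a linear form. -/
noncomputable def evalAt (x : Plane) : AffineFun →ₗ[ℝ] ℝ where
  toFun f := AffineFun.eval f x
  map_add' f g := by simp [AffineFun.eval, inner_add_left]; ring
  map_smul' c f := by simp [AffineFun.eval, inner_smul_left]; ring

theorem evalAt_apply (x : Plane) (f : AffineFun) : evalAt x f = inner ℝ f.1 x + f.2 := rfl

theorem evalAt_const (x : Plane) : evalAt x (0, 1) = 1 := by simp [evalAt_apply]

theorem evalAt_add (x d : Plane) (f : AffineFun) : evalAt (x + d) f = evalAt x f + inner ℝ f.1 d := by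
  simp only [evalAt_apply, inner_add_right]; ring

theorem Fin.sum_three_cyclic {M : Type*} [AddCommMonoid M] (f : Fin 3 → M) {i j k : Fin 3}
    (hij : i ≠ j) (hjk : j ≠ k) (hik : i ≠ k) : ∑ l, f l = f i + f j + f k := by
  have : (Finset.univ : Finset (Fin 3)) = {i, j, k} := by
    clear * - hij hjk hik; revert i j k; decide
  rw [this, Finset.sum_insert (by simp [hij, hik]), Finset.sum_pair hjk, add_assoc]

/-! ### Barycentric coefficients and angles of a triangle. -/

section Triangle

variable {s : Seed AffineFun}

/-- The coefficients of the constant function `-1` in the basis given by a seed. -/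
noncomputable def IsSeed.coeff (hs : IsSeed planeForm s) (i : Fin 3) : ℝ :=
  -hs.basis.repr (0, 1) i

theorem IsSeed.sum_coeff (hs : IsSeed planeForm s) :
    ∑ i, hs.coeff i • s.vec i = -((0, 1) : AffineFun) := by
  have := hs.basis.sum_repr (0, 1)
  simp only [IsSeed.basis_apply] at this
  simp only [IsSeed.coeff, neg_smul, Finset.sum_neg_distrib, this]

theorem IsSeed.sum_coeff_eval (hs : IsSeed planeForm s) (x : Plane) :
    ∑ i, hs.coeff i * evalAt x (s.vec i) = -1 := by
  have := congrArg (evalAt x) hs.sum_coeff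
  rw [map_neg, evalAt_const, map_sum] at this
  simpa using this

theorem IsSeed.sum_coeff_gram (hs : IsSeed planeForm s) (f : AffineFun) :
    ∑ i, hs.coeff i * planeForm (s.vec i) f = 0 := by
  have := congrArg (fun g => planeForm g f) hs.sum_coeff
  simpa [planeForm_apply] using this

/-- Evaluating the relation at a point of the domain shows that some coefficient is positive. A
second one that is not positive would give a direction along which no `f_l` increases, and the
domain would contain a ray. -/
theorem IsTriangleSeed.coeff_pos (hs : IsTriangleSeed s) (i : Fin 3) : 0 < hs.1.coeff i := by
  obtain ⟨hseed, ⟨x₀, hx₀⟩, hbdd⟩ := hs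
  change 0 < hseed.coeff i
  have hx : ∀ i, evalAt x₀ (s.vec i) < 0 := hx₀
  by_contra! hi
  obtain ⟨j, hj⟩ : ∃ j, 0 < hseed.coeff j := by
    by_contra! hcon
    have h1 := hseed.sum_coeff_eval x₀
    have h2 : 0 ≤ ∑ i, hseed.coeff i * evalAt x₀ (s.vec i) :=
      Finset.sum_nonneg fun i _ => mul_nonneg_of_nonpos_of_nonpos (hcon i) (hx i).le
    linarith
  have hij : i ≠ j := by rintro rfl; linarith
  obtain ⟨k, hik, hjk⟩ : ∃ k : Fin 3, i ≠ k ∧ j ≠ k := by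
    clear * - hij; revert i j; decide
  -- These prescribed derivatives are nonpositive and annihilate the relation, so they are the
  -- derivatives along an actual vector `d`, nonzero since `y i < 0`.
  set y : Fin 3 → ℝ := Function.update (Function.update 0 i (-hseed.coeff j)) j (hseed.coeff i)
  have hyi : y i = -hseed.coeff j := by simp [y, hij]
  have hyj : y j = hseed.coeff i := by simp [y]
  have hyk : y k = 0 := by simp [y, hik.symm, hjk.symm]
  set φ : AffineFun →ₗ[ℝ] ℝ := hseed.basis.constr ℝ y
  have hφ : ∀ l, φ (s.vec l) = y l := fun l => by
    have := hseed.basis.constr_basis (M' := ℝ) ℝ y l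
    rwa [IsSeed.basis_apply] at this
  have hφδ : φ (0, 1) = 0 := by
    have := congrArg φ hseed.sum_coeff
    rw [map_neg, map_sum, Fin.sum_three_cyclic _ hij hjk hik] at this
    simp only [map_smul, hφ, hyi, hyj, hyk, smul_eq_mul] at this
    linarith
  obtain ⟨d, hd⟩ := exists_gradient φ hφδ
  have hynonpos : ∀ l, y l ≤ 0 := by
    intro l
    have : l = i ∨ l = j ∨ l = k := by clear * - hij hjk hik; revert i j k l; decide
    rcases this with rfl | rfl | rfl
    · rw [hyi]; linarith
    · rw [hyj]; exact hi
    · rw [hyk]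
  have hd0 : d ≠ 0 := by
    rintro rfl
    have := hd (s.vec i)
    rw [hφ, hyi, inner_zero_right] at this
    linarith
  have hray : ∀ t : ℝ, 0 ≤ t → x₀ + t • d ∈ domain s := by
    intro t ht l
    change evalAt _ _ < 0
    rw [evalAt_add, inner_smul_right, ← hd, hφ]
    nlinarith [hx l, hynonpos l, mul_nonneg ht (neg_nonneg.2 (hynonpos l))]
  obtain ⟨C, hC⟩ := hbdd.exists_norm_le
  have hC0 : 0 ≤ C := (norm_nonneg _).trans (hC _ hx₀)
  have hdn : 0 < ‖d‖ := norm_pos_iff.2 hd0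
  have h1 := hC _ (hray ((C + ‖x₀‖ + 1) / ‖d‖) (by positivity))
  have h2 : ‖((C + ‖x₀‖ + 1) / ‖d‖) • d‖ = C + ‖x₀‖ + 1 := by
    rw [norm_smul, Real.norm_of_nonneg (by positivity)]; field_simp
  have h3 := norm_sub_le (x₀ + ((C + ‖x₀‖ + 1) / ‖d‖) • d) x₀
  rw [add_sub_cancel_left, h2] at h3
  linarith

theorem IsTriangleSeed.gram_relation (hs : IsTriangleSeed s) {i j k : Fin 3} (hij : i ≠ j)
    (hjk : j ≠ k) (hik : i ≠ k) :
    2 * hs.1.coeff i + hs.1.coeff j * planeForm (s.vec j) (s.vec i) +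
      hs.1.coeff k * planeForm (s.vec k) (s.vec i) = 0 := by
  have := hs.1.sum_coeff_gram (s.vec i)
  rw [Fin.sum_three_cyclic _ hij hjk hik, hs.1.realisation.self_eq_two] at this
  linarith

theorem IsTriangleSeed.isConnectedTriple (hs : IsTriangleSeed s) :
    IsConnectedTriple (gramTriple planeForm s.vec) := by
  intro k
  have n01 : k ≠ k + 1 := by clear * -; revert k; decide
  have n02 : k ≠ k + 2 := by clear * -; revert k; decide
  have n12 : k + 1 ≠ k + 2 := by clear * -; revert k; decide
  have e1 : k + 1 + 1 = k + 2 := by clear * -; revert k; decide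
  have e2 : k + 1 + 2 = k := by clear * -; revert k; decide
  have e3 : k + 2 + 1 = k := by clear * -; revert k; decide
  have e4 : k + 2 + 2 = k + 1 := by clear * -; revert k; decide
  by_contra! hcon
  simp only [gramTriple, e1, e2, e3, e4] at hcon
  have := hs.gram_relation n01 n12 n02
  rw [hcon.1, planeForm_comm, hcon.2] at this
  linarith [hs.coeff_pos k]

theorem nonpos_of_relations {x y z a b c : ℝ} (ha : 0 < a) (hb : 0 < b) (hc : 0 < c)
    (h1 : 2 * b + c * x + a * z = 0) (h2 : 2 * c + a * y + b * x = 0) (h : x * y * z ≤ 0) :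
    x ≤ 0 := by
  by_contra! hx
  have hz : z < 0 := by
    by_contra! hz
    linarith [mul_pos hc hx, mul_nonneg ha.le hz]
  have hy : y < 0 := by
    by_contra! hy
    linarith [mul_pos hb hx, mul_nonneg ha.le hy]
  have := mul_pos hx (mul_pos_of_neg_of_neg hy hz)
  linarith

/-- The triangle has no obtuse angle: a positive product would force the two others to be negative,
by the relations with positive coefficients, and the product of all three would be positive, which
acyclicity excludes. -/
theorem IsTriangleSeed.gram_eq (hs : IsTriangleSeed s) (hac : IsAcyclic s.mat) {i j : Fin 3}
    (hij : i ≠ j) : planeForm (s.vec i) (s.vec j) = -|s.mat i j| := by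
  have hcompat := hs.1.compatMatrix planeForm_comm
  have hprod : planeForm (s.vec 1) (s.vec 2) * planeForm (s.vec 2) (s.vec 0) *
      planeForm (s.vec 0) (s.vec 1) ≤ 0 := by
    refine hcompat.2.2.2.2 fun h => (isAcyclic_iff hs.1.skew).1 hac ?_
    rcases h with ⟨h1, h2, h3⟩ | ⟨h1, h2, h3⟩
    · exact Or.inl ⟨h3, h1, h2⟩
    · exact Or.inr ⟨h3, h1, h2⟩
  obtain ⟨k, hik, hjk⟩ : ∃ k : Fin 3, i ≠ k ∧ j ≠ k := by
    clear * - hij; revert i j; decide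
  have hprod2 : planeForm (s.vec i) (s.vec j) * planeForm (s.vec j) (s.vec k) *
      planeForm (s.vec k) (s.vec i) ≤ 0 := by
    have c01 := planeForm_comm (s.vec 1) (s.vec 0)
    have c12 := planeForm_comm (s.vec 2) (s.vec 1)
    have c02 := planeForm_comm (s.vec 0) (s.vec 2)
    clear * - hij hik hjk hprod c01 c12 c02
    fin_cases i <;> fin_cases j <;> fin_cases k <;>
      first
      | exact absurd rfl hij
      | exact absurd rfl hik
      | exact absurd rfl hjk
      | (simp only [Fin.zero_eta, Fin.mk_one, Fin.reduceFinMk, c01, c12, c02] at hprod ⊢; linarith)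
  have h1 := hs.gram_relation hij hjk hik
  have h2 := hs.gram_relation hij.symm hik hjk
  rw [planeForm_comm (s.vec j)] at h1
  rw [planeForm_comm (s.vec k) (s.vec j)] at h2
  have hneg := nonpos_of_relations (hs.coeff_pos k) (hs.coeff_pos i) (hs.coeff_pos j)
    (by linarith) (by linarith) hprod2
  rw [← hs.1.realisation.abs_eq i j hij, abs_of_nonpos hneg, neg_neg]

end Triangle

/-! ### The skew form and the belt line of a triangle seed. -/

section Belt

variable {s : Seed AffineFun}

theorem skew_of_basis {V ι : Type*} [AddCommGroup V] [Module ℝ V] (b : Module.Basis ι ℝ V)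
    {ω : LinearMap.BilinForm ℝ V} (h : ∀ i j, ω (b i) (b j) = -ω (b j) (b i)) (f g : V) :
    ω f g = -ω g f := by
  have : ω = -LinearMap.flip ω := LinearMap.BilinForm.ext_basis b h
  conv_lhs => rw [this]
  rfl

/-- The skew form on affine functions which is described by the matrix of a seed. -/
noncomputable def IsSeed.skewForm (hs : IsSeed planeForm s) : LinearMap.BilinForm ℝ AffineFun :=
  Matrix.toBilin hs.basis s.mat

theorem IsSeed.skewForm_vec (hs : IsSeed planeForm s) (i j : Fin 3) :
    hs.skewForm (s.vec i) (s.vec j) = s.mat i j := by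
  have := LinearMap.BilinForm.toMatrix_apply hs.basis hs.skewForm i j
  rw [IsSeed.skewForm, LinearMap.BilinForm.toMatrix_toBilin, IsSeed.basis_apply,
    IsSeed.basis_apply] at this
  exact this.symm

theorem IsSeed.skewForm_skew (hs : IsSeed planeForm s) (f g : AffineFun) :
    hs.skewForm f g = -hs.skewForm g f := by
  refine skew_of_basis hs.basis (fun i j => ?_) f g
  rw [IsSeed.basis_apply, IsSeed.basis_apply, hs.skewForm_vec, hs.skewForm_vec]
  exact skew_apply hs.skew j i

/-- The belt data of a seed in the plane, where the tie-breaking point is `H`. -/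
noncomputable def IsSeed.beltData (hs : IsSeed planeForm s) (H : Plane) : BeltData AffineFun where
  Q := planeForm
  ω := hs.skewForm
  δ := (0, 1)
  ν := evalAt H
  symm := planeForm_comm
  skew := hs.skewForm_skew
  radical x := by simp [planeForm_apply]
  ν_δ := evalAt_const H

theorem IsSeed.beltData_isRadicalSpan (hs : IsSeed planeForm s) (H : Plane) :
    (hs.beltData H).IsRadicalSpan := fun f h => ⟨f.2, planeForm_radical h⟩

theorem IsAltitudeFoot.eval_self {i : Fin 3} {H : Plane} (h : IsAltitudeFoot s i H) :
    evalAt H (s.vec i) = 0 := h.choose_spec.2.1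

/-- At the opposite corner `f_i` equals `-1/m_i`, where `m_i` is the coefficient of `f_i`; the
gradient has square length 2, so the foot is reached after `1/(2 m_i)` times the gradient. -/
theorem IsTriangleSeed.eval_foot (hs : IsTriangleSeed s) {i j : Fin 3} {H : Plane}
    (h : IsAltitudeFoot s i H) (hij : i ≠ j) :
    evalAt H (s.vec j) = planeForm (s.vec i) (s.vec j) / (2 * hs.1.coeff i) := by
  obtain ⟨X, hX, hH, c, rfl⟩ := h
  have hX' : ∀ j, j ≠ i → evalAt X (s.vec j) = 0 := hX
  have hH' : evalAt (X + c • (s.vec i).1) (s.vec i) = 0 := hH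
  have hpos := hs.coeff_pos i
  obtain ⟨k, hik, hjk⟩ : ∃ k : Fin 3, i ≠ k ∧ j ≠ k := by
    clear * - hij; revert i j; decide
  have h1 := hs.1.sum_coeff_eval X
  rw [Fin.sum_three_cyclic _ hij hjk hik, hX' j hij.symm, hX' k hik.symm] at h1
  have h2 : inner ℝ (s.vec i).1 (s.vec i).1 = (2 : ℝ) := hs.1.realisation.self_eq_two i
  rw [evalAt_add, inner_smul_right, h2] at hH'
  have hc : c = 1 / (2 * hs.1.coeff i) := by
    field_simp
    linear_combination hs.1.coeff i * hH' - h1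
  rw [evalAt_add, hX' j hij.symm, inner_smul_right, hc, planeForm_apply, real_inner_comm]
  ring

theorem eventually_add_mul_neg_iff (a b : ℝ) :
    (∀ᶠ t : ℝ in atTop, a + t * -b < 0) ↔ 0 < b ∨ (b = 0 ∧ a < 0) := by
  constructor
  · intro h
    rcases lt_trichotomy b 0 with hb | rfl | hb
    · exfalso
      obtain ⟨t, h1, h2⟩ := (h.and (eventually_ge_atTop (-a / -b))).exists
      rw [div_le_iff₀ (by linarith)] at h2
      linarith
    · obtain ⟨t, ht⟩ := h.exists
      exact Or.inr ⟨rfl, by linarith⟩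
    · exact Or.inl hb
  · rintro (hb | ⟨rfl, ha⟩)
    · filter_upwards [eventually_gt_atTop (a / b)] with t ht
      rw [div_lt_iff₀ hb] at ht
      linarith
    · exact Eventually.of_forall fun t => by linarith

/-- The positive vectors are determined by the belt data; the initial seed is a belt seed. -/
theorem IsTriangleSeed.exists_beltData (hs : IsTriangleSeed s) (hac : IsAcyclic s.mat)
    {pos : Set AffineFun} (hpos : IsBeltPositivity s pos) :
    ∃ H, (hs.1.beltData H).pos = pos ∧ (hs.1.beltData H).IsBeltSeed s := by
  obtain ⟨i, k, Hi, Hk, hi, hk, hik0, hfi, hfk, rfl⟩ := hpos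
  have hskew := fun i j => skew_apply hs.1.skew i j
  have hdiag : ∀ i, s.mat i i = 0 := fun i => by have := hskew i i; linarith
  have hik : i ≠ k := by rintro rfl; rw [hdiag] at hik0; exact lt_irrefl _ hik0
  obtain ⟨j, hij, hkj⟩ : ∃ j : Fin 3, i ≠ j ∧ k ≠ j := by
    clear * - hik; revert i k; decide
  have hjk := hkj.symm
  set D := hs.1.beltData Hi with hD
  set mi := hs.1.coeff i with hmi
  set mj := hs.1.coeff j with hmj
  set mk := hs.1.coeff k with hmk
  have pi : 0 < mi := hs.coeff_pos i
  have pj : 0 < mj := hs.coeff_pos j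
  have pk : 0 < mk := hs.coeff_pos k
  have gij : planeForm (s.vec i) (s.vec j) = -s.mat i j := by
    rw [hs.gram_eq hac hij, abs_of_nonneg (hi j)]
  have gjk : planeForm (s.vec j) (s.vec k) = -s.mat j k := by
    rw [hs.gram_eq hac hjk, abs_of_nonneg (hk j)]
  have gik : planeForm (s.vec i) (s.vec k) = -s.mat i k := by
    rw [hs.gram_eq hac hik, abs_of_nonneg (hi k)]
  have hT : D.AcyclicTriple (s.vec i) (s.vec j) (s.vec k) (s.mat i j) (s.mat j k) (s.mat i k)
      mi mj mk := by
    refine ⟨hs.1.realisation.self_eq_two i, hs.1.realisation.self_eq_two j,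
      hs.1.realisation.self_eq_two k, gij, gjk, gik, hs.1.skewForm_vec i j, hs.1.skewForm_vec j k,
      hs.1.skewForm_vec i k, hi j, hk j, hi k, pi, pj, pk, ?_, ?_⟩
    · have := hs.1.sum_coeff
      rwa [Fin.sum_three_cyclic _ hij hjk hik] at this
    · change _ * evalAt Hi _ - _ * evalAt Hi _ + _ * evalAt Hi _ = 0
      rw [hfi.eval_self, hs.eval_foot hfi hij, hs.eval_foot hfi hik, gij, gik]
      ring
  -- The slope and the derivative along `Hk - Hi` are proportional, as a comparison on the three
  -- basis vectors shows; the constant is read off at the source, where the slope is `2 mi`.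
  have hslope : ∀ f, D.slope f * (s.mat i k / (4 * mi * mk)) = -inner ℝ f.1 (Hk - Hi) := by
    set φ : AffineFun →ₗ[ℝ] ℝ := (s.mat i k / (4 * mi * mk)) • D.ω D.δ - (evalAt Hi - evalAt Hk)
    have hφ : φ = 0 := by
      refine hs.1.basis.ext fun l => ?_
      rw [IsSeed.basis_apply]
      change s.mat i k / (4 * mi * mk) * D.slope (s.vec l) -
        (evalAt Hi (s.vec l) - evalAt Hk (s.vec l)) = 0
      have : l = i ∨ l = j ∨ l = k := by clear * - hij hjk hik; revert i j k l; decide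
      rcases this with rfl | rfl | rfl
      · rw [hT.slope_x, hfi.eval_self, hs.eval_foot hfk hik.symm, planeForm_comm, gik, ← hmk]
        field_simp
        ring
      · rw [hT.slope_y, hs.eval_foot hfi hij, hs.eval_foot hfk hkj, planeForm_comm (s.vec k), gij,
          gjk, ← hmi, ← hmk]
        have e1 := hT.eq_a
        have e2 := hT.eq_c
        field_simp
        linear_combination (-2 * s.mat l k) * e1 + 2 * s.mat i l * e2
      · rw [hT.slope_z, hfk.eval_self, hs.eval_foot hfi hik, gik, ← hmi]
        field_simp
        ring
    intro f
    have h1 : s.mat i k / (4 * mi * mk) * D.slope f - (evalAt Hi f - evalAt Hk f) = 0 :=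
      congrArg (fun φ => φ f) hφ
    have h2 := evalAt_add Hi (Hk - Hi) f
    rw [add_sub_cancel] at h2
    linarith
  refine ⟨Hi, ?_, fun a b => (hs.1.skewForm_vec a b).symm, i, j, k, hij, hjk, hik,
    hT.isBeltTriple⟩
  ext f
  have hκ : 0 < s.mat i k / (4 * mi * mk) := by positivity
  have e : ∀ t : ℝ, AffineFun.eval f (Hi + t • (Hk - Hi)) =
      D.ν f + t * -(D.slope f * (s.mat i k / (4 * mi * mk))) := by
    intro t
    rw [hslope, neg_neg, ← inner_smul_right]
    exact evalAt_add _ _ _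
  rw [Set.mem_ofPred_eq]
  simp only [e]
  rw [eventually_add_mul_neg_iff]
  change 0 < D.slope f ∨ (D.slope f = 0 ∧ D.ν f < 0) ↔ _
  rw [mul_pos_iff_of_pos_right hκ, mul_eq_zero, or_iff_left hκ.ne']

end Belt



/-! ### The translation lattice -/

section Lattice

variable {s : Seed AffineFun} {H : Plane}

theorem span_vec_of_mem_labelledSeeds (hs : IsSeed planeForm s) {pos : Set AffineFun}
    {t : Seed AffineFun} (ht : t ∈ labelledSeeds planeForm pos s) :
    Submodule.span ℝ (Set.range t.vec) = ⊤ := by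
  obtain ⟨m, hm⟩ := ReachedIn.of_mem_labelledSeeds ht
  refine (((hs.basis).is_basis_iff_det (v := t.vec)).2 ?_).2
  rcases hm.det hs with h | h <;> rw [h] <;> simp

theorem shiftSeed_eq_translateSeed (hs : IsSeed planeForm s) {e : Plane}
    (he : ∀ f, (hs.beltData H).slope f = inner ℝ f.1 e) (τ : ℝ) (t : Seed AffineFun) :
    shiftSeed ((hs.beltData H).shift τ) t = translateSeed (τ • e) t := by
  ext1
  · funext i
    simp only [shiftSeed, translateSeed]
    rw [BeltData.shift_apply, he, inner_smul_right]
    change _ + _ • ((0, 1) : AffineFun) = _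
    ext1
    · simp
    · simp; ring
  · rfl

/-- Vertices that differ by the translation by `w` are belt seeds with the same matrix, so `w = τ •
e` is parallel to the belt line. Its length is `|τ| ‖e‖`, and the sign of `τ` does not matter in a
group. -/
theorem translationLattice_eq_map (hs : IsSeed planeForm s) (hb : (hs.beltData H).IsBeltSeed s)
    {e : Plane} (he : ∀ f, (hs.beltData H).slope f = inner ℝ f.1 e) :
    translationLattice (hs.beltData H).pos s =
      (hb.translations (hs.beltData_isRadicalSpan H)).map (LinearMap.mulLeft ℤ ‖e‖) := by
  set D := hs.beltData H
  have hD : D.IsRadicalSpan := hs.beltData_isRadicalSpan H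
  refine le_antisymm (Submodule.span_le.2 ?_) ?_
  · rintro _ ⟨w, t, ht, htw, rfl⟩
    have hbt := hb.of_mem_exchangeVertices ht
    have hbt' := hb.of_mem_exchangeVertices htw
    obtain ⟨τ, hτ, hslope⟩ := hbt.eq_shiftSeed hbt' (c := fun i => -inner ℝ (t.vec i).1 w) rfl
      (fun i => by
        change _ = _ + _ • ((0, 1) : AffineFun)
        ext1
        · simp [translateSeed]
        · simp [translateSeed]; ring)
    have hw : w = τ • e := by
      obtain ⟨u, hu, hut⟩ := mem_exchangeVertices.1 ht
      obtain ⟨σ, rfl⟩ := unlabelled_eq_iff.1 hut.symm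
      have h0 : ∀ i, inner ℝ (u.vec i).1 (w - τ • e) = (0 : ℝ) := by
        intro i
        have := hslope (σ⁻¹ i)
        simp only [relabel, Function.comp_apply] at this
        rw [he, show σ (σ⁻¹ i) = i from σ.apply_symm_apply i] at this
        rw [inner_sub_right, inner_smul_right]
        linarith
      have h1 : ∀ f : AffineFun, inner ℝ f.1 (w - τ • e) = (0 : ℝ) := by
        set φ : AffineFun →ₗ[ℝ] ℝ := (innerₗ Plane).flip (w - τ • e) ∘ₗ LinearMap.fst ℝ Plane ℝ
        have : φ = 0 := by
          refine LinearMap.ext_on (span_vec_of_mem_labelledSeeds hs hu) ?_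
          rintro _ ⟨i, rfl⟩
          exact h0 i
        exact fun f => congrArg (fun φ => φ f) this
      have := h1 (w - τ • e, 0)
      rw [inner_self_eq_zero, sub_eq_zero] at this
      exact this
    have hmem : τ ∈ hb.translations hD := fun y hy =>
      hb.translate_mem hD ht hy (by rw [BeltData.translate_unlabelled, ← hτ]; exact htw)
    rw [hw, norm_smul, Real.norm_eq_abs]
    rcases abs_choice τ with h | h <;> rw [h]
    · exact ⟨τ, hmem, mul_comm _ _⟩
    · exact ⟨-τ, neg_mem hmem, mul_comm _ _⟩
  · rintro _ ⟨τ, hτ, rfl⟩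
    have hs0 := mem_exchangeVertices.2 ⟨s, mem_labelledSeeds_self D.Q D.pos s, rfl⟩
    have h1 : ‖τ • e‖ ∈ translationLattice D.pos s :=
      Submodule.subset_span ⟨τ • e, s, hs0, by
        rw [← shiftSeed_eq_translateSeed hs he]; exact hτ _ hs0, rfl⟩
    rw [norm_smul, Real.norm_eq_abs] at h1
    change ‖e‖ * τ ∈ _
    rw [mul_comm]
    rcases abs_choice τ with h | h <;> rw [h] at h1
    · exact h1
    · rw [neg_mul] at h1; exact neg_mem_iff.1 h1

theorem exists_slope_gradient (hs : IsSeed planeForm s) (hb : (hs.beltData H).IsBeltSeed s) :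
    ∃ e : Plane, e ≠ 0 ∧ ∀ f, (hs.beltData H).slope f = inner ℝ f.1 e := by
  obtain ⟨e, he⟩ := exists_gradient (hs.skewForm (0, 1)) ((hs.beltData H).ω_self (0, 1))
  refine ⟨e, ?_, he⟩
  rintro rfl
  obtain ⟨l, hl⟩ := hb.exists_slope_ne_zero
  exact hl ((he _).trans (inner_zero_right _))

theorem nonempty_translations_equiv (hs : IsSeed planeForm s) (hb : (hs.beltData H).IsBeltSeed s) :
    Nonempty (hb.translations (hs.beltData_isRadicalSpan H) ≃ₗ[ℤ]
      translationLattice (hs.beltData H).pos s) := by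
  obtain ⟨e, he0, he⟩ := exists_slope_gradient hs hb
  rw [translationLattice_eq_map hs hb he]
  exact ⟨Submodule.equivMapOfInjective _
    (fun x y h => mul_left_cancel₀ (norm_ne_zero_iff.2 he0) h) _⟩

theorem markovMatrix_skew : markovMatrix.transpose = -markovMatrix := by
  ext i j
  fin_cases i <;> fin_cases j <;> simp [markovMatrix]

theorem not_isAcyclic_markovMatrix : ¬ IsAcyclic markovMatrix := by
  rw [isAcyclic_iff markovMatrix_skew]
  simp [markovMatrix]

theorem not_isAcyclic_neg_markovMatrix : ¬ IsAcyclic (-markovMatrix) := by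
  rw [isAcyclic_iff (by rw [Matrix.transpose_neg, markovMatrix_skew])]
  simp [markovMatrix]

/-- The growth rate of the exchange graph of an acyclic triangle is the rank of the translation
lattice. -/
theorem IsTriangleSeed.growth (hs : IsTriangleSeed s) (hac : IsAcyclic s.mat)
    (hfin : IsMutationFinite s.mat) {pos : Set AffineFun} (hpos : IsBeltPositivity s pos)
    (x : exchangeVertices planeForm pos s) :
    HasPolynomialGrowth (exchangeGraph planeForm pos s) x ∧
      Module.Finite ℤ (translationLattice pos s) ∧
      IsGrowthRate (exchangeGraph planeForm pos s) x
        (Module.finrank ℤ (translationLattice pos s)) := by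
  have hm : s.mat ≠ markovMatrix := fun h => not_isAcyclic_markovMatrix (h ▸ hac)
  have hm' : s.mat ≠ -markovMatrix := fun h => not_isAcyclic_neg_markovMatrix (h ▸ hac)
  have hpoly := hs.1.hasPolynomialGrowth planeForm_comm hfin hm hm' pos
  refine ⟨hpoly x, ?_⟩
  obtain ⟨H, rfl, hb⟩ := hs.exists_beltData hac hpos
  obtain ⟨E⟩ := nonempty_translations_equiv hs.1 hb
  have hact := hb.isFreeCocompactAction hs.1 hfin hs.isConnectedTriple hm hm'
    (hs.1.beltData_isRadicalSpan H)
  have hconn := exchangeGraph_connected planeForm (hs.1.beltData H).pos s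
  have hΛ := hact.finite hconn fun x => (hpoly x).1 1
  refine ⟨Module.Finite.equiv E, ?_⟩
  rw [← E.finrank_eq]
  exact hact.isGrowthRate hconn (fun x m => (hpoly x).1 m) x

end Lattice



/-! ### Independence of the values of the squared cosecant -/

section Cosecant

/-- The squared cosecant of `π x / N`. -/
noncomputable def cosecSq (N : ℕ) (x : ZMod N) : ℝ := 1 / Real.sin (Real.pi * x.val / N) ^ 2

theorem cosecSq_nonneg {N : ℕ} (x : ZMod N) : 0 ≤ cosecSq N x := by
  unfold cosecSq; positivity

/-- The right-hand side, made for telescoping, equals `1 / (sin (x - h) sin (x + h))`, and its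
denominator is `sin² x - sin² h`. -/
theorem one_div_sin_sq_le {x h : ℝ} (h0 : 0 < h) (h1 : 0 < x - h) (h2 : x + h < Real.pi) :
    1 / Real.sin x ^ 2 ≤ (Real.cot (x - h) - Real.cot (x + h)) / Real.sin (2 * h) := by
  have p1 : 0 < Real.sin (x - h) := Real.sin_pos_of_pos_of_lt_pi h1 (by linarith)
  have p2 : 0 < Real.sin (x + h) := Real.sin_pos_of_pos_of_lt_pi (by linarith) h2
  have p3 : 0 < Real.sin (2 * h) := Real.sin_pos_of_pos_of_lt_pi (by linarith) (by linarith)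
  have e1 : Real.sin (2 * h) = Real.sin (x + h) * Real.cos (x - h) -
      Real.cos (x + h) * Real.sin (x - h) := by
    rw [← Real.sin_sub]; congr 1; ring
  have e2 : Real.sin (x - h) * Real.sin (x + h) = Real.sin x ^ 2 - Real.sin h ^ 2 := by
    rw [Real.sin_sub, Real.sin_add]
    have := Real.sin_sq_add_cos_sq x
    have := Real.sin_sq_add_cos_sq h
    linear_combination Real.sin x ^ 2 * Real.sin_sq_add_cos_sq h -
      Real.sin h ^ 2 * Real.sin_sq_add_cos_sq x
  have e3 : (Real.cot (x - h) - Real.cot (x + h)) / Real.sin (2 * h) =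
      1 / (Real.sin (x - h) * Real.sin (x + h)) := by
    rw [Real.cot_eq_cos_div_sin, Real.cot_eq_cos_div_sin, div_sub_div _ _ p1.ne' p2.ne', div_div,
      div_eq_div_iff (by positivity) (by positivity), e1]
    ring
  rw [e3]
  refine one_div_le_one_div_of_le (by positivity) ?_
  rw [e2]
  linarith [sq_nonneg (Real.sin h)]

/-- The values at the points next to the pole dominate the sum of the others. -/
theorem sum_one_div_sin_sq_lt {N : ℕ} (hN : 3 ≤ N) :
    ∑ j ∈ Finset.Ico 2 (N - 1), 1 / Real.sin (Real.pi * j / N) ^ 2 <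
      2 / Real.sin (Real.pi / N) ^ 2 := by
  set h : ℝ := Real.pi / (2 * N) with hh
  have hN' : (3 : ℝ) ≤ N := by exact_mod_cast hN
  have hNpos : (0 : ℝ) < N := by linarith
  have hπ := Real.pi_pos
  have h0 : 0 < h := by positivity
  have hNh : 2 * N * h = Real.pi := by rw [hh]; field_simp
  have h3 : 3 * h ≤ Real.pi / 2 := by nlinarith
  -- Since `π j / N = 2 j h`, the bounds `cot ((2j - 1) h) - cot ((2j + 1) h)` telescope.
  have hsum : ∀ m, 2 ≤ m → m + 1 ≤ N → ∑ j ∈ Finset.Ico 2 m, 1 / Real.sin (Real.pi * j / N) ^ 2 ≤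
      (Real.cot (3 * h) - Real.cot ((2 * m - 1) * h)) / Real.sin (2 * h) := by
    intro m hm
    induction m, hm using Nat.le_induction with
    | base => intro _; rw [Finset.Ico_self, Finset.sum_empty]; norm_num
    | succ m hm ih =>
      intro hmN
      have hm' : (2 : ℝ) ≤ m := by exact_mod_cast hm
      have hmN' : (m : ℝ) + 1 + 1 ≤ N := by exact_mod_cast hmN
      have e : Real.pi * m / N = 2 * m * h := by rw [hh]; field_simp
      have step := one_div_sin_sq_le (x := 2 * m * h) h0 (by nlinarith) (by nlinarith)
      rw [Finset.sum_Ico_succ_top hm, e]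
      refine (add_le_add (ih (by omega)) step).trans (le_of_eq ?_)
      rw [← add_div]
      push_cast
      rw [show 2 * (m : ℝ) * h - h = (2 * m - 1) * h by ring,
        show 2 * (m : ℝ) * h + h = (2 * (m + 1) - 1) * h by ring]
      ring
  have p2 : 0 < Real.sin (2 * h) := Real.sin_pos_of_pos_of_lt_pi (by linarith) (by linarith)
  have p3 : 0 < Real.sin (3 * h) := Real.sin_pos_of_pos_of_lt_pi (by linarith) (by linarith)
  refine (hsum (N - 1) (by omega) (by omega)).trans_lt ?_
  have hcast : ((N - 1 : ℕ) : ℝ) = N - 1 := by rw [Nat.cast_sub (by omega)]; norm_num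
  have e1 : (2 * ((N - 1 : ℕ) : ℝ) - 1) * h = Real.pi - 3 * h := by rw [hcast, ← hNh]; ring
  have e2 : Real.pi / N = 2 * h := by rw [hh]; field_simp
  rw [e1, e2, Real.cot_eq_cos_div_sin, Real.cot_eq_cos_div_sin, Real.sin_pi_sub, Real.cos_pi_sub]
  -- The sum is at most `2 cot (3h) / sin (2h)`, so what remains is `cot (3h) sin (2h) < 1`.
  have key : Real.cos (3 * h) * Real.sin (2 * h) < Real.sin (3 * h) := by
    have c1 : Real.cos (3 * h) ≤ Real.cos h :=
      Real.cos_le_cos_of_nonneg_of_le_pi h0.le (by linarith) (by linarith)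
    have c2 : 0 < Real.cos (2 * h) := Real.cos_pos_of_mem_Ioo ⟨by linarith, by linarith⟩
    have c3 : 0 < Real.sin h := Real.sin_pos_of_pos_of_lt_pi h0 (by linarith)
    have e3 : Real.sin (3 * h) = Real.sin (2 * h) * Real.cos h + Real.cos (2 * h) * Real.sin h := by
      rw [← Real.sin_add]; congr 1; ring
    rw [e3]
    have := mul_le_mul_of_nonneg_right c1 p2.le
    have := mul_pos c2 c3
    linarith
  have e4 : (Real.cos (3 * h) / Real.sin (3 * h) - -Real.cos (3 * h) / Real.sin (3 * h)) /
      Real.sin (2 * h) = 2 * (Real.cos (3 * h) * Real.sin (2 * h)) /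
        (Real.sin (3 * h) * Real.sin (2 * h) ^ 2) := by
    field_simp; ring
  rw [e4, div_lt_div_iff₀ (by positivity) (by positivity)]
  have := pow_pos p2 2
  nlinarith

variable {N : ℕ} [NeZero N]

theorem cosecSq_neg (x : ZMod N) : cosecSq N (-x) = cosecSq N x := by
  by_cases hx : x = 0
  · rw [hx, neg_zero]
  have : NeZero x := ⟨hx⟩
  unfold cosecSq
  rw [ZMod.val_neg_of_ne_zero, Nat.cast_sub x.val_lt.le]
  have hN : (N : ℝ) ≠ 0 := Nat.cast_ne_zero.2 (NeZero.ne N)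
  rw [show Real.pi * ((N : ℝ) - x.val) / N = Real.pi - Real.pi * x.val / N by field_simp,
    Real.sin_pi_sub]

theorem sum_cosecSq_lt (hN : 3 ≤ N) :
    ∑ x ∈ (Finset.univ.filter fun x : ZMod N => x ≠ 0 ∧ x ≠ 1 ∧ x ≠ -1), cosecSq N x <
      2 * cosecSq N 1 := by
  have : Fact (1 < N) := ⟨by omega⟩
  have e1 : 2 * cosecSq N 1 = 2 / Real.sin (Real.pi / N) ^ 2 := by
    rw [cosecSq, ZMod.val_one, Nat.cast_one, mul_one, mul_one_div]
  rw [e1]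
  refine lt_of_le_of_lt ?_ (sum_one_div_sin_sq_lt hN)
  have hinj := ZMod.val_injective N
  have e2 : ∑ x ∈ (Finset.univ.filter fun x : ZMod N => x ≠ 0 ∧ x ≠ 1 ∧ x ≠ -1), cosecSq N x =
      ∑ j ∈ (Finset.univ.filter fun x : ZMod N => x ≠ 0 ∧ x ≠ 1 ∧ x ≠ -1).image ZMod.val,
        1 / Real.sin (Real.pi * j / N) ^ 2 := by
    rw [Finset.sum_image fun x _ y _ h => hinj h]
    rfl
  rw [e2]
  refine Finset.sum_le_sum_of_subset_of_nonneg ?_ fun _ _ _ => by positivity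
  intro j hj
  obtain ⟨x, hx, rfl⟩ := Finset.mem_image.1 hj
  obtain ⟨-, h0, h1, h2⟩ := Finset.mem_filter.1 hx
  have hv0 : x.val ≠ 0 := fun h => h0 ((ZMod.val_eq_zero x).1 h)
  have hv1 : x.val ≠ 1 := fun h => h1 (hinj (h.trans (ZMod.val_one N).symm))
  have hv2 : x.val ≠ N - 1 := by
    intro h
    have e : (-1 : ZMod N).val = N - 1 := by
      have : NeZero (1 : ZMod N) := ⟨one_ne_zero⟩
      rw [ZMod.val_neg_of_ne_zero, ZMod.val_one]
    exact h2 (hinj (h.trans e.symm))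
  have := x.val_lt
  rw [Finset.mem_Ico]
  omega

/-- A polynomial whose values at `N`-th roots of unity are squared cosecants. -/
noncomputable def cosecPoly (N : ℕ) : Polynomial ℤ :=
  -4 * Polynomial.X * (∑ j ∈ Finset.range N, (j : Polynomial ℤ) * Polynomial.X ^ j) ^ 2

theorem sum_mul_pow_of_pow_eq_one {w : ℂ} (n : ℕ) (hw : w ^ n = 1) :
    (w - 1) * ∑ j ∈ Finset.range n, (j : ℂ) * w ^ j = n - ∑ j ∈ Finset.range n, w ^ j := by
  have key : ∀ m : ℕ, (w - 1) * ∑ j ∈ Finset.range m, (j : ℂ) * w ^ j =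
      m * w ^ m - w * ∑ j ∈ Finset.range m, w ^ j := by
    intro m
    induction m with
    | zero => simp
    | succ m ih =>
      rw [Finset.sum_range_succ, Finset.sum_range_succ, mul_add, ih]
      push_cast; ring
  have h2 : w * ∑ j ∈ Finset.range n, w ^ j = ∑ j ∈ Finset.range n, w ^ j := by
    have := geom_sum_mul w n
    rw [hw, sub_self] at this
    linear_combination this
  rw [key, hw, mul_one, h2]

/-- For a root of unity `w ≠ 1` the inner sum is `N / (w - 1)`; with `w = e^{2iθ}` the quotient `-4w
/ (w - 1)²` is `1 / sin² θ`. -/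
theorem aeval_cosecPoly {w : ℂ} (hw : w ^ N = 1) (hw1 : w ≠ 1) :
    Polynomial.aeval w (cosecPoly N) * (w - 1) ^ 2 = -4 * w * N ^ 2 := by
  have h1 := sum_mul_pow_of_pow_eq_one N hw
  have h2 : ∑ j ∈ Finset.range N, w ^ j = 0 := by
    have := geom_sum_mul w N
    rw [hw, sub_self] at this
    exact (mul_eq_zero.1 this).resolve_right (sub_ne_zero.2 hw1)
  rw [h2, sub_zero] at h1
  simp only [cosecPoly, map_mul, map_neg, map_pow, map_sum, Polynomial.aeval_X, map_natCast,
    map_ofNat]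
  rw [← h1]
  ring

theorem exp_pow_eq (k : ℕ) : Complex.exp (2 * Real.pi * Complex.I / N) ^ k =
    Complex.exp ((Real.pi * k / N : ℝ) * Complex.I) ^ 2 := by
  rw [← Complex.exp_nat_mul, ← Complex.exp_nat_mul]
  congr 1
  push_cast
  ring

theorem aeval_cosecPoly_eq (x : ZMod N) (hx : x ≠ 0) :
    Polynomial.aeval (Complex.exp (2 * Real.pi * Complex.I / N) ^ x.val) (cosecPoly N) =
      ((N ^ 2 * cosecSq N x : ℝ) : ℂ) := by
  have hζ := Complex.isPrimitiveRoot_exp N (NeZero.ne N)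
  set ζ := Complex.exp (2 * Real.pi * Complex.I / N) with hζdef
  have hv : ¬ N ∣ x.val := fun h => hx ((ZMod.val_eq_zero x).1 (Nat.eq_zero_of_dvd_of_lt h x.val_lt))
  have h1 : ζ ^ x.val ≠ 1 := fun h => hv (hζ.dvd_of_pow_eq_one _ h)
  have h2 : (ζ ^ x.val) ^ N = 1 := by rw [← pow_mul, mul_comm, pow_mul, hζ.pow_eq_one, one_pow]
  have h3 := aeval_cosecPoly h2 h1
  set θ : ℝ := Real.pi * x.val / N with hθ
  set u := Complex.exp (θ * Complex.I) with hu
  have h4 : ζ ^ x.val = u ^ 2 := exp_pow_eq x.val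
  have hu0 : u ≠ 0 := Complex.exp_ne_zero _
  have h5 : (u ^ 2 - 1) ^ 2 = -4 * u ^ 2 * (Real.sin θ : ℂ) ^ 2 := by
    have e : u = Complex.cos θ + Complex.sin θ * Complex.I := Complex.exp_mul_I _
    have hI := Complex.I_sq
    have hcs := Complex.sin_sq_add_cos_sq (θ : ℂ)
    have e2 : u ^ 2 - 1 = 2 * Complex.I * Complex.sin θ * u := by
      rw [e]
      linear_combination (-Complex.sin θ ^ 2) * hI + hcs
    rw [e2, Complex.ofReal_sin]
    linear_combination 4 * Complex.sin θ ^ 2 * u ^ 2 * hI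
  have h6 : (Real.sin θ : ℂ) ≠ 0 := by
    intro h0
    rw [h0] at h5
    rw [h4] at h1
    have : (u ^ 2 - 1) ^ 2 = 0 := by rw [h5]; ring
    exact h1 (sub_eq_zero.1 (pow_eq_zero_iff two_ne_zero |>.1 this))
  rw [h4] at h3 ⊢
  rw [h5] at h3
  rw [cosecSq, ← hθ]
  push_cast
  rw [mul_one_div, eq_div_iff (pow_ne_zero 2 (by exact_mod_cast h6))]
  refine mul_left_cancel₀ (mul_ne_zero (show (-4 : ℂ) ≠ 0 by norm_num) (pow_ne_zero 2 hu0)) ?_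
  rw [Complex.ofReal_sin] at h3
  linear_combination h3

/-- Galois conjugation of integral relations between squared cosecants. -/
theorem sum_cosecSq_mul_unit {q : ZMod N → ℤ} (h0 : q 0 = 0)
    (hq : ∑ x, q x * cosecSq N x = 0) (u : (ZMod N)ˣ) : ∑ x, q x * cosecSq N (u * x) = 0 := by
  have hζ := Complex.isPrimitiveRoot_exp N (NeZero.ne N)
  set ζ := Complex.exp (2 * Real.pi * Complex.I / N) with hζdef
  -- `R` takes at `ζ ^ u` the value `N²` times the relation with arguments multiplied by `u`. It
  -- vanishes at `ζ`, hence at all primitive `N`-th roots of unity, which share a minimal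
  -- polynomial.
  set R : Polynomial ℤ := ∑ x : ZMod N, Polynomial.C (q x) *
    (cosecPoly N).comp (Polynomial.X ^ x.val)
  have hNpos := Nat.pos_of_ne_zero (NeZero.ne N)
  have heval : ∀ u : (ZMod N)ˣ, Polynomial.aeval (ζ ^ (u : ZMod N).val) R =
      ((N ^ 2 * ∑ x, q x * cosecSq N (u * x) : ℝ) : ℂ) := by
    intro u
    simp only [R, map_sum, map_mul, Polynomial.aeval_comp, Finset.mul_sum, Complex.ofReal_sum]
    refine Finset.sum_congr rfl fun x _ => ?_
    -- At the pole `cosecSq` has the default value `1 / 0 = 0`, which the polynomial does not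
    -- reproduce; `q 0 = 0` removes this term.
    by_cases hx : x = 0
    · subst hx; simp [h0]
    have hux : (u : ZMod N) * x ≠ 0 := by simpa using hx
    have e : (ζ ^ (u : ZMod N).val) ^ x.val = ζ ^ ((u : ZMod N) * x).val := by
      rw [← pow_mul, ZMod.val_mul, ← pow_mod_orderOf, ← hζ.eq_orderOf]
    rw [map_pow, Polynomial.aeval_X, e, aeval_cosecPoly_eq _ hux]
    simp only [eq_intCast, map_intCast]
    push_cast
    ring
  have hR : Polynomial.aeval ζ R = 0 := by
    have := heval 1
    simp only [Units.val_one, one_mul, hq, mul_zero, Complex.ofReal_zero] at this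
    by_cases h1 : N = 1
    · subst h1
      have e : ζ = 1 := by simpa using hζ.pow_eq_one
      rwa [e, one_pow, ← e] at this
    · have : Fact (1 < N) := ⟨by omega⟩
      rwa [ZMod.val_one, pow_one] at *
  have hdvd : minpoly ℤ ζ ∣ R := minpoly.isIntegrallyClosed_dvd (hζ.isIntegral hNpos) hR
  rw [hζ.minpoly_eq_pow_coprime (ZMod.val_coe_unit_coprime u)] at hdvd
  obtain ⟨S, hS⟩ := hdvd
  have h2 := heval u
  rw [hS, map_mul, minpoly.aeval, zero_mul] at h2
  have h3 : (N ^ 2 * ∑ x, q x * cosecSq N (u * x) : ℝ) = 0 := by exact_mod_cast h2.symm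
  exact (mul_eq_zero.1 h3).resolve_left (by have := NeZero.ne N; positivity)

/-- An even integral relation between squared cosecants of units is trivial. -/
theorem eq_zero_of_sum_cosecSq (hN : 3 ≤ N) {q : ZMod N → ℤ} (hodd : (2 : ZMod N) ≠ 0)
    (heven : ∀ x, q (-x) = q x) (hunit : ∀ x, ¬ IsUnit x → q x = 0)
    (hq : ∑ x, q x * cosecSq N x = 0) : q = 0 := by
  have : Fact (1 < N) := ⟨by omega⟩
  -- A coefficient of largest absolute value is moved to `±1` by conjugation. There it contributes
  -- `2 q cosecSq N 1`, more than all other terms can cancel.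
  obtain ⟨x₀, -, hmax⟩ := Finset.exists_max_image Finset.univ (fun x => |q x|) ⟨0, Finset.mem_univ _⟩
  by_cases hx₀ : q x₀ = 0
  · funext x
    have := hmax x (Finset.mem_univ _)
    rw [hx₀, abs_zero] at this
    exact abs_nonpos_iff.1 this
  exfalso
  obtain ⟨u, rfl⟩ : IsUnit x₀ := by
    by_contra hcon; exact hx₀ (hunit _ hcon)
  have h0 : q 0 = 0 := hunit 0 not_isUnit_zero
  have h1 := sum_cosecSq_mul_unit h0 hq u⁻¹
  have h2 : ∑ y : ZMod N, (q (u * y) : ℝ) * cosecSq N y = 0 := by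
    rw [← h1]
    refine (Equiv.sum_comp (Units.mulLeft u⁻¹) _).symm.trans ?_
    refine Finset.sum_congr rfl fun x _ => ?_
    simp
  have hne : (1 : ZMod N) ≠ -1 := by
    intro h
    have : (1 : ZMod N) + 1 = 0 := by nth_rw 1 [h]; ring
    exact hodd (by rw [← this]; norm_num)
  have hsplit := Finset.sum_filter_add_sum_filter_not (Finset.univ : Finset (ZMod N))
    (fun x => x ≠ 0 ∧ x ≠ 1 ∧ x ≠ -1) (fun y => (q (u * y) : ℝ) * cosecSq N y)
  have hnot : (Finset.univ.filter fun x : ZMod N => ¬ (x ≠ 0 ∧ x ≠ 1 ∧ x ≠ -1)) = {0, 1, -1} := by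
    ext x; simp; tauto
  have h01 : (0 : ZMod N) ∉ ({1, -1} : Finset (ZMod N)) := by
    simp only [Finset.mem_insert, Finset.mem_singleton, not_or]
    exact ⟨zero_ne_one, fun h => one_ne_zero (neg_eq_zero.1 h.symm)⟩
  rw [hnot, h2, Finset.sum_insert h01, Finset.sum_pair hne, mul_zero, h0, mul_one, mul_neg_one,
    heven, cosecSq_neg] at hsplit
  set S := ∑ x ∈ Finset.univ.filter fun x : ZMod N => x ≠ 0 ∧ x ≠ 1 ∧ x ≠ -1,
    (q (u * x) : ℝ) * cosecSq N x
  have hS : |S| ≤ |(q u : ℝ)| *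
      ∑ x ∈ (Finset.univ.filter fun x : ZMod N => x ≠ 0 ∧ x ≠ 1 ∧ x ≠ -1), cosecSq N x := by
    refine (Finset.abs_sum_le_sum_abs _ _).trans ?_
    rw [Finset.mul_sum]
    refine Finset.sum_le_sum fun x _ => ?_
    rw [abs_mul, abs_of_nonneg (cosecSq_nonneg x)]
    refine mul_le_mul_of_nonneg_right ?_ (cosecSq_nonneg x)
    exact_mod_cast hmax (u * x) (Finset.mem_univ _)
  have hq0 : 0 < |(q u : ℝ)| := abs_pos.2 (by exact_mod_cast hx₀)
  have h3 := mul_lt_mul_of_pos_left (sum_cosecSq_lt hN) hq0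
  have h4 : S = -(2 * (q u * cosecSq N 1)) := by
    push_cast at hsplit; linarith
  rw [h4, abs_neg, abs_mul, abs_mul, abs_two, abs_of_nonneg (cosecSq_nonneg 1)] at hS
  linarith

end Cosecant



/-! ### Ranks of groups of real numbers -/

theorem ZMod.two_ne_zero_of_three_le {N : ℕ} (hN : 3 ≤ N) : (2 : ZMod N) ≠ 0 := by
  intro h
  have := (ZMod.natCast_eq_zero_iff 2 N).1 (by exact_mod_cast h)
  have := Nat.le_of_dvd two_pos this
  omega

section Independence

variable {N : ℕ} [NeZero N]

/-- Representatives of the units up to sign. -/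
def halfUnits (N : ℕ) [NeZero N] : Set (ZMod N) := {x | IsUnit x ∧ 2 * x.val < N}

theorem neg_mem_halfUnits_iff (hN : Odd N) (h3 : 3 ≤ N) {x : ZMod N} (hx : IsUnit x) :
    -x ∈ halfUnits N ↔ x ∉ halfUnits N := by
  have : Fact (1 < N) := ⟨by omega⟩
  have : NeZero x := ⟨hx.ne_zero⟩
  have hv := x.val_lt
  have hne : x.val ≠ 0 := fun h => hx.ne_zero ((ZMod.val_eq_zero x).1 h)
  simp only [halfUnits, Set.mem_ofPred_eq, IsUnit.neg_iff, hx, true_and, ZMod.val_neg_of_ne_zero]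
  obtain ⟨m, rfl⟩ := hN
  omega

theorem linearIndependent_cosecSq (hN : Odd N) (h3 : 3 ≤ N) :
    LinearIndependent ℤ fun x : halfUnits N => cosecSq N x := by
  classical
  rw [Fintype.linearIndependent_iff]
  intro g hg
  set g' : ZMod N → ℤ := fun x => if h : x ∈ halfUnits N then g ⟨x, h⟩ else 0 with hg'def
  have hg' : ∑ x, (g' x : ℝ) * cosecSq N x = 0 := by
    have h1 := Finset.sum_subtype (Finset.univ.filter (· ∈ halfUnits N)) (p := (· ∈ halfUnits N))
      (F := inferInstance) (by simp) (fun x => (g' x : ℝ) * cosecSq N x)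
    have h2 : ∑ x : halfUnits N, (g' x : ℝ) * cosecSq N x = 0 := by
      rw [← hg]
      refine Finset.sum_congr rfl fun x _ => ?_
      rw [zsmul_eq_mul, hg'def]
      simp
    rw [← h2]
    refine Eq.trans ?_ h1
    refine (Finset.sum_subset (Finset.subset_univ _) fun x _ hx => ?_).symm
    have : x ∉ halfUnits N := by simpa using hx
    simp [hg'def, this]
  have hg'' : ∑ x, (g' (-x) : ℝ) * cosecSq N x = 0 := by
    rw [← hg', ← Equiv.sum_comp (Equiv.neg (ZMod N))]
    refine Finset.sum_congr rfl fun x _ => ?_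
    simp [cosecSq_neg]
  -- The relation is symmetrised to become even; no cancellation occurs, because `halfUnits`
  -- contains only one of `x` and `-x`.
  have hz := eq_zero_of_sum_cosecSq h3 (q := fun x => g' x + g' (-x))
    (ZMod.two_ne_zero_of_three_le h3) (fun x => by rw [neg_neg, add_comm]) (fun x hx => by
      have h1 : x ∉ halfUnits N := fun h => hx h.1
      have h2 : -x ∉ halfUnits N := fun h => hx (IsUnit.neg_iff x |>.1 h.1)
      simp [hg'def, h1, h2]) (by
      push_cast
      simp only [add_mul, Finset.sum_add_distrib]
      rw [hg', hg'', add_zero])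
  rintro ⟨x, hx⟩
  have h1 : -x ∉ halfUnits N := fun h => (neg_mem_halfUnits_iff hN h3 hx.1).1 h hx
  simpa [hg'def, hx, h1] using congrFun hz x

theorem two_mul_card_halfUnits (hN : Odd N) (h3 : 3 ≤ N) :
    2 * Nat.card (halfUnits N) = Nat.totient N := by
  classical
  set A : Finset (ZMod N)ˣ := Finset.univ.filter fun u => (u : ZMod N) ∈ halfUnits N with hA
  have h1 : Nat.card (halfUnits N) = A.card := by
    rw [Nat.card_eq_fintype_card, ← Finset.card_univ]
    refine (Finset.card_bij (fun u hu => ⟨(u : ZMod N), (Finset.mem_filter.1 hu).2⟩)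
      (fun _ _ => Finset.mem_univ _) (fun u _ v _ h => Units.ext (congrArg Subtype.val h)) ?_).symm
    rintro ⟨x, hx⟩ -
    obtain ⟨u, rfl⟩ := hx.1
    exact ⟨u, by simpa [hA] using hx, rfl⟩
  have h2 : A.card = Aᶜ.card := by
    have key : ∀ u : (ZMod N)ˣ, -u ∈ A ↔ u ∉ A := fun u => by
      simpa [hA] using neg_mem_halfUnits_iff hN h3 u.isUnit
    refine Finset.card_bij (fun u _ => -u) (fun u hu => ?_) (fun u _ v _ h => neg_injective h)
      (fun u hu => ⟨-u, (key u).2 (Finset.mem_compl.1 hu), neg_neg u⟩)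
    rw [Finset.mem_compl, key, not_not]; exact hu
  have h3 := Finset.card_add_card_compl A
  rw [ZMod.card_units_eq_totient] at h3
  omega

/-- A real field which contains the cosines and has at most half of the degree of the cyclotomic
field. -/
theorem exists_real_subfield (hN : Odd N) (h3 : 3 ≤ N) :
    ∃ K : IntermediateField ℚ ℝ, (∀ k : ℤ, 2 * Real.cos (Real.pi * k / N) ∈ K) ∧
      FiniteDimensional ℚ K ∧ 2 * Module.finrank ℚ K ≤ Nat.totient N := by
  have hζ := Complex.isPrimitiveRoot_exp N (NeZero.ne N)
  set ζ := Complex.exp (2 * Real.pi * Complex.I / N) with hζdef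
  have hNpos := Nat.pos_of_ne_zero (NeZero.ne N)
  have hint : IsIntegral ℚ ζ := (hζ.isIntegral hNpos).tower_top
  set F : IntermediateField ℚ ℂ := IntermediateField.adjoin ℚ {ζ}
  have hζF : ζ ∈ F := IntermediateField.mem_adjoin_simple_self ℚ ζ
  have hFfin : FiniteDimensional ℚ F := IntermediateField.adjoin.finiteDimensional hint
  have hFdim : Module.finrank ℚ F = Nat.totient N := by
    rw [IntermediateField.adjoin.finrank hint, ← Polynomial.cyclotomic_eq_minpoly_rat hζ hNpos,
      Polynomial.natDegree_cyclotomic]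
  set K : IntermediateField ℚ ℝ := F.comap (Algebra.ofId ℝ ℂ |>.restrictScalars ℚ)
  have hK : ∀ x : ℝ, x ∈ K ↔ (x : ℂ) ∈ F := fun x => Iff.rfl
  -- For `N = 2m + 1` one has `e^{πi/N} = -ζ^{m+1}`, so oddness puts the half angles into the
  -- cyclotomic field.
  have hhalf : Complex.exp (Real.pi * Complex.I / N) ∈ F := by
    obtain ⟨m, hm⟩ := hN
    have e : Complex.exp (Real.pi * Complex.I / N) = -ζ ^ (m + 1) := by
      have hN0 : (N : ℂ) ≠ 0 := Nat.cast_ne_zero.2 hNpos.ne'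
      have h1 : (N : ℂ) = 2 * m + 1 := by rw [hm]; push_cast; ring
      rw [hζdef, ← Complex.exp_nat_mul]
      have : ((m + 1 : ℕ) : ℂ) * (2 * Real.pi * Complex.I / N) =
          Real.pi * Complex.I / N + Real.pi * Complex.I := by
        field_simp
        push_cast
        rw [h1]; ring
      rw [this, Complex.exp_add, Complex.exp_pi_mul_I]
      ring
    rw [e]
    exact F.neg_mem (pow_mem hζF _)
  have hcos : ∀ k : ℤ, 2 * Real.cos (Real.pi * k / N) ∈ K := by
    intro k
    rw [hK]
    have e : ((2 * Real.cos (Real.pi * k / N) : ℝ) : ℂ) =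
        Complex.exp (Real.pi * Complex.I / N) ^ k +
          (Complex.exp (Real.pi * Complex.I / N) ^ k)⁻¹ := by
      rw [← Complex.exp_int_mul, ← Complex.exp_neg]
      push_cast
      rw [Complex.two_cos]
      congr 2 <;> ring
    rw [e]
    exact F.add_mem (zpow_mem hhalf _) (F.inv_mem (zpow_mem hhalf _))
  have him : ζ - ζ⁻¹ = ((2 * Real.sin (2 * Real.pi / N) : ℝ) : ℂ) * Complex.I := by
    have e : (2 * Real.pi * Complex.I / N : ℂ) = (2 * Real.pi / N : ℝ) * Complex.I := by
      push_cast; ring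
    rw [hζdef, ← Complex.exp_neg, e]
    push_cast
    rw [Complex.two_sin, mul_assoc, Complex.I_mul_I]
    ring_nf
  have hsin : 2 * Real.sin (2 * Real.pi / N) ≠ 0 := by
    have hN' : (3 : ℝ) ≤ N := by exact_mod_cast h3
    have hπ := Real.pi_pos
    have : 0 < Real.sin (2 * Real.pi / N) := by
      refine Real.sin_pos_of_pos_of_lt_pi (by positivity) ?_
      rw [div_lt_iff₀ (by linarith)]
      nlinarith
    positivity
  let ι : K →ₗ[ℚ] F :=
    { toFun := fun x => ⟨(x : ℝ), (hK x).1 x.2⟩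
      map_add' := fun x y => Subtype.ext (by push_cast; rfl)
      map_smul' := fun c x => Subtype.ext (by simp [Algebra.smul_def]) }
  -- `ζ - ζ⁻¹` is nonzero and purely imaginary, so `K ⊕ K (ζ - ζ⁻¹)` embeds into `F`; this yields
  -- the factor 2.
  let Φ : K × K →ₗ[ℚ] F := ι.coprod
    (LinearMap.mulRight ℚ (⟨ζ - ζ⁻¹, F.sub_mem hζF (F.inv_mem hζF)⟩ : F) ∘ₗ ι)
  have hΦ : Function.Injective Φ := by
    rw [injective_iff_map_eq_zero]
    rintro ⟨a, b⟩ h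
    have h1 : ((a : ℝ) : ℂ) + (b : ℝ) * (ζ - ζ⁻¹) = 0 := congrArg Subtype.val h
    rw [him] at h1
    generalize 2 * Real.sin (2 * Real.pi / N) = r at h1 hsin
    have hre := congrArg Complex.re h1
    have him' := congrArg Complex.im h1
    simp at hre him'
    rw [hre, him'.resolve_right hsin, Prod.mk_zero_zero]
  have hfin := FiniteDimensional.of_injective Φ hΦ
  have hKfin : FiniteDimensional ℚ K :=
    FiniteDimensional.of_injective (Φ ∘ₗ LinearMap.inl ℚ K K)
      (hΦ.comp LinearMap.inl_injective)
  refine ⟨K, hcos, hKfin, ?_⟩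
  have := LinearMap.finrank_le_finrank_of_injective hΦ
  rw [Module.finrank_prod, hFdim] at this
  omega

end Independence

/-- The rank of a group of real numbers which embeds into a number field by a homothety. -/
theorem finrank_le_of_mul_mem (K : IntermediateField ℚ ℝ) [FiniteDimensional ℚ K] (L : Submodule ℤ ℝ)
    [Module.Finite ℤ L] {μ : ℝ} (hμ : μ ≠ 0) (h : ∀ x ∈ L, μ * x ∈ K) :
    Module.finrank ℤ L ≤ Module.finrank ℚ K := by
  set b := Module.finBasis ℤ L
  have h1 : LinearIndependent ℤ fun i => (⟨μ * b i, h _ (b i).2⟩ : K) := by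
    let φ : L →ₗ[ℤ] K := AddMonoidHom.toIntLinearMap
      { toFun := fun x => ⟨μ * x, h _ x.2⟩
        map_zero' := Subtype.ext (by simp)
        map_add' := fun x y => Subtype.ext (by simp [mul_add]) }
    have hφ : Function.Injective φ := fun x y hxy =>
      Subtype.ext (mul_left_cancel₀ hμ (congrArg Subtype.val hxy))
    exact b.linearIndependent.map' φ (LinearMap.ker_eq_bot.2 hφ)
  have h2 := (LinearIndependent.iff_fractionRing ℤ ℚ).1 h1
  have := h2.fintype_card_le_finrank
  rwa [Fintype.card_fin] at this

/-- A lower bound for the rank of a group of real numbers. -/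
theorem card_le_finrank_of_mul_mem {ι : Type*} [Finite ι] {f : ι → ℝ} (hf : LinearIndependent ℤ f)
    (L : Submodule ℤ ℝ) [Module.Finite ℤ L] {c : ℝ} (hc : c ≠ 0) (h : ∀ i, c * f i ∈ L) :
    Nat.card ι ≤ Module.finrank ℤ L := by
  have := Fintype.ofFinite ι
  have h1 : LinearIndependent ℤ fun i => c * f i :=
    hf.map' (LinearMap.mulLeft ℤ c) (LinearMap.ker_eq_bot.2 fun x y h => mul_left_cancel₀ hc h)
  have h2 : LinearIndependent ℤ fun i => (⟨c * f i, h i⟩ : L) :=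
    LinearIndependent.of_comp L.subtype h1
  have := h2.fintype_card_le_finrank
  rwa [← Nat.card_eq_fintype_card] at this



/-! ### Triples of cosines -/

/-- Twice the cosine of `π k / N`. -/
noncomputable def twoCos (N : ℕ) (k : ℤ) : ℝ := 2 * Real.cos (Real.pi * k / N)

/-- The Markov type triple `(2 cos α, 2 cos β, 2 cos (α + β))`. -/
noncomputable def cosTriple (N : ℕ) (a b : ℤ) : Fin 3 → ℝ :=
  ![twoCos N a, twoCos N b, twoCos N (a + b)]

section CosTriple

variable {N : ℕ}

theorem twoCos_neg (k : ℤ) : twoCos N (-k) = twoCos N k := by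
  unfold twoCos
  rw [← Real.cos_neg]
  congr 2
  push_cast; ring

theorem twoCos_mul (a b : ℤ) : twoCos N a * twoCos N b = twoCos N (a + b) + twoCos N (a - b) := by
  unfold twoCos
  have e1 : Real.pi * ((a + b : ℤ) : ℝ) / N = Real.pi * a / N + Real.pi * b / N := by
    push_cast; ring
  have e2 : Real.pi * ((a - b : ℤ) : ℝ) / N = Real.pi * a / N - Real.pi * b / N := by
    push_cast; ring
  rw [e1, e2, Real.cos_add, Real.cos_sub]
  ring

theorem twoCos_add_mul [NeZero N] (k m : ℤ) :
    twoCos N (k + m * N) = (-1) ^ m * twoCos N k := by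
  have hN : (N : ℝ) ≠ 0 := Nat.cast_ne_zero.2 (NeZero.ne N)
  unfold twoCos
  have e : Real.pi * ((k + m * N : ℤ) : ℝ) / N = Real.pi * k / N + m * Real.pi := by
    push_cast; field_simp
  rw [e, Real.cos_add_int_mul_pi]
  ring

theorem cosTriple_neg_neg (a b : ℤ) : cosTriple N (-a) (-b) = cosTriple N a b := by
  unfold cosTriple
  rw [twoCos_neg, twoCos_neg, show -a + -b = -(a + b) by ring, twoCos_neg]

/-- In terms of angles the involutions are linear: `2 cos (α + β) · 2 cos β - 2 cos α = 2 cos (α +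
2β)`. -/
theorem vieta_zero_cosTriple (a b : ℤ) :
    vieta 0 (cosTriple N a b) = cosTriple N (-a - 2 * b) b := by
  have h := twoCos_mul (N := N) (a + b) b
  have e : twoCos N (-a - 2 * b) = twoCos N (a + b + b) := by rw [← twoCos_neg]; congr 1; ring
  have e2 : twoCos N (-a - 2 * b + b) = twoCos N (a + b) := by rw [← twoCos_neg]; congr 1; ring
  rw [add_sub_cancel_right] at h
  funext l
  fin_cases l <;> simp [vieta, cosTriple, e, e2]
  linarith

theorem vieta_one_cosTriple (a b : ℤ) :
    vieta 1 (cosTriple N a b) = cosTriple N a (-b - 2 * a) := by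
  have h := twoCos_mul (N := N) (a + b) a
  have e : twoCos N (-b - 2 * a) = twoCos N (a + b + a) := by rw [← twoCos_neg]; congr 1; ring
  have e2 : twoCos N (a + (-b - 2 * a)) = twoCos N (a + b) := by rw [← twoCos_neg]; congr 1; ring
  rw [add_sub_cancel_left] at h
  funext l
  fin_cases l <;> simp [vieta, cosTriple, e, e2]
  linarith

theorem vieta_two_cosTriple (a b : ℤ) : vieta 2 (cosTriple N a b) = cosTriple N a (-b) := by
  have h := twoCos_mul (N := N) a b
  funext l
  fin_cases l <;> simp [vieta, cosTriple, twoCos_neg, ← sub_eq_add_neg]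
  linarith

variable {t : Fin 3 → ℝ} {a b : ℤ}

theorem cosTriple_neg_mem (h : cosTriple N a b ∈ vietaOrbit t) :
    cosTriple N a (-b) ∈ vietaOrbit t := by
  rw [← vieta_two_cosTriple]; exact vieta_mem_vietaOrbit h 2

/-- Two involutions compose to `b ↦ b + 2a`. With its counterpart for `a` this permits elementary
column operations with even multipliers. -/
theorem cosTriple_add_right_mem (h : cosTriple N a b ∈ vietaOrbit t) (j : ℤ) :
    cosTriple N a (b + 2 * j * a) ∈ vietaOrbit t := by
  have up : ∀ b, cosTriple N a b ∈ vietaOrbit t → cosTriple N a (b + 2 * a) ∈ vietaOrbit t := by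
    intro b hb
    have h1 := vieta_mem_vietaOrbit hb 1
    rw [vieta_one_cosTriple] at h1
    have h2 := cosTriple_neg_mem h1
    rwa [show -(-b - 2 * a) = b + 2 * a by ring] at h2
  have down : ∀ b, cosTriple N a b ∈ vietaOrbit t → cosTriple N a (b - 2 * a) ∈ vietaOrbit t := by
    intro b hb
    have h1 := cosTriple_neg_mem (up _ (cosTriple_neg_mem hb))
    rwa [show -(-b + 2 * a) = b - 2 * a by ring] at h1
  induction j using Int.induction_on with
  | zero => simpa using h
  | succ i ih =>
    have := up _ ih
    rwa [show b + 2 * (i : ℤ) * a + 2 * a = b + 2 * ((i : ℤ) + 1) * a by ring] at this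
  | pred i ih =>
    have := down _ ih
    rwa [show b + 2 * -(i : ℤ) * a - 2 * a = b + 2 * (-(i : ℤ) - 1) * a by ring] at this

theorem cosTriple_add_left_mem (h : cosTriple N a b ∈ vietaOrbit t) (j : ℤ) :
    cosTriple N (a + 2 * j * b) b ∈ vietaOrbit t := by
  have up : ∀ a, cosTriple N a b ∈ vietaOrbit t → cosTriple N (a + 2 * b) b ∈ vietaOrbit t := by
    intro a ha
    have h1 := vieta_mem_vietaOrbit ha 0
    rw [vieta_zero_cosTriple] at h1
    have h2 := cosTriple_neg_mem h1
    rwa [← cosTriple_neg_neg, neg_neg, show -(-a - 2 * b) = a + 2 * b by ring] at h2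
  have flip : ∀ a, cosTriple N a b ∈ vietaOrbit t → cosTriple N (-a) b ∈ vietaOrbit t := by
    intro a ha
    have h1 := cosTriple_neg_mem ha
    rwa [← cosTriple_neg_neg, neg_neg] at h1
  have down : ∀ a, cosTriple N a b ∈ vietaOrbit t → cosTriple N (a - 2 * b) b ∈ vietaOrbit t := by
    intro a ha
    have h1 := flip _ (up _ (flip _ ha))
    rwa [show -(-a + 2 * b) = a - 2 * b by ring] at h1
  induction j using Int.induction_on with
  | zero => simpa using h
  | succ i ih =>
    have := up _ ih
    rwa [show a + 2 * (i : ℤ) * b + 2 * b = a + 2 * ((i : ℤ) + 1) * b by ring] at this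
  | pred i ih =>
    have := down _ ih
    rwa [show a + 2 * -(i : ℤ) * b - 2 * b = a + 2 * (-(i : ℤ) - 1) * b by ring] at this

/-- For `i` the product of the primes dividing `N` but not `a`, every prime divisor of `N` divides
exactly one of `a` and `i b`. -/
theorem exists_isUnit_add_mul [NeZero N] (h : ∀ p : ℕ, p.Prime → p ∣ N → ¬ ((p : ℤ) ∣ a ∧ (p : ℤ) ∣ b)) :
    ∃ i : ℤ, IsUnit ((a + i * b : ℤ) : ZMod N) := by
  classical
  refine ⟨∏ p ∈ N.primeFactors.filter fun p : ℕ => ¬ (p : ℤ) ∣ a, (p : ℤ), ?_⟩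
  rw [ZMod.coe_int_isUnit_iff_isCoprime, Int.isCoprime_iff_gcd_eq_one]
  by_contra hg
  obtain ⟨p, hp, hpg⟩ := Nat.exists_prime_and_dvd hg
  have hpN : p ∣ N := by
    have := (Int.natCast_dvd_natCast.2 hpg).trans (Int.gcd_dvd_left ..)
    exact_mod_cast this
  have hpab := (Int.natCast_dvd_natCast.2 hpg).trans (Int.gcd_dvd_right ..)
  have hp' : Prime (p : ℤ) := Nat.prime_iff_prime_int.1 hp
  by_cases ha : (p : ℤ) ∣ a
  · rw [dvd_add_right ha] at hpab
    rcases hp'.dvd_or_dvd hpab with hd | hd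
    · obtain ⟨q, hq, hpq⟩ := (hp'.dvd_finsetProd_iff _).1 hd
      rw [Finset.mem_filter] at hq
      have : p = q := (Nat.prime_dvd_prime_iff_eq hp (Nat.prime_of_mem_primeFactors hq.1)).1
        (by exact_mod_cast hpq)
      exact hq.2 (this ▸ ha)
    · exact h p hp hpN ⟨ha, hd⟩
  · have hd : (p : ℤ) ∣ ∏ p ∈ N.primeFactors.filter fun p : ℕ => ¬ (p : ℤ) ∣ a, (p : ℤ) :=
      Finset.dvd_prod_of_mem (fun p : ℕ => (p : ℤ))
        (Finset.mem_filter.2 ⟨Nat.mem_primeFactors.2 ⟨hp, hpN, NeZero.ne N⟩, ha⟩)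
    exact ha ((dvd_add_left (hd.mul_right b)).1 hpab)

/-- The orbit of a primitive triple of cosines contains all primitive triples modulo `N` of the
form `(0, κ)`. -/
theorem exists_cosTriple_mem [NeZero N] (hN : Odd N) (h : cosTriple N a b ∈ vietaOrbit t)
    (hab : ∀ p : ℕ, p.Prime → p ∣ N → ¬ ((p : ℤ) ∣ a ∧ (p : ℤ) ∣ b)) (κ : (ZMod N)ˣ) :
    ∃ a' b' : ℤ, cosTriple N a' b' ∈ vietaOrbit t ∧ (a' : ZMod N) = 0 ∧ (b' : ZMod N) = κ := by
  obtain ⟨n, hn⟩ := hN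
  -- As `N` is odd, even multipliers represent all residues.
  have hhalf : ∀ z : ZMod N, ∃ j : ℤ, ((2 * j : ℤ) : ZMod N) = z := by
    intro z
    refine ⟨(n + 1) * z.val, ?_⟩
    have : ((N : ℕ) : ZMod N) = 0 := ZMod.natCast_self N
    have e : (2 * n + 1 : ZMod N) = 0 := by rw [← this, hn]; push_cast; ring
    push_cast
    rw [ZMod.natCast_zmod_val]
    linear_combination z * e
  -- Three elementary operations: the first entry becomes a unit `u`, then the second becomes `κ`
  -- with the help of `u`, and finally `κ` clears the first.
  obtain ⟨i, u, hu⟩ := exists_isUnit_add_mul hab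
  obtain ⟨j₁, hj₁⟩ := hhalf i
  have h1 := cosTriple_add_left_mem h j₁
  have e1 : ((a + 2 * j₁ * b : ℤ) : ZMod N) = u := by
    rw [hu]; push_cast at hj₁ ⊢; rw [hj₁]
  obtain ⟨j₂, hj₂⟩ := hhalf ((κ - b) * (u⁻¹ : (ZMod N)ˣ))
  have h2 := cosTriple_add_right_mem h1 j₂
  have e2 : ((b + 2 * j₂ * (a + 2 * j₁ * b) : ℤ) : ZMod N) = κ := by
    have : ((b + 2 * j₂ * (a + 2 * j₁ * b) : ℤ) : ZMod N) =
        b + ((2 * j₂ : ℤ) : ZMod N) * ((a + 2 * j₁ * b : ℤ) : ZMod N) := by push_cast; ring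
    rw [this, e1, hj₂, mul_assoc, Units.inv_mul, mul_one, add_sub_cancel]
  obtain ⟨j₃, hj₃⟩ := hhalf (-(u : ZMod N) * (κ⁻¹ : (ZMod N)ˣ))
  refine ⟨_, _, cosTriple_add_left_mem h2 j₃, ?_, e2⟩
  have : ∀ x y : ℤ, ((x + 2 * j₃ * y : ℤ) : ZMod N) = x + ((2 * j₃ : ℤ) : ZMod N) * y := by
    intro x y; push_cast; ring
  rw [this, e1, e2, hj₃, mul_assoc, Units.inv_mul, mul_one, add_neg_cancel]

theorem four_sub_twoCos_sq (k : ℤ) :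
    4 - twoCos N k ^ 2 = 4 * Real.sin (Real.pi * k / N) ^ 2 := by
  have := Real.sin_sq_add_cos_sq (Real.pi * k / N)
  unfold twoCos
  linear_combination -4 * this

theorem twoCos_ne_zero [NeZero N] (hN : Odd N) (k : ℤ) : twoCos N k ≠ 0 := by
  have hN0 : (N : ℝ) ≠ 0 := Nat.cast_ne_zero.2 (NeZero.ne N)
  intro h
  have h1 : Real.cos (Real.pi * k / N) = 0 := by unfold twoCos at h; linarith
  obtain ⟨m, hm⟩ := Real.cos_eq_zero_iff.1 h1
  have h2 : (2 * k : ℝ) = (2 * m + 1) * N := by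
    field_simp at hm
    linarith
  have h3 : 2 * k = (2 * m + 1) * N := by exact_mod_cast h2
  obtain ⟨n, rfl⟩ := hN
  push_cast at h3
  have : 2 * k = 2 * (2 * m * n + m + n) + 1 := by linear_combination h3
  omega

/-- Triples of cosines with `a = 0` and `b = κ` modulo `N`. -/
theorem cosTriple_abs [NeZero N] {κ : ZMod N} (ha : (a : ZMod N) = 0) (hb : (b : ZMod N) = κ) :
    |cosTriple N a b 0| = 2 ∧ |cosTriple N a b 2| = |cosTriple N a b 1| ∧
      4 - cosTriple N a b 1 ^ 2 = 4 * Real.sin (Real.pi * κ.val / N) ^ 2 := by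
  have habs : ∀ (m : ℤ) (x : ℝ), |(-1 : ℝ) ^ m * x| = |x| := fun m x => by
    rw [abs_mul, abs_zpow, abs_neg, abs_one, one_zpow, one_mul]
  obtain ⟨m, rfl⟩ := (ZMod.intCast_zmod_eq_zero_iff_dvd a N).1 ha |>.imp fun m hm => hm
  have h0 : twoCos N 0 = 2 := by simp [twoCos]
  have hcong : ((b - κ.val : ℤ) : ZMod N) = 0 := by
    push_cast; rw [hb, ZMod.natCast_zmod_val, sub_self]
  obtain ⟨l, hl⟩ := (ZMod.intCast_zmod_eq_zero_iff_dvd _ N).1 hcong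
  have hb' : b = κ.val + l * N := by linarith
  refine ⟨?_, ?_, ?_⟩
  · change |twoCos N _| = 2
    rw [show (N : ℤ) * m = 0 + m * N by ring, twoCos_add_mul, habs, h0, abs_two]
  · change |twoCos N _| = |twoCos N _|
    rw [show (N : ℤ) * m + b = b + m * N by ring, twoCos_add_mul, habs]
  · change 4 - twoCos N b ^ 2 = _
    rw [hb', twoCos_add_mul, ← sq_abs, habs, sq_abs, four_sub_twoCos_sq]
    norm_cast

end CosTriple



/-! ### Strips -/

namespace BeltData

variable {V : Type*} [AddCommGroup V] [Module ℝ V] {D : BeltData V} {t : Seed V}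

theorem ω_shift (τ : ℝ) (f g : V) : D.ω (f + D.shift τ f) (g + D.shift τ g) = D.ω f g := by
  have h := D.skew f D.δ
  simp only [shift_apply, map_add, map_smul, LinearMap.add_apply, LinearMap.smul_apply, smul_eq_mul,
    D.ω_self, slope, h]
  ring

/-- A belt seed with weights `2, ρ, ρ` bounds a strip. -/
theorem IsBeltSeed.exists_strip (ht : D.IsBeltSeed t) {w : Fin 3 → ℝ} {ρ : ℝ} (hρ : 0 < ρ)
    (hρ2 : ρ < 2) (hw0 : w 0 = 2) (hw1 : w 1 = ρ) (hw2 : w 2 = ρ)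
    (hw : ∀ i j k, i ≠ j → j ≠ k → i ≠ k → |t.mat i j| = w k) :
    ∃ i j k b, i ≠ j ∧ j ≠ k ∧ i ≠ k ∧
      D.CyclicTriple (t.vec i) (t.vec j) (t.vec k) ρ 2 ρ 0 b b := by
  obtain ⟨i, j, k, hij, hjk, hik, h⟩ := ht.exists_triple
  have cases : (w i = 2 ∧ w j = ρ ∧ w k = ρ) ∨ (w i = ρ ∧ w j = 2 ∧ w k = ρ) ∨
      (w i = ρ ∧ w j = ρ ∧ w k = 2) := by
    clear * - hij hjk hik hw0 hw1 hw2
    fin_cases i <;> fin_cases j <;> fin_cases k <;>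
      first
      | exact absurd rfl hij
      | exact absurd rfl hjk
      | exact absurd rfl hik
      | simp [hw0, hw1, hw2]
  have e1 := hw i j k hij hjk hik
  have e2 := hw j k i hjk hik.symm hij.symm
  have e3 := hw i k j hik hjk.symm hij
  rw [ht.mat_eq] at e1 e2 e3
  rcases h with ⟨p, q, r, a, b, c, h⟩ | ⟨r, p, q, a, b, c, h⟩
  -- An acyclic triple cannot have a weight 2 here: for `p = 2`, say, `2a = 2b + ρc` and `2b = 2a +
  -- ρc` contradict `ρc > 0`.
  · exfalso
    rw [h.ω_xy, abs_of_nonneg h.p_nonneg] at e1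
    rw [h.ω_yz, abs_of_nonneg h.q_nonneg] at e2
    rw [h.ω_xz, abs_of_nonneg h.r_nonneg] at e3
    have ea := h.eq_a
    have eb := h.eq_b
    have ec := h.eq_c
    have := mul_pos hρ h.a_pos
    have := mul_pos hρ h.b_pos
    have := mul_pos hρ h.c_pos
    rcases cases with ⟨h1, h2, h3⟩ | ⟨h1, h2, h3⟩ | ⟨h1, h2, h3⟩ <;>
      (rw [h3] at e1; rw [h1] at e2; rw [h2] at e3; subst e1 e2 e3; linarith)
  · rw [h.ω_xy, abs_of_pos h.r_pos] at e1
    rw [h.ω_yz, abs_of_pos h.p_pos] at e2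
    rw [h.ω_xz, abs_neg, abs_of_pos h.q_pos] at e3
    have ea := h.eq_a
    have eb := h.eq_b
    have ec := h.eq_c
    have hc := h.c_pos
    have hb := h.b_pos
    have hlt : ρ * ρ < 4 := by nlinarith
    -- For a cyclic triple the relations and `ρ < 2` force the weight 2 to lie opposite to `x`, with
    -- coefficient `a = 0`.
    rcases cases with ⟨h1, h2, h3⟩ | ⟨h1, h2, h3⟩ | ⟨h1, h2, h3⟩
    · obtain rfl : ρ = r := (e1.trans h3).symm
      obtain rfl : p = 2 := e2.trans h1
      obtain rfl : ρ = q := (e3.trans h2).symm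
      have ha : (4 - ρ * ρ) * a = 0 := by linear_combination 2 * ea - ρ * eb
      have ha0 := (mul_eq_zero.1 ha).resolve_left (by linarith)
      have hbc : c = b := by rw [ha0] at eb; linarith
      subst ha0 hbc
      exact ⟨i, j, k, c, hij, hjk, hik, h⟩
    · exfalso
      obtain rfl : ρ = r := (e1.trans h3).symm
      obtain rfl : ρ = p := (e2.trans h1).symm
      obtain rfl : q = 2 := e3.trans h2
      have : (4 - ρ * ρ) * b = 0 := by linear_combination 2 * eb - ρ * ea
      rcases mul_eq_zero.1 this with h' | h' <;> linarith
    · exfalso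
      obtain rfl : r = 2 := e1.trans h3
      obtain rfl : ρ = p := (e2.trans h1).symm
      obtain rfl : ρ = q := (e3.trans h2).symm
      have : (4 - ρ * ρ) * c = 0 := by linear_combination 2 * ec + ρ * ea
      rcases mul_eq_zero.1 this with h' | h' <;> linarith

/-- Two mutations move a strip by a translation. -/
theorem IsBeltSeed.mutateSeed_strip (ht : D.IsBeltSeed t) {i j k : Fin 3} (hij : i ≠ j)
    (hjk : j ≠ k) (hik : i ≠ k) {ρ b : ℝ}
    (h : D.CyclicTriple (t.vec i) (t.vec j) (t.vec k) ρ 2 ρ 0 b b) :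
    _root_.mutateSeed D.Q D.pos k (_root_.mutateSeed D.Q D.pos j t) = shiftSeed (D.shift (1 / b ^ 2)) t := by
  have hb := h.b_pos
  have hρ := h.r_pos
  set u := _root_.mutateSeed D.Q D.pos j t with hu
  have hub : D.IsBeltSeed u := ht.mutateSeed j
  have ui : u.vec i = t.vec i := by
    rw [hu, ht.mutateSeed_vec hij]
    exact partialReflection_eq_self_of_mem h.y_mem_pos (by rw [h.ω_xy]; exact hρ.le)
  have uj : u.vec j = -t.vec j := mutateSeed_vec_self j
  have uk : u.vec k = t.vec k + (2 : ℝ) • t.vec j := by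
    rw [hu, ht.mutateSeed_vec hjk.symm]
    exact partialReflection_of_mem h.y_mem_pos h.ω_yz h.p_pos.le h.zy
  have h' := h.mutate_y (by linarith)
  rw [← ui, ← uj, ← uk] at h'
  have hvb : (_root_.mutateSeed D.Q D.pos k u).vec i = u.vec i := by
    rw [hub.mutateSeed_vec hik]
    exact partialReflection_eq_self_of_mem h'.y_mem_pos (by rw [h'.ω_xy]; exact h'.r_pos.le)
  have hvj : (_root_.mutateSeed D.Q D.pos k u).vec j = u.vec j + (2 : ℝ) • u.vec k := by
    rw [hub.mutateSeed_vec hjk]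
    exact partialReflection_of_mem h'.y_mem_pos h'.ω_yz h'.p_pos.le h'.zy
  have hvk : (_root_.mutateSeed D.Q D.pos k u).vec k = -u.vec k := mutateSeed_vec_self k
  -- The sides `y = t.vec j` and `z = t.vec k` are parallel. The mutations turn `y` into `3y + 2z =
  -- y - (2/b) δ`, and `slope y = 2b`, so the translation parameter is `1/b²`.
  have hδ : D.δ = -(b • t.vec j + b • t.vec k) := by
    have := h.relation
    rw [zero_smul, zero_add] at this
    rw [this, neg_neg]
  have hvec : (_root_.mutateSeed D.Q D.pos k u).vec = (shiftSeed (D.shift (1 / b ^ 2)) t).vec := by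
    funext l
    have : l = i ∨ l = j ∨ l = k := by clear * - hij hjk hik; revert i j k l; decide
    rcases this with rfl | rfl | rfl
    · rw [hvb, ui]
      simp only [shiftSeed, shift_apply, h.slope_x]
      simp
    · rw [hvj, uj, uk]
      simp only [shiftSeed, shift_apply, h.slope_y]
      rw [hδ]
      match_scalars <;> field_simp <;> ring
    · rw [hvk, uk]
      simp only [shiftSeed, shift_apply, h.slope_z]
      rw [hδ]
      match_scalars <;> field_simp <;> ring
  ext1
  · exact hvec
  · ext l m
    rw [(hub.mutateSeed k).mat_eq, hvec]
    change D.ω (t.vec l + _) (t.vec m + _) = t.mat l m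
    rw [ω_shift, ht.mat_eq]

end BeltData

/-! ### Triangles with an odd denominator -/

section OddDenominator

variable {s : Seed AffineFun} {H : Plane}

/-- The Gram determinant of three vectors in the plane vanishes. -/
theorem planar_gram_relation {x y e : Plane} {ρ b : ℝ} (hx : inner ℝ x x = (2 : ℝ))
    (hy : inner ℝ y y = (2 : ℝ)) (hxy : inner ℝ x y = ρ) (hxe : inner ℝ x e = (0 : ℝ))
    (hye : inner ℝ y e = 2 * b) : 8 * b ^ 2 = ‖e‖ ^ 2 * (4 - ρ ^ 2) := by
  rw [← real_inner_self_eq_norm_sq]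
  simp only [PiLp.inner_apply, Fin.sum_univ_two, RCLike.inner_apply, conj_trivial] at *
  have key : ∀ X Y R P B E : ℝ, x 0 * x 0 + x 1 * x 1 = X → y 0 * y 0 + y 1 * y 1 = Y →
      x 0 * y 0 + x 1 * y 1 = R → x 0 * e 0 + x 1 * e 1 = P → y 0 * e 0 + y 1 * e 1 = B →
      e 0 * e 0 + e 1 * e 1 = E →
      X * (Y * E - B * B) - R * (R * E - B * P) + P * (R * B - Y * P) = 0 := by
    rintro _ _ _ _ _ _ rfl rfl rfl rfl rfl rfl
    ring
  have := key 2 2 ρ 0 (2 * b) _ (by linarith) (by linarith) (by linarith) (by linarith)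
    (by linarith) rfl
  linear_combination -this

/-- Elements of the translation group satisfy an arithmetic condition. -/
theorem mul_mem_of_mem_translations (hs : IsSeed planeForm s) (hb : (hs.beltData H).IsBeltSeed s)
    {O : Subring ℝ} (hO : ∀ i j, gramOf (gramTriple planeForm s.vec) i j ∈ O) {τ : ℝ}
    (hτ : τ ∈ hb.translations (hs.beltData_isRadicalSpan H)) (l : Fin 3) :
    (hs.beltData H).slope (s.vec l) * hs.coeff l * τ ∈ O := by
  set D := hs.beltData H
  obtain ⟨u, hu, hsu⟩ := mem_exchangeVertices.1
    (hτ _ (mem_exchangeVertices.2 ⟨s, mem_labelledSeeds_self D.Q D.pos s, rfl⟩))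
  obtain ⟨σ, hσ⟩ := unlabelled_eq_iff.1 hsu.symm
  have h1 : s.vec l + D.shift τ (s.vec l) = u.vec (σ l) := congrFun (congrArg Seed.vec hσ) l
  have h2 := hs.repr_mem_of_mem_reached planeForm_comm hO u (ReachedIn.of_mem_labelledSeeds hu)
    (σ l) l
  rw [← h1, BeltData.shift_apply] at h2
  change hs.basis.repr (s.vec l + _ • ((0, 1) : AffineFun)) l ∈ O at h2
  rw [map_add, map_smul, Finsupp.add_apply, Finsupp.smul_apply, smul_eq_mul, ← hs.basis_apply,
    Module.Basis.repr_self, Finsupp.single_eq_same, hs.basis_apply] at h2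
  -- The constant function `δ` has the coordinate `-coeff l`, so the coordinate in `h2` is `1 +
  -- slope · coeff · τ`.
  have h3 := O.sub_mem h2 O.one_mem
  rw [show hs.basis.repr ((0, 1) : AffineFun) l = -hs.coeff l from (neg_neg _).symm] at h3
  convert h3 using 1
  ring

end OddDenominator



/-! ### Weights of the seeds in the exchange graph -/

theorem CompatMatrix.abs_eq {B : Matrix (Fin 3) (Fin 3) ℝ} {u : Fin 3 → ℝ} (h : CompatMatrix B u)
    (hB : B.transpose = -B) {i j k : Fin 3} (hij : i ≠ j) (hjk : j ≠ k) (hik : i ≠ k) :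
    |B i j| = |u k| := by
  have h1 := (h.apply k).1
  have h2 : |B j i| = |B i j| := by
    have := congrFun (congrFun hB i) j
    rw [Matrix.transpose_apply, Matrix.neg_apply] at this
    rw [this, abs_neg]
  have : (i = k + 1 ∧ j = k + 2) ∨ (i = k + 2 ∧ j = k + 1) := by
    clear * - hij hjk hik; revert i j k; decide
  rcases this with ⟨rfl, rfl⟩ | ⟨rfl, rfl⟩
  · exact h1.symm
  · rw [← h2]; exact h1.symm

theorem exists_mem_labelledSeeds_mat_eq {V : Type*} [AddCommGroup V] [Module ℝ V]
    (Q : LinearMap.BilinForm ℝ V) (pos : Set V) (s : Seed V) {B : Matrix (Fin 3) (Fin 3) ℝ}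
    (hB : B ∈ mutationClass s.mat) : ∃ t ∈ labelledSeeds Q pos s, t.mat = B := by
  obtain ⟨ks, rfl⟩ := hB
  exact ⟨_, ⟨ks, rfl⟩, List.foldl_hom Seed.mat (fun t k => rfl) |>.symm⟩

/-! ### Odd denominators: angles, strips and the rank. -/

section OddDenominator

variable {s : Seed AffineFun} {H : Plane}

/-- The gradients are linearly dependent, so their Gram determinant vanishes; a combination of the
three relations isolates it next to the positive coefficient `coeff 0`. -/
theorem IsTriangleSeed.markovConst_gramTriple (hs : IsTriangleSeed s) :
    gramTriple planeForm s.vec 0 ^ 2 + gramTriple planeForm s.vec 1 ^ 2 +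
      gramTriple planeForm s.vec 2 ^ 2 - gramTriple planeForm s.vec 0 *
        gramTriple planeForm s.vec 1 * gramTriple planeForm s.vec 2 = 4 := by
  have r0 := hs.gram_relation (i := 0) (j := 1) (k := 2) (by decide) (by decide) (by decide)
  have r1 := hs.gram_relation (i := 1) (j := 2) (k := 0) (by decide) (by decide) (by decide)
  have r2 := hs.gram_relation (i := 2) (j := 0) (k := 1) (by decide) (by decide) (by decide)
  have e0 : gramTriple planeForm s.vec 0 = planeForm (s.vec 1) (s.vec 2) := rfl
  have e1 : gramTriple planeForm s.vec 1 = planeForm (s.vec 2) (s.vec 0) := rfl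
  have e2 : gramTriple planeForm s.vec 2 = planeForm (s.vec 0) (s.vec 1) := rfl
  rw [planeForm_comm (s.vec 1) (s.vec 0), ← e1, ← e2] at r0
  rw [planeForm_comm (s.vec 2) (s.vec 1), ← e2, ← e0] at r1
  rw [planeForm_comm (s.vec 0) (s.vec 2), ← e0, ← e1] at r2
  generalize gramTriple planeForm s.vec 0 = x at *
  generalize gramTriple planeForm s.vec 1 = y at *
  generalize gramTriple planeForm s.vec 2 = z at *
  have h : hs.1.coeff 0 * (x ^ 2 + y ^ 2 + z ^ 2 - x * y * z - 4) = 0 := by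
    linear_combination (-1 / 2) * ((4 - x ^ 2) * r0 - (2 * z - x * y) * r1 + (z * x - 2 * y) * r2)
  have := (mul_eq_zero.1 h).resolve_left (hs.coeff_pos 0).ne'
  linarith

theorem exists_eq_of_twoCos_eq {N : ℕ} [NeZero N] {a b : ℤ} (h : twoCos N a = twoCos N b) :
    ∃ m : ℤ, a = m * N + b ∨ a = m * N - b := by
  have hN : (N : ℝ) ≠ 0 := Nat.cast_ne_zero.2 (NeZero.ne N)
  have h1 : Real.cos (Real.pi * a / N) = Real.cos (Real.pi * b / N) := mul_left_cancel₀ two_ne_zero h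
  obtain ⟨m, hm⟩ := Real.cos_eq_cos_iff.1 h1
  have hpi := Real.pi_ne_zero
  rcases hm with hm | hm
  · refine ⟨-(2 * m), Or.inl ?_⟩
    have : Real.pi * (b : ℝ) = Real.pi * (2 * m * N + a) := by
      field_simp at hm
      linear_combination Real.pi * hm
    have h2 : b = 2 * m * N + a := by exact_mod_cast mul_left_cancel₀ hpi this
    linear_combination -h2
  · refine ⟨2 * m, Or.inr ?_⟩
    have : Real.pi * (b : ℝ) = Real.pi * (2 * m * N - a) := by
      field_simp at hm
      linear_combination Real.pi * hm
    have h2 : b = 2 * m * N - a := by exact_mod_cast mul_left_cancel₀ hpi this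
    linear_combination h2

/-- By reducedness `p` cannot divide both `r.num` and `r.den`, so in either case it divides the
cofactor `N / r.den`. -/
theorem Rat.prime_mul_den_dvd {r : ℚ} {N p : ℕ} (hp : p.Prime) (hpN : p ∣ N) (hr : r.den ∣ N)
    (h : (p : ℤ) ∣ r.num * (N / r.den : ℕ)) : p * r.den ∣ N := by
  obtain ⟨c, rfl⟩ := hr
  rw [Nat.mul_div_cancel_left _ r.pos] at h
  suffices p ∣ c by rw [mul_comm]; exact mul_dvd_mul_left _ this
  rcases (Nat.prime_iff_prime_int.1 hp).dvd_or_dvd h with h | h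
  · refine (hp.dvd_mul.1 hpN).resolve_left fun hd => ?_
    have := Nat.dvd_gcd (Int.natCast_dvd.1 h) hd
    rw [r.reduced] at this
    exact hp.one_lt.ne' (Nat.dvd_one.1 this)
  · exact Int.natCast_dvd_natCast.1 h

/-- A triangle with denominator `N` has the Gram matrix of a triple of cosines. -/
theorem IsTriangleSeed.exists_cosTriple (hs : IsTriangleSeed s) {N : ℕ} [NeZero N]
    (hden : HasDenominator s N) : ∃ a b : ℤ, gramTriple planeForm s.vec = cosTriple N a b ∧
      ∀ p : ℕ, p.Prime → p ∣ N → ¬ ((p : ℤ) ∣ a ∧ (p : ℤ) ∣ b) := by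
  obtain ⟨r, ⟨-, hr⟩, hN⟩ := hden
  have hNR : (N : ℝ) ≠ 0 := Nat.cast_ne_zero.2 (NeZero.ne N)
  have hdvd : ∀ k, (r k).den ∣ N := by
    intro k
    rw [hN]
    fin_cases k
    · exact Nat.dvd_lcm_left _ _
    · exact (Nat.dvd_lcm_left _ _).trans (Nat.dvd_lcm_right _ _)
    · exact (Nat.dvd_lcm_right _ _).trans (Nat.dvd_lcm_right _ _)
  set p : Fin 3 → ℤ := fun k => (r k).num * (N / (r k).den : ℕ) with hp
  -- Adding `N` to the numerator, that is `π` to the angle, absorbs the minus sign of `-2 cos (r_k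
  -- π)`.
  have hg : ∀ k, gramTriple planeForm s.vec k = twoCos N (p k + N) := by
    intro k
    have h1 := twoCos_add_mul (N := N) (p k) 1
    rw [one_mul] at h1
    have h2 : Real.pi * (p k : ℝ) / N = (r k : ℝ) * Real.pi := by
      have hd : ((r k).den : ℝ) ≠ 0 := Nat.cast_ne_zero.2 (r k).den_nz
      simp only [hp]
      rw [Int.cast_mul, Int.cast_natCast, Nat.cast_div (hdvd k) hd, Rat.cast_def]
      field_simp
    rw [h1, twoCos, h2, gramTriple, hr k _ _ (by clear * -; revert k; decide)
      (by clear * -; revert k; decide) (by clear * -; revert k; decide)]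
    simp
  set a := p 0 + N
  set b := p 1 + N
  -- A prime `ℓ` dividing `N` and all three numerators would make `N / ℓ` a common denominator,
  -- against minimality.
  have hnot : ∀ ℓ : ℕ, ℓ.Prime → ℓ ∣ N → (ℓ : ℤ) ∣ a → (ℓ : ℤ) ∣ b → ¬ (ℓ : ℤ) ∣ p 2 + N := by
    intro ℓ hℓ hℓN h0 h1 h2
    have hℓN' : (ℓ : ℤ) ∣ N := Int.natCast_dvd_natCast.2 hℓN
    have hd : ∀ k, ℓ * (r k).den ∣ N := by
      intro k
      refine Rat.prime_mul_den_dvd hℓ hℓN (hdvd k) ?_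
      change (ℓ : ℤ) ∣ p k
      fin_cases k
      · exact (Int.dvd_add_left hℓN').1 h0
      · exact (Int.dvd_add_left hℓN').1 h1
      · exact (Int.dvd_add_left hℓN').1 h2
    obtain ⟨M, rfl⟩ := hℓN
    have hd' : ∀ k, (r k).den ∣ M := fun k => Nat.dvd_of_mul_dvd_mul_left hℓ.pos (hd k)
    have : ℓ * M ∣ M := by
      conv_lhs => rw [hN]
      exact Nat.lcm_dvd (hd' 0) (Nat.lcm_dvd (hd' 1) (hd' 2))
    have hM : 0 < M := Nat.pos_of_ne_zero fun h => NeZero.ne (ℓ * M) (by rw [h, mul_zero])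
    have := Nat.le_of_dvd hM this
    nlinarith [hℓ.two_le]
  have hmark := hs.markovConst_gramTriple
  rw [hg, hg, hg] at hmark
  change twoCos N a ^ 2 + twoCos N b ^ 2 + _ - twoCos N a * twoCos N b * _ = 4 at hmark
  have hsum := twoCos_mul (N := N) a b
  have hprod := twoCos_mul (N := N) (a + b) (a - b)
  have ha2 := twoCos_mul (N := N) a a
  have hb2 := twoCos_mul (N := N) b b
  have h0 : twoCos N 0 = 2 := by simp [twoCos]
  rw [sub_self, h0] at ha2 hb2
  rw [show a + b + (a - b) = a + a by ring, show a + b - (a - b) = b + b by ring] at hprod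
  -- With two entries `2 cos α`, `2 cos β`, the vanishing Gram determinant factors, so the third is
  -- `2 cos (α + β)` or `2 cos (α - β)`; the second case is absorbed by changing the sign of `b`.
  have hfac : (twoCos N (p 2 + N) - twoCos N (a + b)) * (twoCos N (p 2 + N) - twoCos N (a - b)) =
      0 := by
    linear_combination hmark + (twoCos N (p 2 + N)) * hsum + hprod - ha2 - hb2
  have hex : ∃ b', (b' = b ∨ b' = -b) ∧ twoCos N (p 2 + N) = twoCos N (a + b') := by
    rcases mul_eq_zero.1 hfac with h | h
    · exact ⟨b, Or.inl rfl, sub_eq_zero.1 h⟩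
    · exact ⟨-b, Or.inr rfl, by rw [← sub_eq_add_neg]; exact sub_eq_zero.1 h⟩
  obtain ⟨b', hb', h2⟩ := hex
  have hbb : twoCos N b' = twoCos N b := by
    rcases hb' with rfl | rfl
    · rfl
    · exact twoCos_neg b
  refine ⟨a, b', ?_, ?_⟩
  · funext k
    rw [hg]
    fin_cases k
    · rfl
    · exact hbb.symm
    · exact h2
  · rintro ℓ hℓ hℓN ⟨h3, h4⟩
    have hℓN' : (ℓ : ℤ) ∣ N := Int.natCast_dvd_natCast.2 hℓN
    refine hnot ℓ hℓ hℓN h3 ?_ ?_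
    · rcases hb' with rfl | rfl
      · exact h4
      · exact (dvd_neg).1 h4
    · obtain ⟨m, hm | hm⟩ := exists_eq_of_twoCos_eq h2 <;> rw [hm]
      · exact dvd_add (dvd_mul_of_dvd_right hℓN' m) (dvd_add h3 h4)
      · exact dvd_sub (dvd_mul_of_dvd_right hℓN' m) (dvd_add h3 h4)

/-- Every unit modulo `N` gives a strip in the exchange graph, hence a translation. -/
theorem cosecSq_mem_translations (hs : IsTriangleSeed s) (hb : (hs.1.beltData H).IsBeltSeed s)
    {N : ℕ} [NeZero N] (hN : Odd N) (h3 : 3 ≤ N) (hden : HasDenominator s N) {e : Plane}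
    (he0 : e ≠ 0) (he : ∀ f, (hs.1.beltData H).slope f = inner ℝ f.1 e) (κ : (ZMod N)ˣ) :
    2 / ‖e‖ ^ 2 * cosecSq N κ ∈ hb.translations (hs.1.beltData_isRadicalSpan H) := by
  set D := hs.1.beltData H
  obtain ⟨a, b, hab, hcop⟩ := hs.exists_cosTriple hden
  have hself := self_mem_vietaOrbit (gramTriple planeForm s.vec)
  nth_rw 2 [hab] at hself
  obtain ⟨a', b', hu, ha', hb'⟩ := exists_cosTriple_mem hN hself hcop κ
  obtain ⟨B, hB, hBs, hBu⟩ := exists_compatMatrix_of_mem_vietaOrbit hs.1.skew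
    (hs.1.compatMatrix planeForm_comm) _ hu
  obtain ⟨t, ht, rfl⟩ := exists_mem_labelledSeeds_mat_eq D.Q D.pos s hB
  have htb := hb.of_mem_labelledSeeds ht
  obtain ⟨w0, w2, w1⟩ := cosTriple_abs ha' hb'
  set u := cosTriple N a' b'
  have hu1 : 0 < |u 1| := abs_pos.2 (twoCos_ne_zero hN b')
  have hsin : 0 < Real.sin (Real.pi * (κ : ZMod N).val / N) := by
    have : Fact (1 < N) := ⟨by omega⟩
    have hv : 0 < (κ : ZMod N).val := Nat.pos_of_ne_zero fun h =>
      κ.isUnit.ne_zero ((ZMod.val_eq_zero _).1 h)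
    have hv' : ((κ : ZMod N).val : ℝ) < N := by exact_mod_cast (κ : ZMod N).val_lt
    have hNp : (0 : ℝ) < N := by exact_mod_cast (by omega : 0 < N)
    have hv0 : (0 : ℝ) < (κ : ZMod N).val := by exact_mod_cast hv
    refine Real.sin_pos_of_pos_of_lt_pi (by have := Real.pi_pos; positivity) ?_
    rw [div_lt_iff₀ hNp]
    exact mul_lt_mul_of_pos_left hv' Real.pi_pos
  have hlt : |u 1| < 2 := by
    refine abs_lt_of_sq_lt_sq ?_ two_pos.le
    nlinarith [pow_pos hsin 2]
  obtain ⟨i, j, k, c, hij, hjk, hik, h⟩ := htb.exists_strip (w := fun l => |u l|) hu1 hlt w0 rfl w2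
    (fun i j k h1 h2 h3 => hBu.abs_eq hBs h1 h2 h3)
  have hmove := htb.mutateSeed_strip hij hjk hik h
  have hc := h.b_pos
  -- The gradients of the first two sides and the belt direction `e` lie in one plane. Their Gram
  -- determinant expresses `c` by `ρ = |u 1|` and `‖e‖`: `8c² = ‖e‖² (4 - ρ²) = 4 ‖e‖² sin² (πκ/N)`.
  have key := planar_gram_relation (x := (t.vec i).1) (y := (t.vec j).1) (e := e) (ρ := |u 1|)
    (b := c) h.xx h.yy h.xy (by rw [← he, h.slope_x]; simp) (by rw [← he, h.slope_y])
  have hmem : 1 / c ^ 2 ∈ hb.translations (hs.1.beltData_isRadicalSpan H) := by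
    intro x hx
    refine hb.translate_mem (hs.1.beltData_isRadicalSpan H)
      (mem_exchangeVertices.2 ⟨t, ht, rfl⟩) hx (mem_exchangeVertices.2 ⟨_, ?_, rfl⟩)
    rw [← hmove]
    exact mutateSeed_mem_labelledSeeds (mutateSeed_mem_labelledSeeds ht j) k
  convert hmem using 1
  have hne : ‖e‖ ≠ 0 := norm_ne_zero_iff.2 he0
  rw [sq_abs, w1] at key
  unfold cosecSq
  field_simp
  linear_combination (1 / 4) * key

/-- The rank of the translation lattice of a triangle with an odd denominator. -/
theorem IsTriangleSeed.finrank_translationLattice (hs : IsTriangleSeed s) (hac : IsAcyclic s.mat)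
    {pos : Set AffineFun} (hpos : IsBeltPositivity s pos)
    (hL : Module.Finite ℤ (translationLattice pos s)) {N : ℕ} (hN : Odd N) (h3 : 3 ≤ N)
    (hden : HasDenominator s N) :
    2 * Module.finrank ℤ (translationLattice pos s) = Nat.totient N := by
  have : NeZero N := ⟨by omega⟩
  obtain ⟨H, rfl, hb⟩ := hs.exists_beltData hac hpos
  obtain ⟨E⟩ := nonempty_translations_equiv hs.1 hb
  obtain ⟨e, he0, he⟩ := exists_slope_gradient hs.1 hb
  have hfin : Module.Finite ℤ (hb.translations (hs.1.beltData_isRadicalSpan H)) :=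
    Module.Finite.equiv E.symm
  rw [← E.finrank_eq]
  refine le_antisymm ?_ ?_
  -- Upper bound: multiplication by the nonzero number `slope · coeff` of one vector maps the
  -- translation group into `K`.
  · obtain ⟨K, hK, hKfin, hKrank⟩ := exists_real_subfield hN h3
    obtain ⟨l, hl⟩ := hb.exists_slope_ne_zero
    obtain ⟨a, b, hab, -⟩ := hs.exists_cosTriple hden
    have hO : ∀ i j, gramOf (gramTriple planeForm s.vec) i j ∈ K.toSubfield.toSubring := by
      intro i j
      change _ ∈ K
      by_cases h : i = j
      · simp only [gramOf, Matrix.of_apply, if_pos h]; exact ofNat_mem K 2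
      · simp only [gramOf, Matrix.of_apply, if_neg h, hab]
        generalize -(i + j) = m
        fin_cases m <;> exact hK _
    refine (Nat.mul_le_mul_left 2 (finrank_le_of_mul_mem K _
      (mul_ne_zero hl (hs.coeff_pos l).ne') fun x hx => ?_)).trans hKrank
    exact mul_mem_of_mem_translations hs.1 hb hO hx l
  -- Lower bound: the translations of the strips for units up to sign are independent.
  · rw [← two_mul_card_halfUnits hN h3]
    refine Nat.mul_le_mul_left 2 (card_le_finrank_of_mul_mem (linearIndependent_cosecSq hN h3) _
      (c := 2 / ‖e‖ ^ 2) (by have := norm_ne_zero_iff.2 he0; positivity) fun x => ?_)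
    obtain ⟨κ, hκ⟩ := x.2.1
    rw [← hκ]
    exact cosecSq_mem_translations hs hb hN h3 hden he0 he κ

end OddDenominator



theorem corollary5p6 :
    -- affine quivers
    (∀ (s : Seed AffineFun) (pos : Set AffineFun),
      IsTriangleSeed s → IsAcyclic s.mat → IsMutationFinite s.mat → IsBeltPositivity s pos →
      ∀ x : exchangeVertices planeForm pos s,
        HasPolynomialGrowth (exchangeGraph planeForm pos s) x ∧
        Module.Finite ℤ (translationLattice pos s) ∧
        IsGrowthRate (exchangeGraph planeForm pos s) x
          (Module.finrank ℤ (translationLattice pos s)) ∧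
        ∀ n : ℕ, 1 ≤ n → HasDenominator s (2 * n + 1) →
          IsGrowthRate (exchangeGraph planeForm pos s) x (Nat.totient (2 * n + 1) / 2) ∧
          Module.finrank ℤ (translationLattice pos s) = Nat.totient (2 * n + 1) / 2) ∧
    -- mutation-finite quivers other than the Markov quiver
    (∀ (V : Type*) [AddCommGroup V] [Module ℝ V] (Q : LinearMap.BilinForm ℝ V) (pos : Set V)
      (s : Seed V), (∀ x y, Q x y = Q y x) → IsSeed Q s → IsMutationFinite s.mat →
      s.mat ≠ markovMatrix → s.mat ≠ -markovMatrix →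
      ∀ x : exchangeVertices Q pos s, HasPolynomialGrowth (exchangeGraph Q pos s) x) := by
  refine ⟨fun s pos hs hac hfin hpos x => ?_, fun V _ _ Q pos s hQ hs hfin hm hm' x =>
    hs.hasPolynomialGrowth hQ hfin hm hm' pos x⟩
  obtain ⟨hpoly, hL, hrate⟩ := hs.growth hac hfin hpos x
  refine ⟨hpoly, hL, hrate, fun n hn hden => ?_⟩
  have hrank : Module.finrank ℤ (translationLattice pos s) = Nat.totient (2 * n + 1) / 2 := by
    rw [← hs.finrank_translationLattice hac hpos hL ⟨n, rfl⟩ (by omega) hden]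
    omega
  exact ⟨hrank ▸ hrate, hrank⟩
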